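/- **Setting.** Let $\Omega=(0,L_0)\times(0,L_1)$ with $L_0,L_1>0$, let $\epsilon\in(0,1)$, and impose periodic boundary conditions on $\Omega$; $\|\cdot\|$ and $(\cdot,\cdot)$ are the norm and inner product of $L^2(\Omega)$, $\Delta$ is the (weak) periodic Laplacian, and $\|v\|_{-1}^2=((-\Delta)^{-1}v,v)$ for mean-zero $v$. The phase field crystal (PFC) equation is $$\partial_t\Phi=\Delta\mu,\qquad \mu=(1+\Delta)^2\Phi+\Phi^3-\epsilon\Phi .$$ Let $k\in\{3,4,5\}$, $T>0$, $N\ge 1$, $\tau=T/N$, $t_n=n\tau$, $\Phi^n=\Phi(t_n)$ and $\nabla_\tau v^n=v^n-v^{n-1}$. The kernels $b_j$ are given by $\sum_{\ell=1}^{k}\frac1\ell(1-\zeta)^{\ell-1}=\sum_{j=0}^{k-1}b_j\zeta^j$ ($b_j=0$ for $j\ge k$), and $D_kv^n=\frac1\tau\sum_{j=1}^n b_{n-j}\nabla_\tau v^j$. The BDF-$k$ scheme is $$D_k\phi^n=\Delta\mu^n,\qquad \mu^n=(1+\Delta)^2\phi^n+(\phi^n)^3-\epsilon\phi^n,\qquad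 k\le n\le N,$$ with given starting values $\phi^0,\dots,\phi^{k-1}\in L^2(\Omega)$. The energy is $E[u]=\frac12\|(1+\Delta)u\|^2+\frac14\|u^2-\epsilon\|^2-\frac14\epsilon^2|\Omega|$ and the modified energy is $$\mathcal E_k[\vec\phi^{\,n}]=E[\phi^n]+\tfrac1\tau\,\mathcal G_k[\nabla_\tau\vec\phi^{\,n}],$$ where, with $v_j=\nabla_\tau\phi^j$ and $\delta v_n=v_n-v_{n-1}$, $$\mathcal G_3=\tfrac16\|v_n\|_{-1}^2+\tfrac16\|\tfrac74v_n-v_{n-1}\|_{-1}^2,$$ $$\mathcal G_4=\tfrac{13627}{43008}\|v_n\|_{-1}^2+\tfrac7{24}\|\tfrac{65}{56}v_n-v_{n-1}\|_{-1}^2+\tfrac18\|\tfrac32\delta v_n+v_{n-2}\|_{-1}^2,$$ $$\mathcal G_5=\tfrac{1198850903}{1678080000}\|v_n\|_{-1}^2+\tfrac{437}{900}\|\tfrac{4931}{6992}v_n-v_{n-1}\|_{-1}^2+\tfrac9{40}\|\tfrac{23}{18}\delta v_n+v_{n-2}\|_{-1}^2+\tfrac1{10}\|2\delta v_n+2v_{n-2}-v_{n-3}\|_{-1}^2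 .$$ **Assumption A2 (with constant $c_0$).** The starting values preserve the volume, $(\phi^\ell,1)=(\phi^0,1)$ for $1\le\ell\le k-1$; $\tau\le\frac{2}{3\epsilon}\min\{b_0,\sigma_{Lk}\}$ with $\sigma_{L3}=\frac{95}{48}$, $\sigma_{L4}=\frac{4919}{3072}$, $\sigma_{L5}=\frac{646631}{1920000}$; and $\phi^{k-1}\in H^2(\Omega)$ (periodic) with $\mathcal E_k[\vec\phi^{\,k-1}]\le c_0$. **Constants.** Put $\rho_3=\frac{10}3$, $\rho_4=6$, $\rho_5=\frac{96}5$; $\mathfrak m_{13}=\frac{95}{48}$, $\mathfrak m_{14}=1.628$, $\mathfrak m_{15}=0.3711$; $\mathfrak m_{3k}=\frac{7\rho_k}{2(7-k)}$. Let $\theta_0=1/b_0$ and $\theta_m=-\frac1{b_0}\sum_{i=0}^{m-1}\theta_i b_{m-i}$ for $m\ge1$. **Theorem.** There are constants as follows. * For each $k\in\{3,4,5\}$, constants $\mathfrak m_{2k}>0$ and $c_{I,k}>1$ depending only on $k$, such that $\lambda_{\max}(B^{T}B)\le\mathfrak m_{2k}$ for the lower triangular Toeplitz matrix $B=(b_{i-j})_{j\le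 i}$ of every order, and such that for every real sequence $(v^n)$ and all $n\ge k$ $$\Big|\sum_{\ell=1}^{k-1}\nabla_\tau v^\ell\sum_{j=k}^n\theta_{n-j}b_{j-\ell}\Big|\le\frac{c_{I,k}\rho_k}8\Big(\frac k7\Big)^{n-k}\sum_{\ell=1}^{k-1}|\nabla_\tau v^\ell| .$$ * For each $\Omega$, a constant $c_\Omega>0$ depending only on $\Omega$, such that $\|v\|_{L^\infty}\le c_\Omega(\|v\|+\|\Delta v\|)$ for all periodic $v\in H^2(\Omega)$. * For all $\Omega$, $\epsilon$ and initial data $\Phi_0$, a constant $c_2>0$ depending only on these, such that $\|\Phi(t)\|_{L^\infty}\le c_2$ for all $t\in[0,T]$, for every $T>0$, every $k\in\{3,4,5\}$ and every solution $\Phi\in C^{k+1}([0,T];L^2(\Omega))$ of the PFC equation on $[0,T]$ with $\Phi(0)=\Phi_0$. * For each such $k$, $T$ and $\Phi$, a constant $C_\phi>0$ independent of $N$, $\tau$, $c_0$ and of the numerical solution. For given $c_0$, put $$c_1=c_\Omega\sqrt{8c_0+2(2+\epsilon)^2|\Omega|},\quad c_3=c_2^2+c_1c_2+c_1^2+\epsilon,\quad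 c_4=\frac{250\,\mathfrak m_{2k}^2}{\mathfrak m_{1k}^5}+\frac{2c_3^2\,\mathfrak m_{2k}\mathfrak m_{3k}}{\mathfrak m_{1k}^2}.$$ If $\phi^0,\dots,\phi^N$ satisfies the BDF-$k$ scheme, A2 holds with $c_0$, and $\tau\le 1/(2c_4)$, then for all $k\le n\le N$ $$\|\Phi^n-\phi^n\|\le\frac{7\rho_k}{7-k}\exp(2c_4t_{n-k+1})\Big(c_{I,k}\sum_{\ell=0}^{k-1}\|\Phi^\ell-\phi^\ell\|+C_\phi\,t_{n-k+1}\,\tau^k\Big).$$ -/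

import Mathlib

open MeasureTheory
open scoped ContDiff InnerProductSpace

noncomputable section

namespace PFC

/-! ### BDF kernels, DOC kernels and the constants attached to them -/

/-- The BDF-`k` kernels `b_j`, generated by
`∑_{ℓ=1}^{k} (1/ℓ) (1 - ζ)^{ℓ-1} = ∑_j b_j ζ^j` (so `b_j = 0` for `j ≥ k`). -/
def bdfKernel (k j : ℕ) : ℝ :=
  (∑ l ∈ Finset.Icc 1 k,
    Polynomial.C (1 / (l : ℝ)) * (1 - Polynomial.X) ^ (l - 1) : Polynomial ℝ).coeff j

/-- The backward difference `v^n - v^{n-1}` (used for `n ≥ 1` only). -/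
def backDiff {V : Type*} [AddCommGroup V] (v : ℕ → V) (n : ℕ) : V := v n - v (n - 1)

/-- The BDF-`k` formula `D_k v^n = (1/τ) ∑_{j=1}^{n} b_{n-j} (v^j - v^{j-1})`. -/
def bdf {V : Type*} [AddCommGroup V] [Module ℝ V] (k : ℕ) (τ : ℝ) (v : ℕ → V) (n : ℕ) : V :=
  (1 / τ) • ∑ j ∈ Finset.Icc 1 n, bdfKernel k (n - j) • backDiff v j

/-- The discrete orthogonal convolution kernels `θ_j` of the BDF-`k` kernels:
`θ_0 = 1 / b_0` and `θ_m = -(1 / b_0) ∑_{i=0}^{m-1} θ_i b_{m-i}`. -/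
def docKernel (k : ℕ) : ℕ → ℝ
  | 0 => 1 / bdfKernel k 0
  | m + 1 => -(1 / bdfKernel k 0) *
      ∑ i : Fin (m + 1), docKernel k i * bdfKernel k (m + 1 - (i : ℕ))
  decreasing_by exact i.2

/-- The starting effect
`v_I^{(k,n)} = ∑_{ℓ=1}^{k-1} (v^ℓ - v^{ℓ-1}) ∑_{j=k}^{n} θ_{n-j} b_{j-ℓ}`. -/
def startingEffect (k : ℕ) (v : ℕ → ℝ) (n : ℕ) : ℝ :=
  ∑ l ∈ Finset.Icc 1 (k - 1), backDiff v l *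
    ∑ j ∈ Finset.Icc k n, docKernel k (n - j) * bdfKernel k (j - l)

/-- The lower triangular Toeplitz matrix of order `m` built from the BDF-`k` kernels. -/
def bdfMatrix (k m : ℕ) : Matrix (Fin m) (Fin m) ℝ :=
  Matrix.of fun i j => if j ≤ i then bdfKernel k ((i : ℕ) - (j : ℕ)) else 0

/-- The constants `ρ_k`, for `k = 3, 4, 5`. -/
def rho : ℕ → ℝ
  | 3 => 10 / 3
  | 4 => 6
  | 5 => 96 / 5
  | _ => 0

/-- The constants `σ_{Lk}`, for `k = 3, 4, 5`. -/
def sigmaL : ℕ → ℝ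
  | 3 => 95 / 48
  | 4 => 4919 / 3072
  | 5 => 646631 / 1920000
  | _ => 0

/-- The constants `𝔪_{1k}`, for `k = 3, 4, 5`. -/
def m1 : ℕ → ℝ
  | 3 => 95 / 48
  | 4 => 1.628
  | 5 => 0.3711
  | _ => 0

/-- The constants `𝔪_{3k} = 7 ρ_k / (2 (7 - k))`. -/
def m3 (k : ℕ) : ℝ := 7 * rho k / (2 * (7 - (k : ℝ)))

/-- The nonnegative quadratic functionals `𝒢_k` of the discrete gradient structure, evaluated at
`(v_n, v_{n-1}, …)`, where `q` is the quadratic form that replaces squaring. -/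
def gradFunctional {V : Type*} [AddCommGroup V] [Module ℝ V]
    (k : ℕ) (q : V → ℝ) (v : ℕ → V) (n : ℕ) : ℝ :=
  match k with
  | 3 => 1 / 6 * q (v n) + 1 / 6 * q ((7 / 4 : ℝ) • v n - v (n - 1))
  | 4 => 13627 / 43008 * q (v n) + 7 / 24 * q ((65 / 56 : ℝ) • v n - v (n - 1))
      + 1 / 8 * q ((3 / 2 : ℝ) • (v n - v (n - 1)) + v (n - 2))
  | 5 => 1198850903 / 1678080000 * q (v n)
      + 437 / 900 * q ((4931 / 6992 : ℝ) • v n - v (n - 1))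
      + 9 / 40 * q ((23 / 18 : ℝ) • (v n - v (n - 1)) + v (n - 2))
      + 1 / 10 * q ((2 : ℝ) • (v n - v (n - 1)) + (2 : ℝ) • v (n - 2) - v (n - 3))
  | _ => 0

/-! ### Periodic functions on a rectangle -/

/-- The period cell `Ω = (0, L₀) × (0, L₁)`. -/
def cell (L : Fin 2 → ℝ) : Set (EuclideanSpace ℝ (Fin 2)) :=
  {x | ∀ i, x i ∈ Set.Ioo 0 (L i)}

/-- Lebesgue measure on the period cell. -/
abbrev cellMeasure (L : Fin 2 → ℝ) : Measure (EuclideanSpace ℝ (Fin 2)) :=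
  volume.restrict (cell L)

/-- The real Hilbert space `L²(Ω)`. -/
abbrev L2 (L : Fin 2 → ℝ) : Type := Lp ℝ 2 (cellMeasure L)

/-- Smooth functions on the plane that are `Ω`-periodic. -/
def IsPeriodicTest (L : Fin 2 → ℝ) (ψ : EuclideanSpace ℝ (Fin 2) → ℝ) : Prop :=
  ContDiff ℝ ∞ ψ ∧ ∀ x i, ψ (x + EuclideanSpace.single i (L i)) = ψ x

/-- `w ∈ L²(Ω)` is the weak Laplacian of `u ∈ L²(Ω)` under periodic boundary conditions. -/
def HasLaplacian (L : Fin 2 → ℝ) (u w : L2 L) : Prop :=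
  ∀ ψ : EuclideanSpace ℝ (Fin 2) → ℝ, IsPeriodicTest L ψ →
    ∫ x, u x * Laplacian.laplacian ψ x ∂(cellMeasure L) = ∫ x, w x * ψ x ∂(cellMeasure L)

/-- Membership in the periodic Sobolev space `H²(Ω)`; on a periodic cell this is the domain of
the weak Laplacian. -/
def InH2 (L : Fin 2 → ℝ) (u : L2 L) : Prop := ∃ w : L2 L, HasLaplacian L u w

open Classical in
/-- The weak Laplacian of `u` (unique where it exists, and `0` by convention elsewhere). -/
def lap (L : Fin 2 → ℝ) (u : L2 L) : L2 L :=
  if h : InH2 L u then h.choose else 0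

/-- The integral `(u, 1)` over the cell. -/
def mean (L : Fin 2 → ℝ) (u : L2 L) : ℝ := ∫ x, u x ∂(cellMeasure L)

open Classical in
/-- `(-Δ)⁻¹ v` for mean-zero `v`: the mean-zero `g` with `-Δ g = v`. -/
def invNegLap (L : Fin 2 → ℝ) (v : L2 L) : L2 L :=
  if h : ∃ g : L2 L, mean L g = 0 ∧ HasLaplacian L g (-v) then h.choose else 0

/-- The squared `H⁻¹` norm `‖v‖²_{-1} = ((-Δ)⁻¹ v, v)` of a mean-zero `v`. -/
def negNormSq (L : Fin 2 → ℝ) (v : L2 L) : ℝ := ⟪invNegLap L v, v⟫_ℝ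

/-! ### The phase field crystal equation and its BDF discretization -/

/-- `u` is regular enough and `μ = (1 + Δ)² u + u³ - ε u` in `L²(Ω)`. -/
def IsChemicalPotential (L : Fin 2 → ℝ) (ε : ℝ) (u μ : L2 L) : Prop :=
  InH2 L u ∧ InH2 L (u + lap L u) ∧
    ∀ᵐ x ∂(cellMeasure L),
      μ x = ((u + lap L u) + lap L (u + lap L u)) x + (u x) ^ 3 - ε * u x

/-- `Φ` solves `∂_t Φ = Δ μ`, `μ = (1 + Δ)² Φ + Φ³ - ε Φ` on `[0, T]`, periodically in space. -/
def IsPFCSolution (L : Fin 2 → ℝ) (ε T : ℝ) (Φ : ℝ → L2 L) : Prop :=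
  ∀ t ∈ Set.Icc 0 T, ∃ μ : L2 L, IsChemicalPotential L ε (Φ t) μ ∧
    HasLaplacian L μ (derivWithin Φ (Set.Icc 0 T) t)

/-- `φ^0, …, φ^N` satisfies the BDF-`k` implicit scheme `D_k φ^n = Δ μ^n`,
`μ^n = (1 + Δ)² φ^n + (φ^n)³ - ε φ^n` for `k ≤ n ≤ N`. -/
def IsBDFSolution (k : ℕ) (L : Fin 2 → ℝ) (ε τ : ℝ) (N : ℕ) (φ : ℕ → L2 L) : Prop :=
  ∀ n, k ≤ n → n ≤ N → ∃ μ : L2 L, IsChemicalPotential L ε (φ n) μ ∧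
    HasLaplacian L μ (bdf k τ φ n)

/-- The free energy `E[u] = ½‖(1 + Δ)u‖² + ¼‖u² - ε‖² - ¼‖ε‖²`. -/
def energy (L : Fin 2 → ℝ) (ε : ℝ) (u : L2 L) : ℝ :=
  1 / 2 * ‖u + lap L u‖ ^ 2
    + 1 / 4 * ∫ x, ((u x) ^ 2 - ε) ^ 2 ∂(cellMeasure L)
    - 1 / 4 * (ε ^ 2 * volume.real (cell L))

/-- The modified energy `E[φ^n] + (1/τ) (𝒢_k[∇_τ φ^n], 1)_{-1}`. -/
def modifiedEnergy (k : ℕ) (L : Fin 2 → ℝ) (ε τ : ℝ) (φ : ℕ → L2 L) (n : ℕ) : ℝ :=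
  energy L ε (φ n) + 1 / τ * gradFunctional k (negNormSq L) (backDiff φ) n

/-- Assumption A1: the starting values preserve the volume. -/
def AssumptionA1 (k : ℕ) (L : Fin 2 → ℝ) (φ : ℕ → L2 L) : Prop :=
  ∀ l, 1 ≤ l → l ≤ k - 1 → mean L (φ l) = mean L (φ 0)

/-- Assumption A2: A1, the time-step restriction `τ ≤ (2/(3ε)) min {b_0, σ_{Lk}}`, and a modified
energy of the starting values that is finite and at most `c₀`. -/
def AssumptionA2 (k : ℕ) (L : Fin 2 → ℝ) (ε τ : ℝ) (φ : ℕ → L2 L) (c₀ : ℝ) : Prop :=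
  AssumptionA1 k L φ ∧ τ ≤ 2 / (3 * ε) * min (bdfKernel k 0) (sigmaL k) ∧
    InH2 L (φ (k - 1)) ∧ modifiedEnergy k L ε τ φ (k - 1) ≤ c₀

/-- `c₁ = c_Ω √(8 c₀ + 2 (2 + ε)² |Ω|)`. -/
def c1 (L : Fin 2 → ℝ) (ε cΩ c₀ : ℝ) : ℝ :=
  cΩ * Real.sqrt (8 * c₀ + 2 * (2 + ε) ^ 2 * volume.real (cell L))

/-- `c₃ = c₂² + c₁ c₂ + c₁² + ε`. -/
def c3 (ε a₁ a₂ : ℝ) : ℝ := a₂ ^ 2 + a₁ * a₂ + a₁ ^ 2 + ε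

/-- `c₄ = 250 𝔪_{2k}² / 𝔪_{1k}⁵ + 2 c₃² 𝔪_{2k} 𝔪_{3k} / 𝔪_{1k}²`. -/
def c4 (k : ℕ) (m2 a₃ : ℝ) : ℝ :=
  250 * m2 ^ 2 / m1 k ^ 5 + 2 * a₃ ^ 2 * m2 * m3 k / m1 k ^ 2

end PFC

end

/-!
The periodic Laplacian is diagonalized by the waves `cos (2π k·x/L) + sin (2π k·x/L)`, `k ∈ ℤ²`,
which form a real orthonormal basis of `L²(Ω)` up to normalization: `-Δ` becomes multiplication by
`freq L k ≥ 0`. Both estimates behind the theorem are proved one Fourier mode at a time and summed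
by Parseval.

*Uniform bounds.* The BDF formula has a discrete gradient structure: `(D_k φ^n, ∇_τ φ^n)_{-1}`
dominates the increment of `𝒢_k / τ`, so the modified energy decreases and bounds the numerical
solution in `H² ⊂ L^∞`. The exact solution is bounded in the same way by the decrease of `E`. On
bounded functions the nonlinearity is Lipschitz.

*Convergence.* The DOC kernels `θ` invert the BDF kernels under convolution, hence convolving the
error equation with `θ` isolates `∇_τ e^n`. Positive definiteness of the convolution with `θ`
controls the elliptic terms, the geometric decay `|θ_m| ≤ (ρ_k / 4) (k / 7) ^ m` controls the
contributions of the starting values and of the consistency errors `O(τ^k)`, and a discrete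
Gronwall inequality concludes.
-/

noncomputable section

open Finset MeasureTheory
open scoped ContDiff InnerProductSpace

namespace PFC

/-! ### Causal convolution kernels -/

/-- The causal discrete convolution `∑_{i ≤ p} f_{p-i} g_i` of two sequences. -/
def conv (f g : ℕ → ℝ) (p : ℕ) : ℝ := ∑ i ∈ range (p + 1), f (p - i) * g i

lemma conv_eq_coeff (f g : ℕ → ℝ) (p : ℕ) :
    conv f g p = (PowerSeries.mk g * PowerSeries.mk f).coeff p := by
  rw [PowerSeries.coeff_mul, Nat.sum_antidiagonal_eq_sum_range_succ_mk, conv]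
  simp only [PowerSeries.coeff_mk, mul_comm]

lemma mk_conv (f g : ℕ → ℝ) :
    PowerSeries.mk (conv f g) = PowerSeries.mk g * PowerSeries.mk f := by
  ext p
  rw [PowerSeries.coeff_mk, conv_eq_coeff]

lemma conv_conv_of_mk_mul_mk_eq_one {f g : ℕ → ℝ}
    (h : PowerSeries.mk f * PowerSeries.mk g = 1) (x : ℕ → ℝ) : conv g (conv f x) = x := by
  ext p
  rw [conv_eq_coeff, mk_conv, mul_assoc, h, mul_one, PowerSeries.coeff_mk]

/-- The sequence `x` delayed by `i` steps and extended by zero to the first `i` indices. -/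
def delay (i : ℕ) (x : ℕ → ℝ) (p : ℕ) : ℝ := if p < i then 0 else x (p - i)

lemma delay_add_self (i : ℕ) (x : ℕ → ℝ) (p : ℕ) : delay i x (i + p) = x p := by
  simp [delay]

lemma delay_add_sub {i k : ℕ} (hi : i ≤ k) (x : ℕ → ℝ) (p : ℕ) :
    delay k x (k + p - i) = delay i x p := by
  unfold delay
  split_ifs <;> first | rfl | omega | (congr 1; omega)

lemma sum_range_delay (i : ℕ) (x : ℕ → ℝ) (M : ℕ) :
    ∑ p ∈ range M, delay i x p = ∑ p ∈ range (M - i), x p := by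
  induction M with
  | zero => simp
  | succ M ih =>
    rw [sum_range_succ, ih, delay]
    split_ifs with hM
    · rw [show M + 1 - i = M - i by omega, add_zero]
    · rw [show M + 1 - i = M - i + 1 by omega, sum_range_succ]

lemma sum_delay_sq_le (i : ℕ) (x : ℕ → ℝ) (M : ℕ) :
    ∑ p ∈ range M, delay i x p ^ 2 ≤ ∑ p ∈ range M, x p ^ 2 := by
  have hsq : ∀ p, delay i x p ^ 2 = delay i (fun p => x p ^ 2) p := fun p => by
    unfold delay; split_ifs <;> simp
  simp only [hsq, sum_range_delay]
  exact sum_le_sum_of_subset_of_nonneg (range_subset_range.2 (Nat.sub_le _ _))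
    fun p _ _ => sq_nonneg _

lemma conv_eq_sum_delay {k : ℕ} {b : ℕ → ℝ} (hb : ∀ j, k ≤ j → b j = 0) (x : ℕ → ℝ) (p : ℕ) :
    conv b x p = ∑ i ∈ range k, b i * delay i x p := by
  have hreflect : conv b x p = ∑ i ∈ range (p + 1), b i * delay i x p := by
    rw [conv, ← sum_range_reflect]
    refine sum_congr rfl fun i hi => ?_
    have hi : i ≤ p := by simpa [Nat.lt_succ_iff] using hi
    rw [delay, if_neg (by omega)]
    congr 2; omega
  have hvanish : ∀ i, i ∉ range k ∨ i ∉ range (p + 1) → b i * delay i x p = 0 := fun i hi => by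
    simp only [mem_range, not_lt] at hi
    rcases hi with hi | hi
    · rw [hb i hi, zero_mul]
    · rw [delay, if_pos (by omega), mul_zero]
  rw [hreflect, sum_subset (range_subset_range.2 (Nat.le_add_left (p + 1) k))
      fun i _ hi => hvanish i (.inr hi),
    ← sum_subset (range_subset_range.2 (Nat.le_add_right k (p + 1)))
      fun i _ hi => hvanish i (.inl hi)]

/-- Convolution with `b` is coercive with constant `s` on `ℓ²(0, M)`, uniformly in `M`. -/
def IsCoerciveKernel (s : ℝ) (b : ℕ → ℝ) : Prop :=
  ∀ (x : ℕ → ℝ) (M : ℕ), s * ∑ p ∈ range M, x p ^ 2 ≤ ∑ p ∈ range M, x p * conv b x p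

/-- Convolution with `b` has squared operator norm at most `K` on `ℓ²(0, M)`, uniformly in `M`. -/
def IsL2BoundedKernel (K : ℝ) (b : ℕ → ℝ) : Prop :=
  ∀ (x : ℕ → ℝ) (M : ℕ), ∑ p ∈ range M, conv b x p ^ 2 ≤ K * ∑ p ∈ range M, x p ^ 2

lemma isL2BoundedKernel_of_support {k : ℕ} {b : ℕ → ℝ} (hb : ∀ j, k ≤ j → b j = 0) :
    IsL2BoundedKernel (k * ∑ i ∈ range k, b i ^ 2) b := fun x M =>
  calc ∑ p ∈ range M, conv b x p ^ 2
      ≤ ∑ p ∈ range M, (∑ i ∈ range k, b i ^ 2) * ∑ i ∈ range k, delay i x p ^ 2 :=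
        sum_le_sum fun p _ => by
          rw [conv_eq_sum_delay hb]
          exact sum_mul_sq_le_sq_mul_sq _ _ _
    _ = (∑ i ∈ range k, b i ^ 2) * ∑ i ∈ range k, ∑ p ∈ range M, delay i x p ^ 2 := by
        rw [← mul_sum, sum_comm]
    _ ≤ (∑ i ∈ range k, b i ^ 2) * ∑ _i ∈ range k, ∑ p ∈ range M, x p ^ 2 := by
        have hnonneg : 0 ≤ ∑ i ∈ range k, b i ^ 2 := sum_nonneg fun _ _ => sq_nonneg _
        exact mul_le_mul_of_nonneg_left (sum_le_sum fun i _ => sum_delay_sq_le i x M) hnonneg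
    _ = (k * ∑ i ∈ range k, b i ^ 2) * ∑ p ∈ range M, x p ^ 2 := by
        rw [sum_const, card_range, nsmul_eq_mul]; ring

section Inverse

variable {s K : ℝ} {b θ : ℕ → ℝ} (hinv : PowerSeries.mk θ * PowerSeries.mk b = 1)
include hinv

lemma IsCoerciveKernel.inverse (hb : IsCoerciveKernel s b) (hs : 0 ≤ s)
    (hK : IsL2BoundedKernel K b) (hK0 : 0 < K) : IsCoerciveKernel (s / K) θ := fun x M => by
  have hcoercive := hb (conv θ x) M
  have hbound := hK (conv θ x) M
  simp only [conv_conv_of_mk_mul_mk_eq_one hinv] at hcoercive hbound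
  calc s / K * ∑ p ∈ range M, x p ^ 2
      ≤ s / K * (K * ∑ p ∈ range M, conv θ x p ^ 2) := by gcongr
    _ = s * ∑ p ∈ range M, conv θ x p ^ 2 := by field_simp
    _ ≤ ∑ p ∈ range M, x p * conv θ x p := by simpa only [mul_comm (x _)] using hcoercive

lemma IsCoerciveKernel.inverse_isL2Bounded (hb : IsCoerciveKernel s b) (hs : 0 < s) :
    IsL2BoundedKernel (1 / s ^ 2) θ := fun x M => by
  have hcoercive := hb (conv θ x) M
  simp only [conv_conv_of_mk_mul_mk_eq_one hinv] at hcoercive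
  have hyoung : ∑ p ∈ range M, conv θ x p * x p ≤
      s / 2 * ∑ p ∈ range M, conv θ x p ^ 2 + 1 / (2 * s) * ∑ p ∈ range M, x p ^ 2 := by
    rw [mul_sum, mul_sum, ← sum_add_distrib]
    refine sum_le_sum fun p _ => sub_nonneg.1 ?_
    have : s / 2 * conv θ x p ^ 2 + 1 / (2 * s) * x p ^ 2 - conv θ x p * x p =
        1 / (2 * s) * (s * conv θ x p - x p) ^ 2 := by field_simp; ring
    rw [this]
    positivity
  calc ∑ p ∈ range M, conv θ x p ^ 2
      = 2 / s * (s / 2 * ∑ p ∈ range M, conv θ x p ^ 2) := by field_simp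
    _ ≤ 2 / s * (1 / (2 * s) * ∑ p ∈ range M, x p ^ 2) :=
        mul_le_mul_of_nonneg_left (by linarith) (by positivity)
    _ = 1 / s ^ 2 * ∑ p ∈ range M, x p ^ 2 := by field_simp

end Inverse

lemma eigenvalue_transpose_mul_self_le {ι : Type*} [Fintype ι] [DecidableEq ι]
    {A : Matrix ι ι ℝ} {K lam : ℝ} (hA : ∀ v, A.mulVec v ⬝ᵥ A.mulVec v ≤ K * (v ⬝ᵥ v))
    (h : Module.End.HasEigenvalue (Matrix.toLin' (A.transpose * A)) lam) : lam ≤ K := by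
  obtain ⟨v, hv⟩ := h.exists_hasEigenvector
  have hrayleigh : A.mulVec v ⬝ᵥ A.mulVec v = lam * (v ⬝ᵥ v) := by
    have heigen := hv.apply_eq_smul
    rw [Matrix.toLin'_apply, ← Matrix.mulVec_mulVec] at heigen
    rw [Matrix.dotProduct_mulVec, ← Matrix.mulVec_transpose, dotProduct_comm, heigen,
      dotProduct_smul, smul_eq_mul]
  have hpos : 0 < v ⬝ᵥ v := by
    simpa using Matrix.dotProduct_star_self_pos_iff.2 hv.2
  exact le_of_mul_le_mul_right (hrayleigh ▸ hA v) hpos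

/-! ### The BDF and DOC kernels -/

lemma bdfKernel_eq_sum_choose (k j : ℕ) :
    bdfKernel k j = ∑ l ∈ Icc 1 k, 1 / (l : ℝ) * ((-1) ^ j * (l - 1).choose j) := by
  have hcoeff : ∀ n, ((1 - Polynomial.X : Polynomial ℝ) ^ n).coeff j = (-1) ^ j * n.choose j :=
    fun n => by
      have : (1 - Polynomial.X : Polynomial ℝ) ^ n =
          ((1 + Polynomial.X) ^ n).comp (Polynomial.C (-1) * Polynomial.X) := by
        simp [sub_eq_add_neg]
      rw [this, Polynomial.comp_C_mul_X_coeff, Polynomial.coeff_one_add_X_pow, mul_comm]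
  simp only [bdfKernel, Polynomial.finsetSum_coeff, Polynomial.coeff_C_mul, hcoeff]

lemma bdfKernel_eq_zero {k j : ℕ} (hj : k ≤ j) : bdfKernel k j = 0 := by
  rw [bdfKernel_eq_sum_choose]
  refine sum_eq_zero fun l hl => ?_
  rw [mem_Icc] at hl
  rw [Nat.choose_eq_zero_of_lt (by omega), Nat.cast_zero, mul_zero, mul_zero]

lemma bdfKernel_zero_pos {k : ℕ} (hk : 0 < k) : 0 < bdfKernel k 0 := by
  rw [bdfKernel_eq_sum_choose]
  refine sum_pos (fun l hl => ?_) ⟨1, mem_Icc.2 ⟨le_rfl, hk⟩⟩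
  have : 0 < l := (mem_Icc.1 hl).1
  simp only [pow_zero, Nat.choose_zero_right, Nat.cast_one, mul_one]
  positivity

lemma bdfKernel_three :
    bdfKernel 3 0 = 11 / 6 ∧ bdfKernel 3 1 = -7 / 6 ∧ bdfKernel 3 2 = 1 / 3 := by
  norm_num [bdfKernel_eq_sum_choose, sum_Icc_succ_top, Nat.choose]

lemma bdfKernel_four : bdfKernel 4 0 = 25 / 12 ∧ bdfKernel 4 1 = -23 / 12 ∧
    bdfKernel 4 2 = 13 / 12 ∧ bdfKernel 4 3 = -1 / 4 := by
  norm_num [bdfKernel_eq_sum_choose, sum_Icc_succ_top, Nat.choose]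

lemma bdfKernel_five : bdfKernel 5 0 = 137 / 60 ∧ bdfKernel 5 1 = -163 / 60 ∧
    bdfKernel 5 2 = 137 / 60 ∧ bdfKernel 5 3 = -21 / 20 ∧ bdfKernel 5 4 = 1 / 5 := by
  norm_num [bdfKernel_eq_sum_choose, sum_Icc_succ_top, Nat.choose]

lemma mk_docKernel_mul_mk_bdfKernel {k : ℕ} (hk : 0 < k) :
    PowerSeries.mk (docKernel k) * PowerSeries.mk (bdfKernel k) = 1 := by
  have hb := (bdfKernel_zero_pos hk).ne'
  ext p
  rw [← conv_eq_coeff, conv, sum_range_succ, PowerSeries.coeff_one]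
  cases p with
  | zero => simp [docKernel, hb]
  | succ m =>
    rw [if_neg (Nat.succ_ne_zero m), Nat.sub_self, docKernel,
      Fin.sum_univ_eq_sum_range (fun i => docKernel k i * bdfKernel k (m + 1 - i)) (m + 1)]
    simp only [mul_comm (bdfKernel k _)]
    field_simp
    ring

lemma docKernel_recurrence {k n : ℕ} (hk : 0 < k) (hn : n ≠ 0) (hkn : k ≤ n + 1) :
    ∑ i ∈ range k, bdfKernel k i * docKernel k (n - i) = 0 := by
  have hconv : conv (bdfKernel k) (docKernel k) n = 0 := by
    rw [conv_eq_coeff, mk_docKernel_mul_mk_bdfKernel hk, PowerSeries.coeff_one, if_neg hn]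
  rw [← hconv, conv_eq_sum_delay fun j hj => bdfKernel_eq_zero hj]
  refine sum_congr rfl fun i hi => ?_
  rw [mem_range] at hi
  rw [delay, if_neg (by omega)]

lemma gradFunctional_sub_le {k n : ℕ} (hk : k ∈ Set.Icc 3 5) (v : ℕ → ℝ) :
    gradFunctional k (fun x : ℝ => x ^ 2) v n - gradFunctional k (fun x : ℝ => x ^ 2) v (n - 1)
      + sigmaL k / 2 * v n ^ 2 ≤ v n * ∑ i ∈ range k, bdfKernel k i * v (n - i) := by
  obtain ⟨hk3, hk5⟩ := hk
  interval_cases k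
  · simp only [gradFunctional, sigmaL, sum_range_succ, sum_range_zero, bdfKernel_three,
      smul_eq_mul, Nat.sub_sub, Nat.sub_zero, Nat.reduceAdd]
    linarith [sq_nonneg (v n - 7 / 4 * v (n - 1) + v (n - 2))]
  · simp only [gradFunctional, sigmaL, sum_range_succ, sum_range_zero, bdfKernel_four,
      smul_eq_mul, Nat.sub_sub, Nat.sub_zero, Nat.reduceAdd]
    linarith [sq_nonneg (-v n + 3 / 2 * v (n - 1) - 3 / 2 * v (n - 2) + v (n - 3)),
      sq_nonneg (v n - 29 / 32 * v (n - 1) + v (n - 2))]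
  · simp only [gradFunctional, sigmaL, sum_range_succ, sum_range_zero, bdfKernel_five,
      smul_eq_mul, Nat.sub_sub, Nat.sub_zero, Nat.reduceAdd]
    linarith [sq_nonneg (v n - 2 * v (n - 1) + 2 * v (n - 2) - 2 * v (n - 3) + v (n - 4)),
      sq_nonneg (-v n + 7 / 10 * v (n - 1) - 7 / 10 * v (n - 2) + v (n - 3)),
      sq_nonneg (v n + 187 / 800 * v (n - 1) + v (n - 2))]

lemma gradFunctional_nonneg {V : Type*} [AddCommGroup V] [Module ℝ V] (k n : ℕ) {q : V → ℝ}
    {v : ℕ → V}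
    (hq : ∀ a b c d : ℝ, 0 ≤ q (a • v n + b • v (n - 1) + c • v (n - 2) + d • v (n - 3))) :
    0 ≤ gradFunctional k q v n := by
  have h₁ : 0 ≤ q (v n) := by simpa using hq 1 0 0 0
  have h₂ : ∀ a : ℝ, 0 ≤ q (a • v n - v (n - 1)) := fun a => by
    simpa [sub_eq_add_neg] using hq a (-1) 0 0
  have h₃ : ∀ a : ℝ, 0 ≤ q (a • (v n - v (n - 1)) + v (n - 2)) := fun a => by
    simpa [sub_eq_add_neg] using hq a (-a) 1 0
  have h₄ : 0 ≤ q ((2 : ℝ) • (v n - v (n - 1)) + (2 : ℝ) • v (n - 2) - v (n - 3)) := by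
    simpa [sub_eq_add_neg] using hq 2 (-2) 2 (-1)
  unfold gradFunctional
  split
  · linarith [h₂ (7 / 4)]
  · linarith [h₂ (65 / 56), h₃ (3 / 2)]
  · linarith [h₂ (4931 / 6992), h₃ (23 / 18)]
  · exact le_rfl

lemma sigmaL_pos {k : ℕ} (hk : k ∈ Set.Icc 3 5) : 0 < sigmaL k := by
  obtain ⟨hk3, hk5⟩ := hk
  interval_cases k <;> norm_num [sigmaL]

lemma isCoerciveKernel_bdfKernel {k : ℕ} (hk : k ∈ Set.Icc 3 5) :
    IsCoerciveKernel (sigmaL k / 2) (bdfKernel k) := fun x M => by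
  have htelescope : gradFunctional k (fun x : ℝ => x ^ 2) (delay k x) (k + M - 1) +
      sigmaL k / 2 * ∑ p ∈ range M, x p ^ 2 ≤ ∑ p ∈ range M, x p * conv (bdfKernel k) x p := by
    induction M with
    | zero =>
      obtain ⟨hk3, hk5⟩ := hk
      interval_cases k <;> simp [gradFunctional, delay]
    | succ M ih =>
      have hstep := gradFunctional_sub_le (n := k + M) hk (delay k x)
      have hconv : ∑ i ∈ range k, bdfKernel k i * delay k x (k + M - i) =
          conv (bdfKernel k) x M := by
        rw [conv_eq_sum_delay fun j hj => bdfKernel_eq_zero hj]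
        exact sum_congr rfl fun i hi => by rw [delay_add_sub (mem_range.1 hi).le]
      rw [hconv, delay_add_self] at hstep
      rw [sum_range_succ, sum_range_succ, show k + (M + 1) - 1 = k + M by omega]
      linarith
  have hnonneg : 0 ≤ gradFunctional k (fun x : ℝ => x ^ 2) (delay k x) (k + M - 1) :=
    gradFunctional_nonneg _ _ fun _ _ _ _ => sq_nonneg _
  linarith

lemma isL2BoundedKernel_bdfKernel {k : ℕ} (hk : k ∈ Set.Icc 3 5) :
    IsL2BoundedKernel 100 (bdfKernel k) := fun x M => by
  have hb : k * ∑ i ∈ range k, bdfKernel k i ^ 2 ≤ 100 := by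
    obtain ⟨hk3, hk5⟩ := hk
    interval_cases k <;>
      norm_num [sum_range_succ, bdfKernel_three, bdfKernel_four, bdfKernel_five]
  exact (isL2BoundedKernel_of_support (fun j hj => bdfKernel_eq_zero hj) x M).trans
    (mul_le_mul_of_nonneg_right hb (sum_nonneg fun _ _ => sq_nonneg _))

lemma isCoerciveKernel_docKernel {k : ℕ} (hk : k ∈ Set.Icc 3 5) :
    IsCoerciveKernel (sigmaL k / 2 / 100) (docKernel k) :=
  (isCoerciveKernel_bdfKernel hk).inverse (mk_docKernel_mul_mk_bdfKernel (by grind))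
    (half_pos (sigmaL_pos hk)).le (isL2BoundedKernel_bdfKernel hk) (by norm_num)

lemma isL2BoundedKernel_docKernel {k : ℕ} (hk : k ∈ Set.Icc 3 5) :
    IsL2BoundedKernel (1 / (sigmaL k / 2) ^ 2) (docKernel k) :=
  (isCoerciveKernel_bdfKernel hk).inverse_isL2Bounded
    (mk_docKernel_mul_mk_bdfKernel (by grind)) (half_pos (sigmaL_pos hk))

lemma bdfMatrix_mulVec (k : ℕ) {m : ℕ} (v : Fin m → ℝ) (i : Fin m) :
    (bdfMatrix k m).mulVec v i = conv (bdfKernel k) (Function.extend Fin.val v 0) i := by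
  have hentry : ∀ j : Fin m, bdfMatrix k m i j * v j =
      (fun n : ℕ => if n ≤ i then bdfKernel k (i - n) * Function.extend Fin.val v 0 n else 0) j :=
    fun j => by
      simp only [bdfMatrix, Matrix.of_apply, Fin.val_injective.extend_apply, ite_mul, zero_mul,
        Fin.le_def]
  rw [Matrix.mulVec, dotProduct, sum_congr rfl fun j _ => hentry j, Fin.sum_univ_eq_sum_range
    (fun n => if n ≤ i then bdfKernel k (i - n) * Function.extend Fin.val v 0 n else 0),
    ← sum_filter, conv]
  refine sum_congr ?_ fun _ _ => rfl
  ext j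
  simp only [mem_filter, mem_range]
  omega

lemma eigenvalue_bdfMatrix_le {k : ℕ} (hk : k ∈ Set.Icc 3 5) {m : ℕ} {lam : ℝ}
    (h : Module.End.HasEigenvalue
      (Matrix.toLin' ((bdfMatrix k m).transpose * bdfMatrix k m)) lam) : lam ≤ 100 := by
  refine eigenvalue_transpose_mul_self_le (fun v => ?_) h
  have hbound := isL2BoundedKernel_bdfKernel hk (Function.extend Fin.val v 0) m
  simpa only [sum_range, dotProduct, ← pow_two, bdfMatrix_mulVec,
    Fin.val_injective.extend_apply] using hbound

/-! ### Geometric decay of the DOC kernels -/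

lemma abs_le_of_lyapunov {t q : ℕ → ℝ} {c r D : ℝ} (hc : 0 < c) (hr : 0 ≤ r) (hD : 0 ≤ D)
    (hlower : ∀ p, c * t p ^ 2 ≤ q p) (hstep : ∀ p, q (p + 1) ≤ r ^ 2 * q p)
    (hzero : q 0 ≤ c * D ^ 2) (p : ℕ) : |t p| ≤ D * r ^ p := by
  have hdecay : q p ≤ (r ^ p) ^ 2 * q 0 := by
    induction p with
    | zero => simp
    | succ p ih =>
      calc q (p + 1) ≤ r ^ 2 * q p := hstep p
        _ ≤ r ^ 2 * ((r ^ p) ^ 2 * q 0) := by gcongr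
        _ = _ := by ring
  refine abs_le_of_sq_le_sq (le_of_mul_le_mul_left ?_ hc) (by positivity)
  calc c * t p ^ 2 ≤ (r ^ p) ^ 2 * q 0 := (hlower p).trans hdecay
    _ ≤ (r ^ p) ^ 2 * (c * D ^ 2) := by gcongr
    _ = c * (D * r ^ p) ^ 2 := by ring

-- The form `q` is a Lyapunov function of the recurrence for the rate `3 / 7`; an LDLᵀ decomposition
-- into squares certifies its positivity and its decay.
lemma abs_docKernel_three_le (p : ℕ) : |docKernel 3 p| ≤ rho 3 / 4 * (3 / 7) ^ p := by
  have hrec : ∀ p, docKernel 3 (p + 2) = 7 / 11 * docKernel 3 (p + 1) - 2 / 11 * docKernel 3 p :=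
    fun p => by
      have h := docKernel_recurrence (k := 3) (n := p + 2) (by omega) (by omega) (by omega)
      simp only [sum_range_succ, sum_range_zero, bdfKernel_three] at h
      norm_num at h
      linarith
  have h₀ : docKernel 3 0 = 6 / 11 := by norm_num [docKernel, bdfKernel_three]
  have h₁ : docKernel 3 1 = 42 / 121 := by
    norm_num [docKernel, Fin.sum_univ_succ, bdfKernel_three]
  generalize docKernel 3 = θ at hrec h₀ h₁ ⊢
  have htail := abs_le_of_lyapunov (t := fun p => θ (p + 1)) (c := 39 / 8) (r := 3 / 7)
    (q := fun p => 11 * θ (p + 1) ^ 2 - 7 * θ (p + 1) * θ p + 2 * θ p ^ 2) (D := 5 / 14)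
    (by norm_num) (by norm_num) (by norm_num)
    (fun p => by linarith [sq_nonneg (θ p - 7 / 4 * θ (p + 1))])
    (fun p => by
      simp only [hrec]
      nlinarith [sq_nonneg (θ p - 7 / 4 * θ (p + 1)), sq_nonneg (θ (p + 1))])
    (by norm_num [h₀, h₁])
  rcases p with _ | p
  · norm_num [h₀, rho]
  · exact (htail p).trans_eq (by rw [rho]; ring)

lemma abs_docKernel_four_le (p : ℕ) : |docKernel 4 p| ≤ rho 4 / 4 * (4 / 7) ^ p := by
  have hrec : ∀ p, docKernel 4 (p + 3) = 23 / 25 * docKernel 4 (p + 2)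
      - 13 / 25 * docKernel 4 (p + 1) + 3 / 25 * docKernel 4 p := fun p => by
    have h := docKernel_recurrence (k := 4) (n := p + 3) (by omega) (by omega) (by omega)
    simp only [sum_range_succ, sum_range_zero, bdfKernel_four, Nat.reduceSubDiff] at h
    norm_num at h
    linarith
  have h₀ : docKernel 4 0 = 12 / 25 := by norm_num [docKernel, bdfKernel_four]
  have h₁ : docKernel 4 1 = 276 / 625 := by
    norm_num [docKernel, Fin.sum_univ_succ, bdfKernel_four]
  have h₂ : docKernel 4 2 = 2448 / 15625 := by
    norm_num [docKernel, Fin.sum_univ_succ, bdfKernel_four]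
  generalize docKernel 4 = θ at hrec h₀ h₁ h₂ ⊢
  have htail := abs_le_of_lyapunov (t := fun p => θ (p + 2)) (c := 3748 / 79) (r := 4 / 7)
    (q := fun p => 212 * θ (p + 2) ^ 2 + 134 * θ (p + 1) ^ 2 + 10 * θ p ^ 2
      - 266 * θ (p + 2) * θ (p + 1) + 46 * θ (p + 2) * θ p - 64 * θ (p + 1) * θ p)
    (D := 24 / 49) (by norm_num) (by norm_num) (by norm_num)
    (fun p => by
      linarith [sq_nonneg (θ p - 16 / 5 * θ (p + 1) + 23 / 10 * θ (p + 2)),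
        sq_nonneg (θ (p + 1) - 297 / 158 * θ (p + 2))])
    (fun p => by
      simp only [hrec]
      linarith [sq_nonneg (θ (p + 2) - 5019 / 7774 * θ (p + 1) + 2003 / 15548 * θ p),
        sq_nonneg (θ (p + 1) + 4727 / 10566 * θ p), sq_nonneg (θ p)])
    (by norm_num [h₀, h₁, h₂])
  rcases p with _ | _ | p
  · norm_num [h₀, rho]
  · norm_num [h₁, rho]
  · exact (htail p).trans_eq (by rw [rho]; ring)

lemma abs_docKernel_five_le (p : ℕ) : |docKernel 5 p| ≤ rho 5 / 4 * (5 / 7) ^ p := by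
  have hrec : ∀ p, docKernel 5 (p + 4) = 163 / 137 * docKernel 5 (p + 3) - docKernel 5 (p + 2)
      + 63 / 137 * docKernel 5 (p + 1) - 12 / 137 * docKernel 5 p := fun p => by
    have h := docKernel_recurrence (k := 5) (n := p + 4) (by omega) (by omega) (by omega)
    simp only [sum_range_succ, sum_range_zero, bdfKernel_five, Nat.reduceSubDiff] at h
    norm_num at h
    linarith
  have h₀ : docKernel 5 0 = 60 / 137 := by norm_num [docKernel, bdfKernel_five]
  have h₁ : docKernel 5 1 = 9780 / 18769 := by
    norm_num [docKernel, Fin.sum_univ_succ, bdfKernel_five]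
  have h₂ : docKernel 5 2 = 468000 / 2571353 := by
    norm_num [docKernel, Fin.sum_univ_succ, bdfKernel_five]
  have h₃ : docKernel 5 3 = -36330000 / 352275361 := by
    rw [docKernel, Fin.sum_univ_three]
    norm_num [h₀, h₁, h₂, bdfKernel_five]
  generalize docKernel 5 = θ at hrec h₀ h₁ h₂ h₃ ⊢
  have htail := abs_le_of_lyapunov (t := fun p => θ (p + 3)) (c := 70863 / 2851) (r := 5 / 7)
    (q := fun p => 300 * θ (p + 3) ^ 2 + 411 * θ (p + 2) ^ 2 + 113 * θ (p + 1) ^ 2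
      + 5 * θ p ^ 2 - 574 * θ (p + 3) * θ (p + 2) + 204 * θ (p + 3) * θ (p + 1)
      - 24 * θ (p + 3) * θ p - 396 * θ (p + 2) * θ (p + 1) + 68 * θ (p + 2) * θ p
      - 44 * θ (p + 1) * θ p)
    (D := 600 / 343) (by norm_num) (by norm_num) (by norm_num)
    (fun p => by
      linarith [sq_nonneg (θ p - 22 / 5 * θ (p + 1) + 34 / 5 * θ (p + 2) - 12 / 5 * θ (p + 3)),
        sq_nonneg (θ (p + 1) - 242 / 81 * θ (p + 2) + 82 / 27 * θ (p + 3)),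
        sq_nonneg (θ (p + 2) - 4731 / 2851 * θ (p + 3))])
    (fun p => by
      rw [add_right_comm p 1 3, add_right_comm p 1 2, add_right_comm p 1 1, hrec]
      linarith [sq_nonneg (θ (p + 3) + 136178 / 296015 * θ (p + 2) + 145877 / 296015 * θ (p + 1)
          + 2928 / 296015 * θ p),
        sq_nonneg (θ (p + 2) - 306652 / 4538237 * θ (p + 1) + 17467 / 4538237 * θ p),
        sq_nonneg (θ (p + 1) - 42970534 / 37540933 * θ p), sq_nonneg (θ p)])
    (by norm_num [h₀, h₁, h₂, h₃])
  rcases p with _ | _ | _ | p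
  · norm_num [h₀, rho]
  · norm_num [h₁, rho]
  · norm_num [h₂, rho]
  · exact (htail p).trans_eq (by rw [rho]; ring)

lemma abs_docKernel_le {k : ℕ} (hk : k ∈ Set.Icc 3 5) (p : ℕ) :
    |docKernel k p| ≤ rho k / 4 * ((k : ℝ) / 7) ^ p := by
  obtain ⟨hk3, hk5⟩ := hk
  interval_cases k
  · exact_mod_cast abs_docKernel_three_le p
  · exact_mod_cast abs_docKernel_four_le p
  · exact_mod_cast abs_docKernel_five_le p

lemma abs_bdfKernel_le {k : ℕ} (hk : k ∈ Set.Icc 3 5) (j : ℕ) : |bdfKernel k j| ≤ 3 := by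
  obtain ⟨hk3, hk5⟩ := hk
  rcases lt_or_ge j k with hj | hj
  · interval_cases k <;> interval_cases j <;>
      norm_num [bdfKernel_three, bdfKernel_four, bdfKernel_five, abs_le]
  · norm_num [bdfKernel_eq_zero hj]

lemma rho_pos {k : ℕ} (hk : k ∈ Set.Icc 3 5) : 0 < rho k := by
  obtain ⟨hk3, hk5⟩ := hk
  interval_cases k <;> norm_num [rho]

/-- The weight `∑_{j=k}^{n} θ_{n-j} b_{j-ℓ}` of the starting increment `∇_τ v^ℓ` in the starting
effect. -/
def startWeight (k l n : ℕ) : ℝ :=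
  ∑ j ∈ Icc k n, docKernel k (n - j) * bdfKernel k (j - l)

/-- The constant `c_{I,k}` in the decay of the starting effect: at most `k` kernels contribute, each
at most `3` in absolute value, and the decay exponents are off by at most `k`. -/
def startConst (k : ℕ) : ℝ := 6 * k * (7 / (k : ℝ)) ^ k

lemma one_lt_startConst {k : ℕ} (hk : k ∈ Set.Icc 3 5) : 1 < startConst k := by
  obtain ⟨hk3, hk5⟩ := hk
  interval_cases k <;> norm_num [startConst]

lemma abs_startWeight_le {k l n : ℕ} (hk : k ∈ Set.Icc 3 5) (hl : l ≤ k - 1) (hn : k ≤ n) :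
    |startWeight k l n| ≤ startConst k * rho k / 8 * ((k : ℝ) / 7) ^ (n - k) := by
  obtain ⟨hk3, hk5⟩ := id hk
  have hρ := rho_pos hk
  have : (0 : ℝ) < k := by positivity
  have hratio : (k : ℝ) / 7 ≤ 1 := by
    have : (k : ℝ) ≤ 5 := by exact_mod_cast hk5
    linarith
  have hterm : ∀ j ∈ (Icc k n).filter (· < 2 * k), |docKernel k (n - j) * bdfKernel k (j - l)| ≤
      3 * rho k / 4 * (7 / (k : ℝ)) ^ k * ((k : ℝ) / 7) ^ (n - k) := fun j hj => by
    simp only [mem_filter, mem_Icc] at hj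
    have hpow : ((k : ℝ) / 7) ^ (n - j) ≤ (7 / (k : ℝ)) ^ k * ((k : ℝ) / 7) ^ (n - k) := by
      rw [← inv_div (k : ℝ) 7, inv_pow, inv_mul_eq_div, le_div_iff₀ (by positivity), ← pow_add]
      exact pow_le_pow_of_le_one (by positivity) hratio (by omega)
    calc |docKernel k (n - j) * bdfKernel k (j - l)|
        ≤ rho k / 4 * ((k : ℝ) / 7) ^ (n - j) * 3 := by
          rw [abs_mul]
          exact mul_le_mul (abs_docKernel_le hk _) (abs_bdfKernel_le hk _) (abs_nonneg _)
            (by positivity)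
      _ ≤ rho k / 4 * ((7 / (k : ℝ)) ^ k * ((k : ℝ) / 7) ^ (n - k)) * 3 := by gcongr
      _ = _ := by ring
  have hcard : ((Icc k n).filter (· < 2 * k)).card ≤ k := by
    have hsub : (Icc k n).filter (· < 2 * k) ⊆ Ico k (2 * k) := fun j hj => by
      simp only [mem_filter, mem_Icc, mem_Ico] at *; omega
    simpa [two_mul] using card_le_card hsub
  have hsupport : startWeight k l n = ∑ j ∈ (Icc k n).filter (· < 2 * k),
      docKernel k (n - j) * bdfKernel k (j - l) := by
    refine (sum_filter_of_ne fun j _ hne => ?_).symm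
    by_contra hj
    exact hne (by rw [bdfKernel_eq_zero (by omega), mul_zero])
  rw [hsupport]
  calc |∑ j ∈ (Icc k n).filter (· < 2 * k), docKernel k (n - j) * bdfKernel k (j - l)|
      ≤ ((Icc k n).filter (· < 2 * k)).card •
          (3 * rho k / 4 * (7 / (k : ℝ)) ^ k * ((k : ℝ) / 7) ^ (n - k)) :=
        (abs_sum_le_sum_abs _ _).trans (sum_le_card_nsmul _ _ _ hterm)
    _ ≤ k * (3 * rho k / 4 * (7 / (k : ℝ)) ^ k * ((k : ℝ) / 7) ^ (n - k)) := by
        rw [nsmul_eq_mul]; gcongr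
    _ = startConst k * rho k / 8 * ((k : ℝ) / 7) ^ (n - k) := by rw [startConst]; ring

lemma abs_startingEffect_le {k n : ℕ} (hk : k ∈ Set.Icc 3 5) (hn : k ≤ n) (v : ℕ → ℝ) :
    |startingEffect k v n| ≤ startConst k * rho k / 8 * ((k : ℝ) / 7) ^ (n - k) *
      ∑ l ∈ Icc 1 (k - 1), |backDiff v l| := by
  rw [startingEffect, mul_sum]
  refine (abs_sum_le_sum_abs _ _).trans (sum_le_sum fun l hl => ?_)
  rw [abs_mul, mul_comm]
  exact mul_le_mul_of_nonneg_right (abs_startWeight_le hk (mem_Icc.1 hl).2 hn) (abs_nonneg _)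

/-! ### The plane-wave basis of `L²(Ω)` -/

section Torus

-- Mathlib's Fourier theory on `UnitAddTorus` uses this measure, as a local instance.
local instance : MeasureSpace UnitAddCircle := ⟨AddCircle.haarAddCircle⟩

variable {L : Fin 2 → ℝ}

/-- The area `|Ω| = L₀ L₁` of the period cell. -/
def area (L : Fin 2 → ℝ) : ℝ := ∏ i, L i

lemma area_pos (hL : ∀ i, 0 < L i) : 0 < area L := prod_pos fun i _ => hL i

lemma cell_eq_preimage (L : Fin 2 → ℝ) :
    cell L = (WithLp.ofLp : EuclideanSpace ℝ (Fin 2) → Fin 2 → ℝ) ⁻¹'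
      (Set.univ.pi fun i => Set.Ioo 0 (L i)) := by
  ext x; simp [cell]

lemma measurableSet_cell (L : Fin 2 → ℝ) : MeasurableSet (cell L) := by
  rw [cell_eq_preimage]
  exact (MeasurableSet.univ_pi fun _ => measurableSet_Ioo).preimage
    (PiLp.volume_preserving_ofLp (Fin 2)).measurable

lemma measurePreserving_toLp_cell (L : Fin 2 → ℝ) :
    MeasurePreserving (WithLp.toLp 2 : (Fin 2 → ℝ) → EuclideanSpace ℝ (Fin 2))
      (volume.restrict (Set.univ.pi fun i => Set.Ioo 0 (L i))) (cellMeasure L) := by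
  have hpreimage : (WithLp.toLp 2 : (Fin 2 → ℝ) → EuclideanSpace ℝ (Fin 2)) ⁻¹' cell L =
      Set.univ.pi fun i => Set.Ioo 0 (L i) := by
    ext x; simp [cell]
  exact hpreimage ▸ (PiLp.volume_preserving_toLp (Fin 2)).restrict_preimage (measurableSet_cell L)

lemma volume_cell (L : Fin 2 → ℝ) : volume (cell L) = ∏ i, ENNReal.ofReal (L i) := by
  rw [cell_eq_preimage, (PiLp.volume_preserving_ofLp (Fin 2)).measure_preimage
    (MeasurableSet.univ_pi fun _ => measurableSet_Ioo).nullMeasurableSet]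
  simp [Real.volume_pi_Ioo]

instance isFiniteMeasure_cellMeasure (L : Fin 2 → ℝ) : IsFiniteMeasure (cellMeasure L) where
  measure_univ_lt_top := by
    rw [Measure.restrict_apply_univ, volume_cell]
    exact ENNReal.prod_lt_top fun i _ => ENNReal.ofReal_lt_top

lemma measurePreserving_scale (hL : ∀ i, 0 < L i) :
    MeasurePreserving (fun (v : Fin 2 → ℝ) i => L i * v i) volume
      ((ENNReal.ofReal (area L))⁻¹ • volume) := by
  have hdet : (Matrix.diagonal L).det = area L := by simp [area]
  have hmap := Real.smul_map_diagonal_volume_pi (D := L) (by rw [hdet]; exact (area_pos hL).ne')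
  have hscale : (⇑(Matrix.toLin' (Matrix.diagonal L)) : (Fin 2 → ℝ) → Fin 2 → ℝ)
      = fun v i => L i * v i := by
    ext v i; simp [Matrix.mulVec_diagonal]
  rw [hdet, abs_of_pos (area_pos hL), hscale] at hmap
  refine ⟨by fun_prop, ?_⟩
  conv_rhs => rw [← hmap]
  rw [smul_smul, ENNReal.inv_mul_cancel (by simpa using area_pos hL) ENNReal.ofReal_ne_top,
    one_smul]

/-- The section of the projection `torusProj` of the plane onto the unit torus whose values are
the representatives in `∏ᵢ (0, Lᵢ]`. -/
def torusLift (L : Fin 2 → ℝ) (t : UnitAddTorus (Fin 2)) : EuclideanSpace ℝ (Fin 2) :=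
  WithLp.toLp 2 fun i => L i * (AddCircle.equivIoc 1 0 (t i)).1

/-- The projection of the plane onto the unit torus, with the periods `L` rescaled to `1`. -/
def torusProj (L : Fin 2 → ℝ) (x : EuclideanSpace ℝ (Fin 2)) : UnitAddTorus (Fin 2) :=
  fun i => ((x i / L i : ℝ) : UnitAddCircle)

lemma torusProj_torusLift (hL : ∀ i, 0 < L i) (t : UnitAddTorus (Fin 2)) :
    torusProj L (torusLift L t) = t := by
  ext i
  simp only [torusProj, torusLift]
  rw [mul_div_cancel_left₀ _ (hL i).ne']
  exact (AddCircle.equivIoc 1 0).symm_apply_apply (t i)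

lemma measurePreserving_scale_unitBox (hL : ∀ i, 0 < L i) :
    MeasurePreserving (fun (v : Fin 2 → ℝ) i => L i * v i)
      (volume.restrict {x : Fin 2 → ℝ | ∀ i, x i ∈ Set.Ioc ((0 : Fin 2 → ℝ) i)
        ((0 : Fin 2 → ℝ) i + 1)})
      ((ENNReal.ofReal (area L))⁻¹ • volume.restrict (Set.univ.pi fun i => Set.Ioo 0 (L i))) := by
  have hpreimage : (fun (v : Fin 2 → ℝ) i => L i * v i) ⁻¹'
      (Set.univ.pi fun i => Set.Ioc 0 (L i)) =
      {x : Fin 2 → ℝ | ∀ i, x i ∈ Set.Ioc ((0 : Fin 2 → ℝ) i) ((0 : Fin 2 → ℝ) i + 1)} := by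
    ext v
    simp only [Set.mem_preimage, Set.mem_univ_pi, Set.mem_Ioc, Set.mem_ofPred_eq,
      Pi.zero_apply, zero_add]
    exact forall_congr' fun i =>
      and_congr (mul_pos_iff_of_pos_left (hL i)) (mul_le_iff_le_one_right (hL i))
  have hrestrict := (measurePreserving_scale hL).restrict_preimage
    (s := Set.univ.pi fun i => Set.Ioc 0 (L i)) (MeasurableSet.univ_pi fun _ => measurableSet_Ioc)
  have hIoc : (volume.restrict (Set.univ.pi fun i => Set.Ioc 0 (L i)) : Measure (Fin 2 → ℝ)) =
      volume.restrict (Set.univ.pi fun i => Set.Ioo 0 (L i)) :=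
    Measure.restrict_congr_set (Measure.pi_Ioo_ae_eq_pi_Ioc).symm
  rwa [hpreimage, Measure.restrict_smul, hIoc] at hrestrict

lemma measurePreserving_torusLift (hL : ∀ i, 0 < L i) :
    MeasurePreserving (torusLift L) volume ((ENNReal.ofReal (area L))⁻¹ • cellMeasure L) := by
  have hunitBox : MeasurableSet {x : Fin 2 → ℝ | ∀ i, x i ∈ Set.Ioc ((0 : Fin 2 → ℝ) i)
      ((0 : Fin 2 → ℝ) i + 1)} := MeasurableSet.univ_pi' fun _ => measurableSet_Ioc
  have hcoe := MeasurePreserving.mk measurable_subtype_coe (map_comap_subtype_coe hunitBox volume)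
  exact ((measurePreserving_toLp_cell L).smul_measure _).comp
    ((measurePreserving_scale_unitBox hL).comp
      (hcoe.comp (UnitAddTorus.measurePreserving_equivPiIoc (0 : Fin 2 → ℝ))))

lemma integral_cell_eq_torus (hL : ∀ i, 0 < L i) {E : Type*} [NormedAddCommGroup E]
    [NormedSpace ℝ E] {f : EuclideanSpace ℝ (Fin 2) → E}
    (hf : AEStronglyMeasurable f (cellMeasure L)) :
    ∫ x, f x ∂(cellMeasure L) = area L • ∫ t, f (torusLift L t) := by
  have hlift := measurePreserving_torusLift hL
  rw [← integral_map hlift.measurable.aemeasurable (by rw [hlift.map_eq]; exact hf.smul_measure _),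
    hlift.map_eq, integral_smul_measure, ENNReal.toReal_inv,
    ENNReal.toReal_ofReal (area_pos hL).le, smul_smul, mul_inv_cancel₀ (area_pos hL).ne', one_smul]

/-- The phase `2π ∑ᵢ kᵢ xᵢ / Lᵢ` of the plane wave with wave vector `2π (k₀ / L₀, k₁ / L₁)`. -/
def phase (L : Fin 2 → ℝ) (k : Fin 2 → ℤ) (x : EuclideanSpace ℝ (Fin 2)) : ℝ :=
  ∑ i, 2 * Real.pi * k i / L i * x i

lemma phase_add (L : Fin 2 → ℝ) (k l : Fin 2 → ℤ) (x : EuclideanSpace ℝ (Fin 2)) :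
    phase L (k + l) x = phase L k x + phase L l x := by
  simp only [phase, ← sum_add_distrib, Pi.add_apply, Int.cast_add]
  exact sum_congr rfl fun i _ => by ring

lemma phase_neg (L : Fin 2 → ℝ) (k : Fin 2 → ℤ) (x : EuclideanSpace ℝ (Fin 2)) :
    phase L (-k) x = -phase L k x := by
  simp only [phase, ← sum_neg_distrib, Pi.neg_apply, Int.cast_neg]
  exact sum_congr rfl fun i _ => by ring

@[fun_prop]
lemma continuous_phase (L : Fin 2 → ℝ) (k : Fin 2 → ℤ) : Continuous (phase L k) := by
  unfold phase; fun_prop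

/-- The real plane waves `|Ω|^{-1/2} (cos + sin)`. Unlike the functions `cos` and `sin` taken
separately, they form an orthonormal family indexed by the whole lattice `ℤ²`. -/
def wave (L : Fin 2 → ℝ) (k : Fin 2 → ℤ) (x : EuclideanSpace ℝ (Fin 2)) : ℝ :=
  (√(area L))⁻¹ * (Real.cos (phase L k x) + Real.sin (phase L k x))

@[fun_prop]
lemma continuous_wave (L : Fin 2 → ℝ) (k : Fin 2 → ℤ) : Continuous (wave L k) := by
  unfold wave; fun_prop

lemma abs_wave_le (L : Fin 2 → ℝ) (k : Fin 2 → ℤ) (x : EuclideanSpace ℝ (Fin 2)) :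
    |wave L k x| ≤ 2 * (√(area L))⁻¹ := by
  have hnonneg : (0 : ℝ) ≤ (√(area L))⁻¹ := by positivity
  rw [wave, abs_mul, abs_of_nonneg hnonneg, mul_comm]
  refine mul_le_mul_of_nonneg_right ((abs_add_le _ _).trans ?_) hnonneg
  linarith [Real.abs_cos_le_one (phase L k x), Real.abs_sin_le_one (phase L k x)]

lemma mFourier_torusProj (L : Fin 2 → ℝ) (k : Fin 2 → ℤ) (x : EuclideanSpace ℝ (Fin 2)) :
    UnitAddTorus.mFourier k (torusProj L x) = Complex.exp (phase L k x * Complex.I) := by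
  simp only [UnitAddTorus.mFourier, ContinuousMap.coe_mk, torusProj, fourier_coe_apply, phase]
  rw [← Complex.exp_sum]
  push_cast
  rw [sum_mul]
  exact congrArg _ (sum_congr rfl fun i _ => by ring)

lemma integral_mFourier (k : Fin 2 → ℤ) :
    ∫ t, UnitAddTorus.mFourier k t = if k = 0 then 1 else 0 := by
  have horth := (orthonormal_iff_ite.mp (UnitAddTorus.orthonormal_mFourier (d := Fin 2))) 0 k
  rw [ContinuousMap.inner_toLp] at horth
  simpa only [UnitAddTorus.mFourier_zero, ContinuousMap.one_apply, map_one, mul_one,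
    eq_comm (a := (0 : Fin 2 → ℤ))] using horth

lemma integral_exp_phase (hL : ∀ i, 0 < L i) (k : Fin 2 → ℤ) :
    ∫ x, Complex.exp (phase L k x * Complex.I) ∂(cellMeasure L)
      = if k = 0 then (area L : ℂ) else 0 := by
  rw [integral_cell_eq_torus hL (by fun_prop : Continuous _).aestronglyMeasurable]
  simp only [← mFourier_torusProj, torusProj_torusLift hL, integral_mFourier]
  split_ifs <;> simp

lemma integrable_exp_phase (L : Fin 2 → ℝ) (k : Fin 2 → ℤ) :
    Integrable (fun x => Complex.exp (phase L k x * Complex.I)) (cellMeasure L) :=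
  .of_bound (by fun_prop : Continuous _).aestronglyMeasurable 1
    (.of_forall fun x => (Complex.norm_exp_ofReal_mul_I _).le)

lemma integrable_cos_phase (L : Fin 2 → ℝ) (k : Fin 2 → ℤ) :
    Integrable (fun x => Real.cos (phase L k x)) (cellMeasure L) := by
  simpa using (integrable_exp_phase L k).re

lemma integrable_sin_phase (L : Fin 2 → ℝ) (k : Fin 2 → ℤ) :
    Integrable (fun x => Real.sin (phase L k x)) (cellMeasure L) := by
  simpa using (integrable_exp_phase L k).im

lemma integral_cos_phase (hL : ∀ i, 0 < L i) (k : Fin 2 → ℤ) :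
    ∫ x, Real.cos (phase L k x) ∂(cellMeasure L) = if k = 0 then area L else 0 := by
  have hre := integral_re (integrable_exp_phase L k)
  simp only [RCLike.re_to_complex, Complex.exp_ofReal_mul_I_re, integral_exp_phase hL] at hre
  rw [hre]
  split_ifs <;> simp

lemma integral_sin_phase (hL : ∀ i, 0 < L i) (k : Fin 2 → ℤ) :
    ∫ x, Real.sin (phase L k x) ∂(cellMeasure L) = 0 := by
  have him := integral_im (integrable_exp_phase L k)
  simp only [RCLike.im_to_complex, Complex.exp_ofReal_mul_I_im, integral_exp_phase hL] at him
  rw [him]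
  split_ifs <;> simp

lemma integral_wave_mul_wave (hL : ∀ i, 0 < L i) (k l : Fin 2 → ℤ) :
    ∫ x, wave L k x * wave L l x ∂(cellMeasure L) = if k = l then 1 else 0 := by
  have hproduct : ∀ x, wave L k x * wave L l x =
      (area L)⁻¹ * (Real.cos (phase L (k + -l) x) + Real.sin (phase L (k + l) x)) := fun x => by
    rw [phase_add, phase_add, phase_neg, Real.cos_add, Real.sin_add, Real.cos_neg, Real.sin_neg,
      wave, wave, ← Real.mul_self_sqrt (area_pos hL).le, mul_inv,
      Real.mul_self_sqrt (area_pos hL).le]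
    ring
  simp only [hproduct]
  rw [integral_const_mul, integral_add (integrable_cos_phase _ _) (integrable_sin_phase _ _),
    integral_cos_phase hL, integral_sin_phase hL, add_zero]
  simp only [← sub_eq_add_neg, sub_eq_zero]
  split_ifs
  · exact inv_mul_cancel₀ (area_pos hL).ne'
  · exact mul_zero _

lemma memLp_wave (L : Fin 2 → ℝ) (k : Fin 2 → ℤ) : MemLp (wave L k) 2 (cellMeasure L) :=
  MemLp.of_bound (continuous_wave L k).aestronglyMeasurable _
    (Filter.Eventually.of_forall (abs_wave_le L k))

/-- The plane waves as elements of `L²(Ω)`. -/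
def waveLp (L : Fin 2 → ℝ) (k : Fin 2 → ℤ) : L2 L := (memLp_wave L k).toLp

lemma coeFn_waveLp (L : Fin 2 → ℝ) (k : Fin 2 → ℤ) : waveLp L k =ᵐ[cellMeasure L] wave L k :=
  (memLp_wave L k).coeFn_toLp

lemma inner_eq_integral (u v : L2 L) : ⟪u, v⟫_ℝ = ∫ x, u x * v x ∂(cellMeasure L) := by
  rw [L2.inner_def]
  simp [mul_comm]

lemma inner_waveLp (k : Fin 2 → ℤ) (u : L2 L) :
    ⟪waveLp L k, u⟫_ℝ = ∫ x, u x * wave L k x ∂(cellMeasure L) := by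
  rw [inner_eq_integral]
  refine integral_congr_ae ?_
  filter_upwards [coeFn_waveLp L k] with x hx
  rw [hx, mul_comm]

lemma orthonormal_waveLp (hL : ∀ i, 0 < L i) : Orthonormal ℝ (waveLp L) := by
  rw [orthonormal_iff_ite]
  intro k l
  rw [inner_waveLp, ← integral_wave_mul_wave hL k l]
  refine integral_congr_ae ?_
  filter_upwards [coeFn_waveLp L l] with x hx
  rw [hx, mul_comm]

lemma integrable_mul_of_bounded (u : L2 L) {f : EuclideanSpace ℝ (Fin 2) → ℝ} (hf : Continuous f)
    {C : ℝ} (hC : ∀ x, |f x| ≤ C) : Integrable (fun x => u x * f x) (cellMeasure L) :=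
  ((Lp.memLp u).integrable (by norm_num)).mul_bdd hf.aestronglyMeasurable (.of_forall hC)

lemma integral_exp_phase_mul_eq_zero (hL : ∀ i, 0 < L i) {u : L2 L}
    (hu : ∀ k, ⟪waveLp L k, u⟫_ℝ = 0) (k : Fin 2 → ℤ) :
    ∫ x, Complex.exp (phase L k x * Complex.I) * (u x : ℂ) ∂(cellMeasure L) = 0 := by
  have hintcos : ∀ k, Integrable (fun x => u x * Real.cos (phase L k x)) (cellMeasure L) :=
    fun k => integrable_mul_of_bounded u (by fun_prop) fun x => Real.abs_cos_le_one _
  have hintsin : ∀ k, Integrable (fun x => u x * Real.sin (phase L k x)) (cellMeasure L) :=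
    fun k => integrable_mul_of_bounded u (by fun_prop) fun x => Real.abs_sin_le_one _
  have hsum : ∀ k, (∫ x, u x * Real.cos (phase L k x) ∂(cellMeasure L)) +
      ∫ x, u x * Real.sin (phase L k x) ∂(cellMeasure L) = 0 := fun k => by
    have hwave : ∀ x, u x * wave L k x = (√(area L))⁻¹ *
        (u x * Real.cos (phase L k x) + u x * Real.sin (phase L k x)) := fun x => by
      rw [wave]; ring
    have hinner := hu k
    simp only [inner_waveLp, hwave] at hinner
    rw [integral_const_mul, integral_add (hintcos k) (hintsin k)] at hinner
    exact (mul_eq_zero.1 hinner).resolve_left (inv_ne_zero (Real.sqrt_pos.2 (area_pos hL)).ne')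
  have hcos : ∫ x, u x * Real.cos (phase L k x) ∂(cellMeasure L) = 0 := by
    have hneg := hsum (-k)
    simp only [phase_neg, Real.cos_neg, Real.sin_neg, mul_neg, integral_neg] at hneg
    linarith [hsum k]
  have hsin : ∫ x, u x * Real.sin (phase L k x) ∂(cellMeasure L) = 0 := by
    linarith [hsum k]
  have hexp : ∀ x, Complex.exp (phase L k x * Complex.I) * (u x : ℂ) =
      ((u x * Real.cos (phase L k x) : ℝ) : ℂ) +
        ((u x * Real.sin (phase L k x) : ℝ) : ℂ) * Complex.I := fun x => by
    rw [Complex.exp_mul_I]; push_cast; ring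
  simp only [hexp]
  rw [integral_add (hintcos k).ofReal ((hintsin k).ofReal.mul_const _), integral_mul_const,
    integral_complex_ofReal, integral_complex_ofReal, hcos, hsin]
  simp

lemma memLp_comp_torusLift (hL : ∀ i, 0 < L i) (u : L2 L) :
    MemLp (fun t => (u (torusLift L t) : ℂ)) 2 volume :=
  (((Lp.memLp u).ofReal (K := ℂ)).smul_measure
    (ENNReal.inv_ne_top.2 (by simpa using area_pos hL))).comp_measurePreserving
      (measurePreserving_torusLift hL)

lemma comp_torusLift_ae_eq_zero (hL : ∀ i, 0 < L i) {u : L2 L}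
    (hu : ∀ k, ∫ x, Complex.exp (phase L k x * Complex.I) * (u x : ℂ) ∂(cellMeasure L) = 0) :
    ∀ᵐ t, (u (torusLift L t) : ℂ) = 0 := by
  set U := (memLp_comp_torusLift hL u).toLp
  have hcoeFn : U =ᵐ[volume] fun t => (u (torusLift L t) : ℂ) :=
    (memLp_comp_torusLift hL u).coeFn_toLp
  have hrepr : UnitAddTorus.mFourierBasis.repr U = 0 := by
    ext k
    have hmeas : AEStronglyMeasurable
        (fun x => Complex.exp (phase L (-k) x * Complex.I) * (u x : ℂ)) (cellMeasure L) :=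
      AEStronglyMeasurable.mul (by fun_prop : Continuous _).aestronglyMeasurable
        (Complex.continuous_ofReal.comp_aestronglyMeasurable (Lp.aestronglyMeasurable u))
    have hint := hu (-k)
    rw [integral_cell_eq_torus hL hmeas] at hint
    rw [UnitAddTorus.mFourierBasis_repr, lp.coeFn_zero, Pi.zero_apply,
      ← (smul_eq_zero.1 hint).resolve_left (area_pos hL).ne', UnitAddTorus.mFourierCoeff]
    refine integral_congr_ae ?_
    filter_upwards [hcoeFn] with t ht
    rw [ht, ← mFourier_torusProj, torusProj_torusLift hL, smul_eq_mul]
  have hzero : U = 0 := (LinearIsometryEquiv.map_eq_zero_iff _).1 hrepr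
  filter_upwards [hcoeFn, Lp.coeFn_zero ℂ 2 (volume : Measure (UnitAddTorus (Fin 2)))]
    with t ht ht0
  rw [← ht, hzero, ht0, Pi.zero_apply]

lemma eq_zero_of_inner_waveLp (hL : ∀ i, 0 < L i) {u : L2 L}
    (hu : ∀ k, ⟪waveLp L k, u⟫_ℝ = 0) : u = 0 := by
  have hlift := measurePreserving_torusLift hL
  have hae : ∀ᵐ x ∂((ENNReal.ofReal (area L))⁻¹ • cellMeasure L), (u x : ℂ) = 0 := by
    rw [← hlift.map_eq, ae_map_iff hlift.measurable.aemeasurable]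
    · exact comp_torusLift_ae_eq_zero hL (integral_exp_phase_mul_eq_zero hL hu)
    · exact (Complex.measurable_ofReal.comp (Lp.stronglyMeasurable u).measurable)
        (measurableSet_singleton 0)
  rw [Measure.ae_ennreal_smul_measure_eq (ENNReal.inv_ne_zero.2 ENNReal.ofReal_ne_top)] at hae
  refine Lp.eq_zero_iff_ae_eq_zero.2 ?_
  filter_upwards [hae] with x hx
  simpa using hx

/-- The plane waves as a Hilbert basis of `L²(Ω)`. -/
def waveBasis (hL : ∀ i, 0 < L i) : HilbertBasis (Fin 2 → ℤ) ℝ (L2 L) :=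
  HilbertBasis.mkOfOrthogonalEqBot (orthonormal_waveLp hL) <| by
    rw [Submodule.eq_bot_iff]
    exact fun u hu => eq_zero_of_inner_waveLp hL fun k =>
      (Submodule.mem_orthogonal _ _).1 hu _ (Submodule.subset_span ⟨k, rfl⟩)

@[simp]
lemma coe_waveBasis (hL : ∀ i, 0 < L i) : ⇑(waveBasis hL) = waveLp L :=
  HilbertBasis.coe_mkOfOrthogonalEqBot _ _

end Torus

/-! ### The periodic Laplacian on the plane waves -/

section Laplacian

variable {L : Fin 2 → ℝ} {f g : EuclideanSpace ℝ (Fin 2) → ℝ}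

/-- The `i`-th classical partial derivative. -/
def pderiv (i : Fin 2) (f : EuclideanSpace ℝ (Fin 2) → ℝ) (x : EuclideanSpace ℝ (Fin 2)) : ℝ :=
  fderiv ℝ f x (EuclideanSpace.single i 1)

lemma pderiv_mul (i : Fin 2) {x : EuclideanSpace ℝ (Fin 2)} (hf : DifferentiableAt ℝ f x)
    (hg : DifferentiableAt ℝ g x) :
    pderiv i (fun x => f x * g x) x = pderiv i f x * g x + f x * pderiv i g x := by
  rw [pderiv, fderiv_fun_mul hf hg]
  simp only [pderiv, add_apply, smul_apply, smul_eq_mul]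
  ring

lemma pderiv_sub (i : Fin 2) {x : EuclideanSpace ℝ (Fin 2)} (hf : DifferentiableAt ℝ f x)
    (hg : DifferentiableAt ℝ g x) :
    pderiv i (fun x => f x - g x) x = pderiv i f x - pderiv i g x := by
  rw [pderiv, fderiv_fun_sub hf hg, sub_apply, pderiv, pderiv]

namespace IsPeriodicTest

lemma differentiable (hf : IsPeriodicTest L f) : Differentiable ℝ f :=
  hf.1.differentiable (by simp)

lemma mul (hf : IsPeriodicTest L f) (hg : IsPeriodicTest L g) :
    IsPeriodicTest L fun x => f x * g x :=
  ⟨hf.1.mul hg.1, fun x i => by simp only [hf.2, hg.2]⟩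

lemma sub (hf : IsPeriodicTest L f) (hg : IsPeriodicTest L g) :
    IsPeriodicTest L fun x => f x - g x :=
  ⟨hf.1.sub hg.1, fun x i => by simp only [hf.2, hg.2]⟩

lemma pderiv (hf : IsPeriodicTest L f) (i : Fin 2) : IsPeriodicTest L (pderiv i f) := by
  refine ⟨(hf.1.fderiv_right (by simp)).clm_apply contDiff_const, fun x j => ?_⟩
  have hshift : (fun y => f (y + EuclideanSpace.single j (L j))) = f := funext fun y => hf.2 y j
  rw [PFC.pderiv, ← fderiv_comp_add_right, hshift, PFC.pderiv]

lemma laplacian_eq (hf : IsPeriodicTest L f) :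
    Laplacian.laplacian f = fun x => ∑ i, PFC.pderiv i (PFC.pderiv i f) x := by
  ext x
  rw [InnerProductSpace.laplacian_eq_iteratedFDeriv_orthonormalBasis f
    (EuclideanSpace.basisFun (Fin 2) ℝ)]
  refine sum_congr rfl fun i _ => ?_
  have hfderiv : DifferentiableAt ℝ (fderiv ℝ f) x :=
    (hf.1.fderiv_right (m := ∞) (by simp)).differentiable (by simp) x
  unfold PFC.pderiv
  rw [iteratedFDeriv_two_apply, fderiv_clm_apply hfderiv (differentiableAt_const _)]
  simp

lemma laplacian (hf : IsPeriodicTest L f) : IsPeriodicTest L (Laplacian.laplacian f) := by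
  rw [hf.laplacian_eq]
  exact ⟨ContDiff.sum fun i _ => ((hf.pderiv i).pderiv i).1,
    fun x j => sum_congr rfl fun i _ => ((hf.pderiv i).pderiv i).2 x j⟩

lemma memLp (hf : IsPeriodicTest L f) : MemLp f 2 (cellMeasure L) := by
  have hbounded : Bornology.IsBounded (cell L) := by
    rw [cell_eq_preimage]
    exact (PiLp.antilipschitzWith_ofLp 2 fun _ : Fin 2 => ℝ).isBounded_preimage
      (Bornology.IsBounded.pi fun i => Metric.isBounded_Ioo (0 : ℝ) (L i))
  obtain ⟨C, hC⟩ :=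
    hbounded.isCompact_closure.exists_bound_of_continuousOn hf.1.continuous.continuousOn
  refine MemLp.of_bound hf.1.continuous.aestronglyMeasurable C ?_
  filter_upwards [ae_restrict_mem (measurableSet_cell L)] with x hx
  exact hC x (subset_closure hx)

lemma integrable (hf : IsPeriodicTest L f) : Integrable f (cellMeasure L) :=
  hf.memLp.integrable (by norm_num)

end IsPeriodicTest

lemma integral_cell_eq_setIntegral_Icc (f : EuclideanSpace ℝ (Fin 2) → ℝ) :
    ∫ x, f x ∂(cellMeasure L) = ∫ v in Set.Icc (0 : Fin 2 → ℝ) L, f (WithLp.toLp 2 v) := by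
  rw [← (measurePreserving_toLp_cell L).integral_comp
    (MeasurableEquiv.toLp 2 (Fin 2 → ℝ)).measurableEmbedding]
  exact setIntegral_congr_set Measure.univ_pi_Ioo_ae_eq_Icc

lemma integral_sum_pderiv_eq_zero (hL : ∀ i, 0 ≤ L i)
    {F : Fin 2 → EuclideanSpace ℝ (Fin 2) → ℝ} (hF : ∀ i, IsPeriodicTest L (F i)) :
    ∫ x, ∑ i, pderiv i (F i) x ∂(cellMeasure L) = 0 := by
  let e := (PiLp.continuousLinearEquiv 2 ℝ fun _ : Fin 2 => ℝ).symm.toContinuousLinearMap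
  have hderiv (i : Fin 2) (v : Fin 2 → ℝ) :
      HasFDerivAt (fun v => F i (e v)) ((fderiv ℝ (F i) (e v)).comp e) v :=
    ((hF i).differentiable (e v)).hasFDerivAt.comp v e.hasFDerivAt
  have hcont : Continuous fun v => ∑ i, pderiv i (F i) (e v) :=
    continuous_finsetSum _ fun i _ => ((hF i).pderiv i).1.continuous.comp e.continuous
  have hfaces (i : Fin 2) (v : Fin 1 → ℝ) :
      F i (e (i.insertNth (L i) v)) = F i (e (i.insertNth 0 v)) := by
    rw [← (hF i).2 (e (i.insertNth 0 v)) i]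
    congr 1
    ext j
    obtain rfl | ⟨j, rfl⟩ := i.eq_self_or_eq_succAbove j <;> simp [e]
  rw [integral_cell_eq_setIntegral_Icc]
  refine (integral_divergence_of_hasFDerivAt_off_countable' 0 L hL (fun i v => F i (e v))
    (fun i v => (fderiv ℝ (F i) (e v)).comp e) ∅ Set.countable_empty
    (fun i v _ => (hderiv i v).continuousAt.continuousWithinAt) (fun v _ i => hderiv i v)
    (hcont.integrableOn_Icc)).trans ?_
  simp only [hfaces, Pi.zero_apply, sub_self, sum_const_zero]

theorem integral_mul_laplacian_comm (hL : ∀ i, 0 ≤ L i) (hf : IsPeriodicTest L f)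
    (hg : IsPeriodicTest L g) :
    ∫ x, f x * Laplacian.laplacian g x ∂(cellMeasure L) =
      ∫ x, Laplacian.laplacian f x * g x ∂(cellMeasure L) := by
  have hdiv (x) : f x * Laplacian.laplacian g x - Laplacian.laplacian f x * g x =
      ∑ i, pderiv i (fun x => f x * pderiv i g x - pderiv i f x * g x) x := by
    rw [hf.laplacian_eq, hg.laplacian_eq, mul_sum, sum_mul, ← sum_sub_distrib]
    refine sum_congr rfl fun i _ => ?_
    rw [pderiv_sub i ((hf.mul (hg.pderiv i)).differentiable x)
        (((hf.pderiv i).mul hg).differentiable x),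
      pderiv_mul i (hf.differentiable x) ((hg.pderiv i).differentiable x),
      pderiv_mul i ((hf.pderiv i).differentiable x) (hg.differentiable x)]
    ring
  rw [← sub_eq_zero, ← integral_sub (hf.mul hg.laplacian).integrable
    (hf.laplacian.mul hg).integrable]
  simp only [hdiv]
  exact integral_sum_pderiv_eq_zero hL fun i => (hf.mul (hg.pderiv i)).sub ((hf.pderiv i).mul hg)

/-- The eigenvalue of `-Δ` on the `k`-th plane wave. -/
def freq (L : Fin 2 → ℝ) (k : Fin 2 → ℤ) : ℝ := ∑ i, (2 * Real.pi * k i / L i) ^ 2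

/-- The phase of the `k`-th plane wave as a linear functional, that is, its own derivative. -/
def phaseCLM (L : Fin 2 → ℝ) (k : Fin 2 → ℤ) : EuclideanSpace ℝ (Fin 2) →L[ℝ] ℝ :=
  ∑ i, (2 * Real.pi * k i / L i) • EuclideanSpace.proj i

lemma coe_phaseCLM (L : Fin 2 → ℝ) (k : Fin 2 → ℤ) : ⇑(phaseCLM L k) = phase L k := by
  ext x; simp [phaseCLM, phase]

lemma phaseCLM_single (L : Fin 2 → ℝ) (k : Fin 2 → ℤ) (i : Fin 2) (a : ℝ) :
    phaseCLM L k (EuclideanSpace.single i a) = 2 * Real.pi * k i / L i * a := by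
  rw [coe_phaseCLM]
  simp only [phase, PiLp.single_apply, mul_ite, mul_zero, sum_ite_eq', mem_univ, if_true]

lemma hasFDerivAt_phase (L : Fin 2 → ℝ) (k : Fin 2 → ℤ) (x : EuclideanSpace ℝ (Fin 2)) :
    HasFDerivAt (phase L k) (phaseCLM L k) x :=
  coe_phaseCLM L k ▸ (phaseCLM L k).hasFDerivAt

lemma phase_add_single (hL : ∀ i, L i ≠ 0) (k : Fin 2 → ℤ) (x : EuclideanSpace ℝ (Fin 2))
    (i : Fin 2) :
    phase L k (x + EuclideanSpace.single i (L i)) = phase L k x + k i * (2 * Real.pi) := by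
  have := hL i
  rw [← coe_phaseCLM, map_add, phaseCLM_single]
  field_simp

lemma isPeriodicTest_wave (hL : ∀ i, L i ≠ 0) (k : Fin 2 → ℤ) :
    IsPeriodicTest L (wave L k) := by
  have hphase : ContDiff ℝ ∞ (phase L k) := coe_phaseCLM L k ▸ (phaseCLM L k).contDiff
  refine ⟨contDiff_const.mul (hphase.cos.add hphase.sin), fun x i => ?_⟩
  rw [wave, wave, phase_add_single hL, Real.cos_add_int_mul_two_pi, Real.sin_add_int_mul_two_pi]

lemma pderiv_wave (L : Fin 2 → ℝ) (k : Fin 2 → ℤ) (i : Fin 2) :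
    pderiv i (wave L k) = fun x => (√(area L))⁻¹ * (2 * Real.pi * k i / L i) *
      (Real.cos (phase L k x) - Real.sin (phase L k x)) := by
  ext x
  have hphase := hasFDerivAt_phase L k x
  have hwave : HasFDerivAt (wave L k) _ x := (hphase.cos.add hphase.sin).const_mul (√(area L))⁻¹
  rw [pderiv, hwave.fderiv]
  simp only [smul_apply, add_apply, smul_eq_mul, phaseCLM_single]
  ring

lemma pderiv_pderiv_wave (L : Fin 2 → ℝ) (k : Fin 2 → ℤ) (i : Fin 2)
    (x : EuclideanSpace ℝ (Fin 2)) :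
    pderiv i (pderiv i (wave L k)) x = -(2 * Real.pi * k i / L i) ^ 2 * wave L k x := by
  have hphase := hasFDerivAt_phase L k x
  have hpderiv : HasFDerivAt (pderiv i (wave L k)) _ x := pderiv_wave L k i ▸
    (hphase.cos.sub hphase.sin).const_mul ((√(area L))⁻¹ * (2 * Real.pi * k i / L i))
  rw [pderiv, hpderiv.fderiv]
  simp only [smul_apply, sub_apply, smul_eq_mul, phaseCLM_single, wave]
  ring

lemma laplacian_wave (hL : ∀ i, L i ≠ 0) (k : Fin 2 → ℤ) (x : EuclideanSpace ℝ (Fin 2)) :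
    Laplacian.laplacian (wave L k) x = -freq L k * wave L k x := by
  simp only [(isPeriodicTest_wave hL k).laplacian_eq, freq, ← sum_neg_distrib, sum_mul,
    pderiv_pderiv_wave]

lemma integral_mul_laplacian_wave (hL : ∀ i, 0 < L i) (k : Fin 2 → ℤ)
    (u : EuclideanSpace ℝ (Fin 2) → ℝ) :
    ∫ x, u x * Laplacian.laplacian (wave L k) x ∂(cellMeasure L) =
      -freq L k * ∫ x, u x * wave L k x ∂(cellMeasure L) := by
  rw [← integral_const_mul]
  refine integral_congr_ae (.of_forall fun x => ?_)
  simp only [laplacian_wave fun i => (hL i).ne']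
  ring

lemma inner_toLp {f : EuclideanSpace ℝ (Fin 2) → ℝ} (hf : MemLp f 2 (cellMeasure L)) (u : L2 L) :
    ⟪u, hf.toLp⟫_ℝ = ∫ x, u x * f x ∂(cellMeasure L) := by
  rw [inner_eq_integral]
  refine integral_congr_ae ?_
  filter_upwards [hf.coeFn_toLp] with x hx
  rw [hx]

lemma inner_waveLp_toLp_laplacian (hL : ∀ i, 0 < L i) (hf : IsPeriodicTest L f)
    (k : Fin 2 → ℤ) :
    ⟪waveLp L k, hf.laplacian.memLp.toLp⟫_ℝ = -freq L k * ⟪waveLp L k, hf.memLp.toLp⟫_ℝ := by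
  have hinner {h : EuclideanSpace ℝ (Fin 2) → ℝ} (hh : MemLp h 2 (cellMeasure L)) :
      ⟪waveLp L k, hh.toLp⟫_ℝ = ∫ x, h x * wave L k x ∂(cellMeasure L) := by
    rw [inner_waveLp]
    refine integral_congr_ae ?_
    filter_upwards [hh.coeFn_toLp] with x hx
    rw [hx]
  rw [hinner, hinner, ← integral_mul_laplacian_wave hL,
    integral_mul_laplacian_comm (fun i => (hL i).le) hf
      (isPeriodicTest_wave (fun i => (hL i).ne') k)]

theorem hasLaplacian_iff (hL : ∀ i, 0 < L i) {u w : L2 L} :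
    HasLaplacian L u w ↔ ∀ k, ⟪waveLp L k, w⟫_ℝ = -freq L k * ⟪waveLp L k, u⟫_ℝ := by
  refine ⟨fun h k => ?_, fun h ψ hψ => ?_⟩
  · rw [inner_waveLp, inner_waveLp, ← h _ (isPeriodicTest_wave (fun i => (hL i).ne') k),
      integral_mul_laplacian_wave hL]
  · rw [← inner_toLp hψ.laplacian.memLp u, ← inner_toLp hψ.memLp w,
      ← (waveBasis hL).tsum_inner_mul_inner, ← (waveBasis hL).tsum_inner_mul_inner]
    refine tsum_congr fun k => ?_
    rw [coe_waveBasis, inner_waveLp_toLp_laplacian hL hψ, real_inner_comm (waveLp L k) u,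
      real_inner_comm (waveLp L k) w, h k]
    ring

end Laplacian

/-! ### Fourier coefficients, the `H⁻¹` norm and the embedding of `H²(Ω)` into `L^∞(Ω)` -/

section Fourier

variable {L : Fin 2 → ℝ}

/-- The Fourier coefficient of `u` at the `k`-th plane wave; these real coefficients diagonalize
every constant-coefficient operator in the development. -/
def coef (u : L2 L) (k : Fin 2 → ℤ) : ℝ := ⟪waveLp L k, u⟫_ℝ

@[simp] lemma coef_add (u v : L2 L) (k : Fin 2 → ℤ) : coef (u + v) k = coef u k + coef v k :=
  inner_add_right _ _ _

@[simp] lemma coef_sub (u v : L2 L) (k : Fin 2 → ℤ) : coef (u - v) k = coef u k - coef v k :=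
  inner_sub_right _ _ _

@[simp] lemma coef_neg (u : L2 L) (k : Fin 2 → ℤ) : coef (-u) k = -coef u k :=
  inner_neg_right _ _

@[simp] lemma coef_smul (c : ℝ) (u : L2 L) (k : Fin 2 → ℤ) : coef (c • u) k = c * coef u k :=
  real_inner_smul_right _ _ _

@[simp] lemma coef_sum {ι : Type*} (s : Finset ι) (f : ι → L2 L) (k : Fin 2 → ℤ) :
    coef (∑ i ∈ s, f i) k = ∑ i ∈ s, coef (f i) k := inner_sum _ _ _

@[simp] lemma coef_backDiff (v : ℕ → L2 L) (n : ℕ) (k : Fin 2 → ℤ) :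
    coef (backDiff v n) k = backDiff (fun j => coef (v j) k) n := coef_sub _ _ _

lemma hasSum_coef_mul_coef (hL : ∀ i, 0 < L i) (u v : L2 L) :
    HasSum (fun k => coef u k * coef v k) ⟪u, v⟫_ℝ := by
  simpa only [coe_waveBasis, real_inner_comm, coef] using (waveBasis hL).hasSum_inner_mul_inner u v

lemma hasSum_coef_sq (hL : ∀ i, 0 < L i) (u : L2 L) :
    HasSum (fun k => coef u k ^ 2) (‖u‖ ^ 2) := by
  simpa only [← pow_two, real_inner_self_eq_norm_sq] using hasSum_coef_mul_coef hL u u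

lemma exists_coef_eq (hL : ∀ i, 0 < L i) {a : (Fin 2 → ℤ) → ℝ} (ha : Summable fun k => a k ^ 2) :
    ∃ u : L2 L, ∀ k, coef u k = a k := by
  have hmem : Memℓp a 2 := memℓp_gen (by simpa using ha)
  refine ⟨(waveBasis hL).repr.symm ⟨a, hmem⟩, fun k => ?_⟩
  rw [coef, ← coe_waveBasis hL, ← (waveBasis hL).repr_apply_apply,
    LinearIsometryEquiv.apply_symm_apply]

lemma hasLaplacian_iff_coef (hL : ∀ i, 0 < L i) {u w : L2 L} :
    HasLaplacian L u w ↔ ∀ k, coef w k = -freq L k * coef u k := hasLaplacian_iff hL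

lemma coef_lap (hL : ∀ i, 0 < L i) {u : L2 L} (hu : InH2 L u) (k : Fin 2 → ℤ) :
    coef (lap L u) k = -freq L k * coef u k := by
  rw [lap, dif_pos hu]
  exact (hasLaplacian_iff_coef hL).1 hu.choose_spec k

lemma freq_nonneg (L : Fin 2 → ℝ) (k : Fin 2 → ℤ) : 0 ≤ freq L k :=
  sum_nonneg fun _ _ => sq_nonneg _

@[simp] lemma freq_zero (L : Fin 2 → ℝ) : freq L 0 = 0 := by simp [freq]

lemma exists_mul_sum_sq_le_freq (hL : ∀ i, 0 < L i) :
    ∃ c ∈ Set.Ioc (0 : ℝ) 1, ∀ k, c * ∑ i, (k i : ℝ) ^ 2 ≤ freq L k := by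
  obtain ⟨i₀, hi₀⟩ := Finite.exists_min fun i => (2 * Real.pi / L i) ^ 2
  have hpos : 0 < (2 * Real.pi / L i₀) ^ 2 := pow_pos (div_pos Real.two_pi_pos (hL i₀)) 2
  refine ⟨min 1 ((2 * Real.pi / L i₀) ^ 2), ⟨lt_min one_pos hpos, min_le_left _ _⟩, fun k => ?_⟩
  rw [freq, mul_sum]
  refine sum_le_sum fun i _ => ?_
  calc min 1 ((2 * Real.pi / L i₀) ^ 2) * (k i : ℝ) ^ 2
      ≤ (2 * Real.pi / L i) ^ 2 * (k i : ℝ) ^ 2 := by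
        gcongr
        exact (min_le_right _ _).trans (hi₀ i)
    _ = (2 * Real.pi * k i / L i) ^ 2 := by ring

lemma exists_le_freq (hL : ∀ i, 0 < L i) : ∃ c : ℝ, 0 < c ∧ ∀ k ≠ 0, c ≤ freq L k := by
  obtain ⟨c, ⟨hc, -⟩, hfreq⟩ := exists_mul_sum_sq_le_freq hL
  refine ⟨c, hc, fun k hk => (le_mul_of_one_le_right hc.le ?_).trans (hfreq k)⟩
  obtain ⟨i, hi⟩ := Function.ne_iff.1 hk
  have hone : (1 : ℝ) ≤ (k i : ℝ) ^ 2 :=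
    mod_cast (one_le_sq_iff_one_le_abs _).2 (Int.one_le_abs hi)
  exact hone.trans (single_le_sum (f := fun i => (k i : ℝ) ^ 2) (fun _ _ => sq_nonneg _)
    (mem_univ i))

lemma freq_pos (hL : ∀ i, 0 < L i) {k : Fin 2 → ℤ} (hk : k ≠ 0) : 0 < freq L k := by
  obtain ⟨c, hc, hfreq⟩ := exists_le_freq hL
  exact hc.trans_le (hfreq k hk)

lemma mean_eq_sqrt_mul_coef (hL : ∀ i, 0 < L i) (u : L2 L) :
    mean L u = √(area L) * coef u 0 := by
  have hsqrt := (Real.sqrt_pos.2 (area_pos hL)).ne'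
  have hwave (x) : wave L 0 x = (√(area L))⁻¹ := by simp [wave, phase]
  simp only [coef, inner_waveLp, mean, hwave, integral_mul_const]
  field_simp

lemma mean_eq_mean_iff (hL : ∀ i, 0 < L i) {u v : L2 L} :
    mean L u = mean L v ↔ coef u 0 = coef v 0 := by
  rw [mean_eq_sqrt_mul_coef hL, mean_eq_sqrt_mul_coef hL,
    mul_right_inj' (Real.sqrt_pos.2 (area_pos hL)).ne']

lemma mean_eq_zero_iff (hL : ∀ i, 0 < L i) {u : L2 L} : mean L u = 0 ↔ coef u 0 = 0 := by
  rw [mean_eq_sqrt_mul_coef hL, mul_eq_zero,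
    or_iff_right (Real.sqrt_pos.2 (area_pos hL)).ne']

lemma summable_coef_div_freq_sq (hL : ∀ i, 0 < L i) (v : L2 L) :
    Summable fun k => (coef v k / freq L k) ^ 2 := by
  obtain ⟨c, hc, hfreq⟩ := exists_le_freq hL
  refine Summable.of_nonneg_of_le (fun k => sq_nonneg _) (fun k => ?_)
    ((hasSum_coef_sq hL v).summable.mul_left (c⁻¹ ^ 2))
  rcases eq_or_ne k 0 with rfl | hk
  · rw [freq_zero, div_zero, zero_pow two_ne_zero]
    positivity
  · have := freq_nonneg L k
    rw [div_eq_inv_mul, mul_pow]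
    gcongr
    exact hfreq k hk

lemma exists_hasLaplacian_neg (hL : ∀ i, 0 < L i) {v : L2 L} (hv : coef v 0 = 0) :
    ∃ g : L2 L, mean L g = 0 ∧ HasLaplacian L g (-v) := by
  obtain ⟨g, hg⟩ := exists_coef_eq hL (summable_coef_div_freq_sq hL v)
  refine ⟨g, (mean_eq_zero_iff hL).2 (by simp [hg]), (hasLaplacian_iff_coef hL).2 fun k => ?_⟩
  rw [coef_neg, hg]
  rcases eq_or_ne k 0 with rfl | hk
  · simp [hv]
  · have := (freq_pos hL hk).ne'
    field_simp

-- At `k = 0` both sides vanish, the right one as a division by `freq L 0 = 0`.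
lemma coef_invNegLap (hL : ∀ i, 0 < L i) {v : L2 L} (hv : coef v 0 = 0) (k : Fin 2 → ℤ) :
    coef (invNegLap L v) k = coef v k / freq L k := by
  have hex := exists_hasLaplacian_neg hL hv
  rw [invNegLap, dif_pos hex]
  obtain ⟨hmean, hlap⟩ := hex.choose_spec
  rcases eq_or_ne k 0 with rfl | hk
  · rw [(mean_eq_zero_iff hL).1 hmean, hv, zero_div]
  · have hcoef := (hasLaplacian_iff_coef hL).1 hlap k
    rw [coef_neg] at hcoef
    rw [eq_div_iff (freq_pos hL hk).ne']
    linarith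

lemma hasSum_negNormSq (hL : ∀ i, 0 < L i) {v : L2 L} (hv : coef v 0 = 0) :
    HasSum (fun k => (freq L k)⁻¹ * coef v k ^ 2) (negNormSq L v) := by
  refine (hasSum_coef_mul_coef hL (invNegLap L v) v).congr_fun fun k => ?_
  rw [coef_invNegLap hL hv]
  ring

lemma negNormSq_nonneg (hL : ∀ i, 0 < L i) {v : L2 L} (hv : coef v 0 = 0) :
    0 ≤ negNormSq L v :=
  (hasSum_negNormSq hL hv).nonneg fun k => mul_nonneg (inv_nonneg.2 (freq_nonneg L k)) (sq_nonneg _)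

lemma summable_inv_one_add_int_sq : Summable fun n : ℤ => (1 + (n : ℝ) ^ 2)⁻¹ := by
  refine .of_norm_bounded_eventually (Real.summable_one_div_int_pow.2 one_lt_two) ?_
  filter_upwards [(Set.finite_singleton (0 : ℤ)).compl_mem_cofinite] with n hn
  have : n ≠ 0 := hn
  rw [Real.norm_of_nonneg (by positivity), one_div]
  gcongr
  linarith

lemma summable_inv_one_add_freq_sq (hL : ∀ i, 0 < L i) :
    Summable fun k => ((1 + freq L k)⁻¹) ^ 2 := by
  obtain ⟨c, ⟨hc, hc1⟩, hfreq⟩ := exists_mul_sum_sq_le_freq hL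
  have hprod := (finTwoArrowEquiv ℤ).summable_iff.2
    (summable_inv_one_add_int_sq.mul_of_nonneg summable_inv_one_add_int_sq
      (fun n => by positivity) (fun n => by positivity))
  refine .of_nonneg_of_le (fun k => sq_nonneg _) (fun k => ?_) (hprod.mul_left (c⁻¹ ^ 2))
  simp only [Function.comp_apply, finTwoArrowEquiv_apply]
  rw [inv_pow, inv_pow, ← mul_inv, ← mul_inv]
  have hsum := hfreq k
  rw [Fin.sum_univ_two] at hsum
  refine inv_anti₀ (by positivity) ?_
  calc c ^ 2 * ((1 + (k 0 : ℝ) ^ 2) * (1 + (k 1 : ℝ) ^ 2))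
      ≤ c ^ 2 * (1 + (k 0 : ℝ) ^ 2 + (k 1 : ℝ) ^ 2) ^ 2 := by
        gcongr
        nlinarith [mul_nonneg (sq_nonneg (k 0 : ℝ)) (sq_nonneg (k 1 : ℝ)), sq_nonneg (k 0 : ℝ),
          sq_nonneg (k 1 : ℝ)]
    _ = (c + c * ((k 0 : ℝ) ^ 2 + (k 1 : ℝ) ^ 2)) ^ 2 := by ring
    _ ≤ (1 + freq L k) ^ 2 := by gcongr

lemma sum_abs_coef_le (hL : ∀ i, 0 < L i) {u : L2 L} (hu : InH2 L u) (s : Finset (Fin 2 → ℤ)) :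
    ∑ k ∈ s, |coef u k| ≤ √(∑' k, ((1 + freq L k)⁻¹) ^ 2) * ‖u - lap L u‖ := by
  have hcoef (k) : |coef u k| = (1 + freq L k)⁻¹ * |coef (u - lap L u) k| := by
    have hpos : 0 < 1 + freq L k := by linarith [freq_nonneg L k]
    have hfactor : coef u k - -freq L k * coef u k = (1 + freq L k) * coef u k := by ring
    rw [coef_sub, coef_lap hL hu, hfactor, abs_mul, abs_of_pos hpos, inv_mul_cancel_left₀ hpos.ne']
  simp only [hcoef]
  refine (Real.sum_mul_le_sqrt_mul_sqrt _ _ _).trans ?_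
  gcongr
  · exact (summable_inv_one_add_freq_sq hL).sum_le_tsum _ fun _ _ => sq_nonneg _
  · simp only [sq_abs]
    exact Real.sqrt_le_iff.2
      ⟨norm_nonneg _, sum_le_hasSum _ (fun _ _ => sq_nonneg _) (hasSum_coef_sq hL _)⟩

lemma abs_coef_indicatorConstLp_le {A : Set (EuclideanSpace ℝ (Fin 2))} (hA : MeasurableSet A)
    (hA' : cellMeasure L A ≠ ⊤) (k : Fin 2 → ℤ) :
    |coef (indicatorConstLp 2 hA hA' (1 : ℝ) : L2 L) k| ≤
      2 * (√(area L))⁻¹ * (cellMeasure L).real A := by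
  rw [coef, real_inner_comm, L2.inner_indicatorConstLp_one,
    integral_congr_ae (ae_restrict_of_ae (coeFn_waveLp L k)), ← Real.norm_eq_abs]
  exact norm_setIntegral_le_of_norm_le_const (measure_lt_top _ _) fun x _ => abs_wave_le L k x

/- Pointwise bounds for `L²` functions are read off from the averages `(u, 1_A)`, whose Fourier
series converges absolutely. -/
lemma ae_le_of_sum_abs_coef_le (hL : ∀ i, 0 < L i) {u : L2 L} {B : ℝ}
    (hB : ∀ s : Finset (Fin 2 → ℤ), ∑ k ∈ s, |coef u k| ≤ B) :
    ∀ᵐ x ∂(cellMeasure L), u x ≤ 2 * (√(area L))⁻¹ * B := by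
  refine ae_le_of_forall_setIntegral_le ((Lp.memLp u).integrable (by norm_num))
    (integrable_const _) fun A hA hA' => ?_
  rw [← L2.inner_indicatorConstLp_one (𝕜 := ℝ) hA hA'.ne u, setIntegral_const, smul_eq_mul]
  refine hasSum_le_of_sum_le (hasSum_coef_mul_coef hL _ u) fun s => ?_
  calc ∑ k ∈ s, coef (indicatorConstLp 2 hA hA'.ne (1 : ℝ)) k * coef u k
      ≤ ∑ k ∈ s, 2 * (√(area L))⁻¹ * (cellMeasure L).real A * |coef u k| := by
        refine sum_le_sum fun k _ => (le_abs_self _).trans ?_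
        rw [abs_mul]
        gcongr
        exact abs_coef_indicatorConstLp_le hA hA'.ne k
    _ ≤ 2 * (√(area L))⁻¹ * (cellMeasure L).real A * B := by
        rw [← mul_sum]
        gcongr
        exact hB s
    _ = (cellMeasure L).real A * (2 * (√(area L))⁻¹ * B) := by ring

lemma ae_abs_le_of_sum_abs_coef_le (hL : ∀ i, 0 < L i) {u : L2 L} {B : ℝ}
    (hB : ∀ s : Finset (Fin 2 → ℤ), ∑ k ∈ s, |coef u k| ≤ B) :
    ∀ᵐ x ∂(cellMeasure L), |u x| ≤ 2 * (√(area L))⁻¹ * B := by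
  filter_upwards [ae_le_of_sum_abs_coef_le hL hB,
    ae_le_of_sum_abs_coef_le hL (u := -u) (by simpa only [coef_neg, abs_neg] using hB),
    Lp.coeFn_neg u] with x hle hle_neg hneg
  rw [hneg, Pi.neg_apply] at hle_neg
  exact abs_le.2 ⟨by linarith, hle⟩

theorem exists_sobolev_embedding (hL : ∀ i, 0 < L i) : ∃ C : ℝ, 0 < C ∧ ∀ u : L2 L, InH2 L u →
    ∀ᵐ x ∂(cellMeasure L), |u x| ≤ C * (‖u‖ + ‖lap L u‖) := by
  refine ⟨2 * (√(area L))⁻¹ * (√(∑' k, ((1 + freq L k)⁻¹) ^ 2) + 1), ?_, fun u hu => ?_⟩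
  · have := area_pos hL
    positivity
  filter_upwards [ae_abs_le_of_sum_abs_coef_le hL (sum_abs_coef_le hL hu)] with x hx
  refine hx.trans ?_
  rw [mul_assoc _ (_ + _)]
  gcongr
  · exact le_add_of_nonneg_right zero_le_one
  · exact norm_sub_le _ _

lemma integrable_comp_of_inH2 (hL : ∀ i, 0 < L i) {u w : L2 L} (hu : InH2 L u) (hw : InH2 L w)
    {F : ℝ × ℝ → ℝ} (hF : Continuous F) :
    Integrable (fun x => F (u x, w x)) (cellMeasure L) := by
  obtain ⟨C, -, hC⟩ := exists_sobolev_embedding hL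
  obtain ⟨M, hM⟩ := (isCompact_Icc.prod isCompact_Icc).exists_bound_of_continuousOn
    (f := F) (s := Set.Icc (-(C * (‖u‖ + ‖lap L u‖))) (C * (‖u‖ + ‖lap L u‖)) ×ˢ
      Set.Icc (-(C * (‖w‖ + ‖lap L w‖))) (C * (‖w‖ + ‖lap L w‖))) hF.continuousOn
  refine Integrable.of_bound (hF.comp_aestronglyMeasurable
    ((Lp.aestronglyMeasurable u).prodMk (Lp.aestronglyMeasurable w))) M ?_
  filter_upwards [hC u hu, hC w hw] with x hxu hxw
  exact hM _ ⟨abs_le.1 hxu, abs_le.1 hxw⟩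

end Fourier

/-! ### The energy and its dissipation by the BDF scheme -/

section Energy

variable {L : Fin 2 → ℝ}

/-- `(1 + Δ)² u`, associated as in `IsChemicalPotential`. -/
def oneAddLapSq (L : Fin 2 → ℝ) (u : L2 L) : L2 L := (u + lap L u) + lap L (u + lap L u)

lemma coef_add_lap (hL : ∀ i, 0 < L i) {u : L2 L} (hu : InH2 L u) (k : Fin 2 → ℤ) :
    coef (u + lap L u) k = (1 - freq L k) * coef u k := by
  rw [coef_add, coef_lap hL hu]
  ring

lemma coef_oneAddLapSq (hL : ∀ i, 0 < L i) {u : L2 L} (hu : InH2 L u)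
    (hu' : InH2 L (u + lap L u)) (k : Fin 2 → ℤ) :
    coef (oneAddLapSq L u) k = (1 - freq L k) ^ 2 * coef u k := by
  rw [oneAddLapSq, coef_add_lap hL hu', coef_add_lap hL hu]
  ring

lemma inner_oneAddLapSq (hL : ∀ i, 0 < L i) {u v : L2 L} (hu : InH2 L u)
    (hu' : InH2 L (u + lap L u)) (hv : InH2 L v) :
    ⟪oneAddLapSq L u, v⟫_ℝ = ⟪u + lap L u, v + lap L v⟫_ℝ := by
  refine (hasSum_coef_mul_coef hL _ _).unique
    ((hasSum_coef_mul_coef hL (u + lap L u) (v + lap L v)).congr_fun fun k => ?_)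
  rw [coef_oneAddLapSq hL hu hu', coef_add_lap hL hu, coef_add_lap hL hv]
  ring

lemma IsChemicalPotential.inner_eq {ε : ℝ} {u μ : L2 L} (hμ : IsChemicalPotential L ε u μ)
    (v : L2 L) : ⟪μ, v⟫_ℝ =
      ⟪oneAddLapSq L u, v⟫_ℝ + ∫ x, (u x ^ 3 - ε * u x) * v x ∂(cellMeasure L) := by
  have hnonlinear : ⟪μ - oneAddLapSq L u, v⟫_ℝ =
      ∫ x, (u x ^ 3 - ε * u x) * v x ∂(cellMeasure L) := by
    rw [inner_eq_integral]
    refine integral_congr_ae ?_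
    filter_upwards [hμ.2.2, Lp.coeFn_sub μ (oneAddLapSq L u)] with x hx hsub
    rw [hsub, Pi.sub_apply, hx, oneAddLapSq]
    ring
  rw [← hnonlinear, ← inner_add_left, add_sub_cancel]

lemma norm_sub_sq_eq_integral (u w : L2 L) :
    ‖u - w‖ ^ 2 = ∫ x, (u x - w x) ^ 2 ∂(cellMeasure L) := by
  rw [← real_inner_self_eq_norm_sq, inner_eq_integral]
  refine integral_congr_ae ?_
  filter_upwards [Lp.coeFn_sub u w] with x hx
  rw [hx, Pi.sub_apply, pow_two]

lemma double_well_sub_le (ε a b : ℝ) :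
    1 / 4 * (a ^ 2 - ε) ^ 2 - 1 / 4 * (b ^ 2 - ε) ^ 2 ≤
      (a ^ 3 - ε * a) * (a - b) + ε / 2 * (a - b) ^ 2 := by
  have hgap : (a ^ 3 - ε * a) * (a - b) + ε / 2 * (a - b) ^ 2 -
      (1 / 4 * (a ^ 2 - ε) ^ 2 - 1 / 4 * (b ^ 2 - ε) ^ 2) =
        1 / 4 * ((a ^ 2 - b ^ 2) ^ 2 + 2 * (a * (a - b)) ^ 2) := by ring
  rw [← sub_nonneg, hgap]
  positivity

lemma integral_double_well_sub_le (hL : ∀ i, 0 < L i) (ε : ℝ) {u w : L2 L} (hu : InH2 L u)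
    (hw : InH2 L w) :
    1 / 4 * ∫ x, (u x ^ 2 - ε) ^ 2 ∂(cellMeasure L) -
        1 / 4 * ∫ x, (w x ^ 2 - ε) ^ 2 ∂(cellMeasure L) ≤
      (∫ x, (u x ^ 3 - ε * u x) * (u - w) x ∂(cellMeasure L)) + ε / 2 * ‖u - w‖ ^ 2 := by
  have hcongr : ∫ x, (u x ^ 3 - ε * u x) * (u - w) x ∂(cellMeasure L) =
      ∫ x, (u x ^ 3 - ε * u x) * (u x - w x) ∂(cellMeasure L) := by
    refine integral_congr_ae ?_
    filter_upwards [Lp.coeFn_sub u w] with x hx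
    rw [hx, Pi.sub_apply]
  have hu_int := integrable_comp_of_inH2 hL hu hw
    (F := fun p => 1 / 4 * (p.1 ^ 2 - ε) ^ 2) (by fun_prop)
  have hw_int := integrable_comp_of_inH2 hL hu hw
    (F := fun p => 1 / 4 * (p.2 ^ 2 - ε) ^ 2) (by fun_prop)
  have hlin_int := integrable_comp_of_inH2 hL hu hw
    (F := fun p => (p.1 ^ 3 - ε * p.1) * (p.1 - p.2)) (by fun_prop)
  have hsq_int := integrable_comp_of_inH2 hL hu hw
    (F := fun p => ε / 2 * (p.1 - p.2) ^ 2) (by fun_prop)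
  rw [hcongr, norm_sub_sq_eq_integral, ← integral_const_mul, ← integral_const_mul,
    ← integral_const_mul, ← integral_sub hu_int hw_int, ← integral_add hlin_int hsq_int]
  exact integral_mono (hu_int.sub hw_int) (hlin_int.add hsq_int) fun x =>
    double_well_sub_le ε _ _

lemma energy_sub_le (hL : ∀ i, 0 < L i) {ε : ℝ} {u w μ : L2 L}
    (hμ : IsChemicalPotential L ε u μ) (hw : InH2 L w) :
    energy L ε u - energy L ε w ≤ ⟪μ, u - w⟫_ℝ
      - 1 / 2 * ‖(u + lap L u) - (w + lap L w)‖ ^ 2 + ε / 2 * ‖u - w‖ ^ 2 := by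
  have hquadratic : 1 / 2 * ‖u + lap L u‖ ^ 2 - 1 / 2 * ‖w + lap L w‖ ^ 2 =
      ⟪oneAddLapSq L u, u - w⟫_ℝ - 1 / 2 * ‖(u + lap L u) - (w + lap L w)‖ ^ 2 := by
    rw [inner_sub_right, inner_oneAddLapSq hL hμ.1 hμ.2.1 hμ.1,
      inner_oneAddLapSq hL hμ.1 hμ.2.1 hw, norm_sub_sq_real, real_inner_self_eq_norm_sq]
    ring
  have hpotential := integral_double_well_sub_le hL ε hμ.1 hw
  rw [hμ.inner_eq, energy, energy]
  linarith

lemma norm_sq_le_integral_double_well (hL : ∀ i, 0 < L i) (ε : ℝ) {u : L2 L} (hu : InH2 L u) :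
    ‖u‖ ^ 2 ≤ 1 / 2 * (∫ x, (u x ^ 2 - ε) ^ 2 ∂(cellMeasure L)) +
      (1 / 2 + ε) * volume.real (cell L) := by
  have hwell := (integrable_comp_of_inH2 hL hu hu (F := fun p => (p.1 ^ 2 - ε) ^ 2)
    (by fun_prop)).const_mul (1 / 2)
  have hconst : (1 / 2 + ε) * volume.real (cell L) = ∫ _, (1 / 2 + ε) ∂(cellMeasure L) := by
    rw [integral_const, measureReal_restrict_apply_univ, smul_eq_mul, mul_comm]
  rw [← real_inner_self_eq_norm_sq, inner_eq_integral, hconst, ← integral_const_mul,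
    ← integral_add hwell (integrable_const _)]
  refine integral_mono (integrable_comp_of_inH2 hL hu hu (F := fun p => p.1 * p.2) (by fun_prop))
    (hwell.add (integrable_const _)) fun x => ?_
  have hsq : 1 / 2 * (u x ^ 2 - ε) ^ 2 + (1 / 2 + ε) - u x * u x =
      1 / 2 * (u x ^ 2 - ε - 1) ^ 2 := by ring
  exact sub_nonneg.1 (hsq ▸ by positivity)

lemma norm_add_norm_lap_le_of_energy_le (hL : ∀ i, 0 < L i) {ε c : ℝ} (hε : 0 ≤ ε) {u : L2 L}
    (hu : InH2 L u) (hc : energy L ε u ≤ c) :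
    ‖u‖ + ‖lap L u‖ ≤ 2 * √(8 * c + 2 * (2 + ε) ^ 2 * volume.real (cell L)) := by
  have hnorm := norm_sq_le_integral_double_well hL ε hu
  have hwell : 0 ≤ ∫ x, (u x ^ 2 - ε) ^ 2 ∂(cellMeasure L) := integral_nonneg fun x => sq_nonneg _
  have hlap : ‖lap L u‖ ≤ ‖u + lap L u‖ + ‖u‖ := by
    simpa only [add_sub_cancel_left] using norm_sub_le (u + lap L u) u
  have hvol : 0 ≤ ε * volume.real (cell L) := mul_nonneg hε measureReal_nonneg
  rw [energy] at hc
  set A := ‖u + lap L u‖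
  have hhalf : (‖u‖ + ‖lap L u‖) / 2 ≤ √(8 * c + 2 * (2 + ε) ^ 2 * volume.real (cell L)) := by
    refine Real.le_sqrt_of_sq_le ?_
    calc ((‖u‖ + ‖lap L u‖) / 2) ^ 2 ≤ ((‖u‖ + (A + ‖u‖)) / 2) ^ 2 := by gcongr
      _ ≤ 2 * ‖u‖ ^ 2 + A ^ 2 / 2 := by nlinarith [sq_nonneg (2 * ‖u‖ - A)]
      _ ≤ _ := by nlinarith [sq_nonneg A, measureReal_nonneg (μ := volume) (s := cell L)]
  linarith

lemma HasLaplacian.coef_zero (hL : ∀ i, 0 < L i) {u w : L2 L} (h : HasLaplacian L u w) :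
    coef w 0 = 0 := by
  rw [(hasLaplacian_iff_coef hL).1 h, freq_zero, neg_zero, zero_mul]

lemma bdf_eq_sum_range {V : Type*} [AddCommGroup V] [Module ℝ V] {k n : ℕ} (hn : k ≤ n) (τ : ℝ)
    (v : ℕ → V) :
    bdf k τ v n = (1 / τ) • ∑ i ∈ range k, bdfKernel k i • backDiff v (n - i) := by
  have hextend : ∑ i ∈ range k, bdfKernel k i • backDiff v (n - i) =
      ∑ i ∈ range n, bdfKernel k i • backDiff v (n - i) :=
    sum_subset (range_subset_range.2 hn) fun i _ hi => by
      rw [bdfKernel_eq_zero (by simpa using hi), zero_smul]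
  rw [bdf, hextend]
  congr 1
  refine sum_bij' (fun j _ => n - j) (fun i _ => n - i) ?_ ?_ ?_ ?_ ?_ <;>
    simp only [mem_Icc, mem_range]
  · omega
  · omega
  · omega
  · omega
  · exact fun j hj => by rw [Nat.sub_sub_self hj.2]

lemma coef_bdf {k n : ℕ} (hn : k ≤ n) (τ : ℝ) (v : ℕ → L2 L) (κ : Fin 2 → ℤ) :
    coef (bdf k τ v n) κ =
      1 / τ * ∑ i ∈ range k, bdfKernel k i * coef (backDiff v (n - i)) κ := by
  simp only [bdf_eq_sum_range hn, coef_smul, coef_sum]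

section Scheme

variable {k N : ℕ} {ε τ : ℝ} {φ : ℕ → L2 L}

lemma AssumptionA1.coef_eq (hL : ∀ i, 0 < L i) (hA1 : AssumptionA1 k L φ) {l : ℕ}
    (hl : l ≤ k - 1) : coef (φ l) 0 = coef (φ 0) 0 := by
  rcases Nat.eq_zero_or_pos l with rfl | hpos
  · rfl
  · exact (mean_eq_mean_iff hL).1 (hA1 l hpos hl)

/-- `D_k φⁿ` is a Laplacian, hence mean zero, and `b₀ ≠ 0`: the mean of `∇_τ φⁿ` is determined by
the means of the earlier differences. -/
lemma IsBDFSolution.coef_backDiff_zero (hφ : IsBDFSolution k L ε τ N φ) (hL : ∀ i, 0 < L i)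
    (hk : 0 < k) (hτ : 0 < τ) (hA1 : AssumptionA1 k L φ) {n : ℕ} (hn : n ≤ N) :
    coef (backDiff φ n) 0 = 0 := by
  induction n using Nat.strong_induction_on with
  | _ n ih =>
    by_cases hkn : k ≤ n
    · obtain ⟨μ, -, hμ⟩ := hφ n hkn hn
      have hmean := hμ.coef_zero hL
      have hearlier : ∀ i ∈ range k, i ≠ 0 →
          bdfKernel k i * coef (backDiff φ (n - i)) 0 = 0 := fun i _ hi => by
        rw [ih (n - i) (by omega) (by omega), mul_zero]
      rw [coef_bdf hkn, sum_eq_single_of_mem 0 (mem_range.2 hk) hearlier, Nat.sub_zero] at hmean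
      simpa [hτ.ne', (bdfKernel_zero_pos hk).ne'] using hmean
    · rw [backDiff, coef_sub, hA1.coef_eq hL (l := n) (by omega),
        hA1.coef_eq hL (l := n - 1) (by omega), sub_self]

end Scheme

lemma hasSum_gradFunctional (hL : ∀ i, 0 < L i) (k n : ℕ) {v : ℕ → L2 L}
    (hv : ∀ j ≤ n, coef (v j) 0 = 0) :
    HasSum (fun κ => (freq L κ)⁻¹ *
        gradFunctional k (fun x : ℝ => x ^ 2) (fun j => coef (v j) κ) n)
      (gradFunctional k (negNormSq L) v n) := by
  have hcur := hv n le_rfl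
  have hprev := fun i => hv (n - i) (Nat.sub_le _ _)
  have hsum₀ := hasSum_negNormSq hL hcur
  have hsum₁ := fun a : ℝ => hasSum_negNormSq hL (v := a • v n - v (n - 1)) (by simp [hcur, hprev])
  have hsum₂ := fun a : ℝ => hasSum_negNormSq hL (v := a • (v n - v (n - 1)) + v (n - 2))
    (by simp [hcur, hprev])
  have hsum₃ := hasSum_negNormSq hL
    (v := (2 : ℝ) • (v n - v (n - 1)) + (2 : ℝ) • v (n - 2) - v (n - 3)) (by simp [hcur, hprev])
  unfold gradFunctional
  split
  · refine ((hsum₀.mul_left _).add ((hsum₁ _).mul_left _)).congr_fun fun κ => ?_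
    simp only [coef_sub, coef_smul, smul_eq_mul]
    ring
  · refine (((hsum₀.mul_left _).add ((hsum₁ _).mul_left _)).add
      ((hsum₂ _).mul_left _)).congr_fun fun κ => ?_
    simp only [coef_add, coef_sub, coef_smul, smul_eq_mul]
    ring
  · refine ((((hsum₀.mul_left _).add ((hsum₁ _).mul_left _)).add ((hsum₂ _).mul_left _)).add
      (hsum₃.mul_left _)).congr_fun fun κ => ?_
    simp only [coef_add, coef_sub, coef_smul, smul_eq_mul]
    ring
  · simpa only [mul_zero] using hasSum_zero

lemma gradFunctional_negNormSq_nonneg (hL : ∀ i, 0 < L i) (k n : ℕ) {v : ℕ → L2 L}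
    (hv : ∀ j ≤ n, coef (v j) 0 = 0) : 0 ≤ gradFunctional k (negNormSq L) v n :=
  gradFunctional_nonneg k n fun a b c d => negNormSq_nonneg hL <| by
    simp [hv n le_rfl, fun i => hv (n - i) (Nat.sub_le _ _)]

lemma two_mul_mul_sq_add_nonneg {ε f : ℝ} (hε0 : 0 ≤ ε) (hε1 : ε ≤ 1) (hf : 0 ≤ f) :
    0 ≤ 2 * f * (1 - f) ^ 2 + ε * (3 - 2 * f) := by
  rcases le_total f (3 / 2) with hle | hle
  · have : 0 ≤ 3 - 2 * f := by linarith
    positivity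
  · have hlin : ε * (2 * f - 3) ≤ 2 * f - 3 := mul_le_of_le_one_left (by linarith) hε1
    nlinarith [mul_nonneg hf (sq_nonneg (3 * f - 4)), sq_nonneg (f - 3 / 2),
      mul_nonneg (sub_nonneg.2 hle) (sq_nonneg (f - 3 / 2))]

/-- The step restriction lets the dissipation `σ/(2τ) ‖·‖²_{-1}` of the gradient structure and
the convexity `½ ‖(1 + Δ)·‖²` absorb the concave part `ε/2 ‖·‖²`, mode by mode. -/
lemma half_eps_le_mode_dissipation {ε τ s f : ℝ} (hε0 : 0 < ε) (hε1 : ε ≤ 1) (hτ : 0 < τ)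
    (hs : τ ≤ 2 / (3 * ε) * s) (hf : 0 < f) :
    ε / 2 ≤ 1 / 2 * (1 - f) ^ 2 + 1 / τ * (f⁻¹ * (s / 2)) := by
  have hrate : 3 * ε / 2 ≤ s / τ := by
    rw [le_div_iff₀ hτ]
    calc 3 * ε / 2 * τ ≤ 3 * ε / 2 * (2 / (3 * ε) * s) := by gcongr
      _ = s := by field_simp
  have := two_mul_mul_sq_add_nonneg hε0.le hε1 hf.le
  calc ε / 2 ≤ ε / 2 + f⁻¹ / 4 * (2 * f * (1 - f) ^ 2 + ε * (3 - 2 * f)) :=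
        le_add_of_nonneg_right (by positivity)
    _ = 1 / 2 * (1 - f) ^ 2 + f⁻¹ / 2 * (3 * ε / 2) := by
        field_simp
        ring
    _ ≤ 1 / 2 * (1 - f) ^ 2 + f⁻¹ / 2 * (s / τ) := by gcongr
    _ = _ := by ring

lemma mode_dissipation {k n : ℕ} (hk : k ∈ Set.Icc 3 5) {ε τ f m : ℝ} {x : ℕ → ℝ}
    (hε0 : 0 < ε) (hε1 : ε ≤ 1) (hτ : 0 < τ) (hs : τ ≤ 2 / (3 * ε) * sigmaL k) (hf : 0 < f)
    (hm : 1 / τ * ∑ i ∈ range k, bdfKernel k i * x (n - i) = -f * m) :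
    1 / τ * (f⁻¹ * (gradFunctional k (fun y : ℝ => y ^ 2) x n -
        gradFunctional k (fun y : ℝ => y ^ 2) x (n - 1))) + m * x n + ε / 2 * x n ^ 2 ≤
      1 / 2 * (1 - f) ^ 2 * x n ^ 2 := by
  set S := ∑ i ∈ range k, bdfKernel k i * x (n - i)
  have hpotential : 1 / τ * (f⁻¹ * (x n * S)) = -(m * x n) :=
    calc 1 / τ * (f⁻¹ * (x n * S)) = f⁻¹ * x n * (1 / τ * S) := by ring
      _ = -(m * x n) := by
        rw [hm]
        field_simp
  have hgrad : 1 / τ * (f⁻¹ * (gradFunctional k (fun y : ℝ => y ^ 2) x n -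
      gradFunctional k (fun y : ℝ => y ^ 2) x (n - 1) + sigmaL k / 2 * x n ^ 2)) ≤
        1 / τ * (f⁻¹ * (x n * S)) := by
    gcongr
    exact gradFunctional_sub_le hk x
  have habsorb := mul_le_mul_of_nonneg_right (half_eps_le_mode_dissipation hε0 hε1 hτ hs hf)
    (sq_nonneg (x n))
  linarith

section Scheme

variable {k N : ℕ} {ε τ : ℝ} {φ : ℕ → L2 L}

theorem IsBDFSolution.modifiedEnergy_le_pred (hφ : IsBDFSolution k L ε τ N φ)
    (hL : ∀ i, 0 < L i) (hk : k ∈ Set.Icc 3 5) (hε0 : 0 < ε) (hε1 : ε ≤ 1) (hτ : 0 < τ)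
    (hs : τ ≤ 2 / (3 * ε) * sigmaL k) (hA1 : AssumptionA1 k L φ) {n : ℕ} (hkn : k ≤ n)
    (hn : n ≤ N) (hprev : InH2 L (φ (n - 1))) :
    modifiedEnergy k L ε τ φ n ≤ modifiedEnergy k L ε τ φ (n - 1) := by
  obtain ⟨μ, hμ, hD⟩ := hφ n hkn hn
  have hmean : ∀ j ≤ n, coef (backDiff φ j) 0 = 0 := fun j hj =>
    hφ.coef_backDiff_zero hL (by grind) hτ hA1 (hj.trans hn)
  have henergy : energy L ε (φ n) - energy L ε (φ (n - 1)) ≤ ⟪μ, backDiff φ n⟫_ℝ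
      - 1 / 2 * ‖(φ n + lap L (φ n)) - (φ (n - 1) + lap L (φ (n - 1)))‖ ^ 2
      + ε / 2 * ‖backDiff φ n‖ ^ 2 := energy_sub_le hL hμ hprev
  have hgrad := ((hasSum_gradFunctional hL k n hmean).sub (hasSum_gradFunctional hL k (n - 1)
    fun j hj => hmean j (hj.trans (Nat.sub_le _ _)))).mul_left (1 / τ)
  have hinner := hasSum_coef_mul_coef hL μ (backDiff φ n)
  have hnorm := (hasSum_coef_sq hL (backDiff φ n)).mul_left (ε / 2)
  have hquadratic := (hasSum_coef_sq hL
    ((φ n + lap L (φ n)) - (φ (n - 1) + lap L (φ (n - 1))))).mul_left (1 / 2)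
  have hmodes := hasSum_le (fun κ => ?_) ((hgrad.add hinner).add hnorm) hquadratic
  · rw [modifiedEnergy, modifiedEnergy]
    linarith
  have hfactor : coef ((φ n + lap L (φ n)) - (φ (n - 1) + lap L (φ (n - 1)))) κ =
      (1 - freq L κ) * coef (backDiff φ n) κ := by
    rw [backDiff, coef_sub, coef_sub, coef_add_lap hL hμ.1, coef_add_lap hL hprev]
    ring
  rw [hfactor]
  rcases eq_or_ne κ 0 with rfl | hκ
  · simp [hmean n le_rfl, freq_zero]
  · have hmode := mode_dissipation hk (x := fun j => coef (backDiff φ j) κ) hε0 hε1 hτ hs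
      (freq_pos hL hκ) ((coef_bdf hkn τ φ κ).symm.trans ((hasLaplacian_iff_coef hL).1 hD κ))
    linarith

theorem IsBDFSolution.energy_le (hφ : IsBDFSolution k L ε τ N φ) (hL : ∀ i, 0 < L i)
    (hk : k ∈ Set.Icc 3 5) (hε0 : 0 < ε) (hε1 : ε ≤ 1) (hτ : 0 < τ) {c₀ : ℝ}
    (hA2 : AssumptionA2 k L ε τ φ c₀) {n : ℕ} (hkn : k ≤ n) (hn : n ≤ N) :
    InH2 L (φ n) ∧ energy L ε (φ n) ≤ c₀ := by
  obtain ⟨hA1, hstep, hstart, hc₀⟩ := hA2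
  have hs : τ ≤ 2 / (3 * ε) * sigmaL k :=
    hstep.trans (mul_le_mul_of_nonneg_left (min_le_right _ _) (by positivity))
  have hmodified : ∀ m, k - 1 ≤ m → m ≤ N → InH2 L (φ m) ∧ modifiedEnergy k L ε τ φ m ≤ c₀ :=
    fun m hkm => by
      induction m, hkm using Nat.le_induction with
      | base => exact fun _ => ⟨hstart, hc₀⟩
      | succ m hkm ih =>
        intro hm
        obtain ⟨hprev, hdecay⟩ := ih (by omega)
        obtain ⟨_, hμ, -⟩ := hφ (m + 1) (by omega) hm
        exact ⟨hμ.1, (hφ.modifiedEnergy_le_pred hL hk hε0 hε1 hτ hs hA1 (by omega) hm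
          hprev).trans hdecay⟩
  obtain ⟨hH2, hmod⟩ := hmodified n (by omega) hn
  have hgrad := gradFunctional_negNormSq_nonneg hL k n fun j hj =>
    hφ.coef_backDiff_zero hL (by grind) hτ hA1 (hj.trans hn)
  have hnonneg : 0 ≤ 1 / τ * gradFunctional k (negNormSq L) (backDiff φ) n := by positivity
  rw [modifiedEnergy] at hmod
  exact ⟨hH2, by linarith⟩

end Scheme

end Energy

/-! ### Energy dissipation of the PFC equation -/

section Taylor

variable {E : Type*} [NormedAddCommGroup E] [NormedSpace ℝ E]

lemma norm_sub_taylorWithinEval_le {s : Set ℝ} (hs : Convex ℝ s) (hu : UniqueDiffOn ℝ s) {m : ℕ}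
    {f : ℝ → E} {M : ℝ} (hf : ContDiffOn ℝ (m + 1) f s)
    (hM : ∀ t ∈ s, ‖iteratedDerivWithin (m + 1) f s t‖ ≤ M) {t r : ℝ} (ht : t ∈ s) (hr : r ∈ s) :
    ‖f r - taylorWithinEval f m s t r‖ ≤ M * |r - t| ^ (m + 1) := by
  induction m generalizing f r with
  | zero =>
    have hderiv : ∀ x ∈ s, HasDerivWithinAt f (derivWithin f s x) s x := fun x hx =>
      (hf.differentiableOn (by simp) x hx).hasDerivWithinAt
    simpa using hs.norm_image_sub_le_of_norm_hasDerivWithin_le hderiv (by simpa using hM) ht hr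
  | succ m ih =>
    have hsub : Set.uIcc t r ⊆ s := hs.ordConnected.uIcc_subset ht hr
    have hderiv : ∀ x ∈ Set.uIcc t r, HasDerivWithinAt
        (fun x => f x - taylorWithinEval f (m + 1) s t x)
        (derivWithin f s x - taylorWithinEval (derivWithin f s) m s t x) (Set.uIcc t r) x :=
      fun x hx => ((hf.differentiableOn (by simp) x (hsub hx)).hasDerivWithinAt.mono hsub).sub
        (hasDerivAt_taylorWithinEval_succ f m).hasDerivWithinAt
    have hM0 : 0 ≤ M := (norm_nonneg _).trans (hM t ht)
    have hbound : ∀ x ∈ Set.uIcc t r,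
        ‖derivWithin f s x - taylorWithinEval (derivWithin f s) m s t x‖ ≤
          M * |r - t| ^ (m + 1) := fun x hx => by
      refine (ih (hf.derivWithin hu (by norm_cast)) ?_ (hsub hx)).trans ?_
      · simpa only [iteratedDerivWithin_succ'] using hM
      · have := Set.abs_sub_left_of_mem_uIcc hx
        gcongr
    have := (convex_uIcc t r).norm_image_sub_le_of_norm_hasDerivWithin_le hderiv hbound
      Set.left_mem_uIcc Set.right_mem_uIcc
    simpa [mul_assoc, ← pow_succ] using this

lemma norm_sub_sub_smul_derivWithin_le {s : Set ℝ} (hs : Convex ℝ s) (hu : UniqueDiffOn ℝ s)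
    {f : ℝ → E} {M : ℝ} (hf : ContDiffOn ℝ 2 f s)
    (hM : ∀ t ∈ s, ‖iteratedDerivWithin 2 f s t‖ ≤ M) {t r : ℝ} (ht : t ∈ s) (hr : r ∈ s) :
    ‖f t - f r - (t - r) • derivWithin f s t‖ ≤ M * (t - r) ^ 2 := by
  have hrem : f r - taylorWithinEval f 1 s t r = -(f t - f r - (t - r) • derivWithin f s t) := by
    rw [taylorWithinEval_succ, taylor_within_zero_eval]
    simp only [zero_add, iteratedDerivWithin_one]
    norm_num
    module
  have := norm_sub_taylorWithinEval_le (m := 1) hs hu (hf.of_le (by norm_num)) hM ht hr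
  rwa [hrem, norm_neg, sq_abs, sub_sq_comm] at this

end Taylor

lemma antitoneOn_of_sub_le_mul_sq {s : Set ℝ} (hs : Convex ℝ s) {f : ℝ → ℝ} {C : ℝ}
    (h : ∀ r ∈ s, ∀ t ∈ s, r ≤ t → f t - f r ≤ C * (t - r) ^ 2) : AntitoneOn f s := by
  -- Splitting at the midpoint shows that `C / 2` is admissible whenever `C` is.
  have halving : ∀ n : ℕ, ∀ r ∈ s, ∀ t ∈ s, r ≤ t → f t - f r ≤ C / 2 ^ n * (t - r) ^ 2 := by
    intro n
    induction n with
    | zero => simpa using h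
    | succ n ih =>
      intro r hr t ht hrt
      have hmid : midpoint ℝ r t ∈ s := hs.midpoint_mem hr ht
      have hleft := ih r hr _ hmid (left_le_midpoint.2 hrt)
      have hright := ih _ hmid t ht (midpoint_le_right.2 hrt)
      rw [midpoint_eq_smul_add, smul_eq_mul, invOf_eq_inv] at hleft hright
      rw [pow_succ]
      linear_combination hleft + hright
  intro r hr t ht hrt
  have hlim : Filter.Tendsto (fun n : ℕ => C / 2 ^ n * (t - r) ^ 2) Filter.atTop (nhds 0) := by
    simpa [div_eq_mul_inv] using
      ((tendsto_pow_atTop_nhds_zero_of_lt_one (r := (2 : ℝ)⁻¹) (by norm_num)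
        (by norm_num)).const_mul C).mul_const ((t - r) ^ 2)
  exact sub_nonpos.1 (ge_of_tendsto' hlim fun n => halving n r hr t ht hrt)

variable {L : Fin 2 → ℝ}

lemma exists_norm_invNegLap_le (hL : ∀ i, 0 < L i) :
    ∃ C : ℝ, 0 ≤ C ∧ ∀ v : L2 L, coef v 0 = 0 → ‖invNegLap L v‖ ≤ C * ‖v‖ := by
  obtain ⟨c, hc, hfreq⟩ := exists_le_freq hL
  refine ⟨c⁻¹, by positivity, fun v hv => ?_⟩
  have hsq : ‖invNegLap L v‖ ^ 2 ≤ (c⁻¹ * ‖v‖) ^ 2 := by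
    rw [mul_pow]
    refine hasSum_le (fun κ => ?_) (hasSum_coef_sq hL _) ((hasSum_coef_sq hL v).mul_left (c⁻¹ ^ 2))
    rw [coef_invNegLap hL hv, div_eq_inv_mul, mul_pow]
    obtain rfl | hκ := eq_or_ne κ 0
    · simp [hv]
    · have := hfreq κ hκ
      gcongr
      exact inv_nonneg.2 (freq_nonneg L κ)
  exact (sq_le_sq₀ (norm_nonneg _) (by positivity)).1 hsq

lemma HasLaplacian.inner_eq_neg_inner_invNegLap (hL : ∀ i, 0 < L i) {μ d v : L2 L}
    (h : HasLaplacian L μ d) (hv : coef v 0 = 0) : ⟪μ, v⟫_ℝ = -⟪invNegLap L d, v⟫_ℝ := by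
  rw [← inner_neg_left]
  refine (hasSum_coef_mul_coef hL _ _).unique
    ((hasSum_coef_mul_coef hL (-invNegLap L d) v).congr_fun fun κ => ?_)
  obtain rfl | hκ := eq_or_ne κ 0
  · simp [hv]
  · rw [coef_neg, coef_invNegLap hL (h.coef_zero hL), (hasLaplacian_iff_coef hL).1 h]
    have := (freq_pos hL hκ).ne'
    field_simp

lemma HasLaplacian.inner_smul_add_le {C h : ℝ} (hL : ∀ i, 0 < L i)
    (hC : ∀ v : L2 L, coef v 0 = 0 → ‖invNegLap L v‖ ≤ C * ‖v‖) {μ d w : L2 L}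
    (hμ : HasLaplacian L μ d) (hh : 0 ≤ h) (hw : coef w 0 = 0) :
    ⟪μ, h • d + w⟫_ℝ ≤ C * ‖d‖ * ‖w‖ := by
  have hd := hμ.coef_zero hL
  have hdiss : 0 ≤ h * ⟪invNegLap L d, d⟫_ℝ := mul_nonneg hh (negNormSq_nonneg hL hd)
  have hcs : -⟪invNegLap L d, w⟫_ℝ ≤ ‖invNegLap L d‖ * ‖w‖ :=
    (neg_le_abs _).trans (abs_real_inner_le_norm _ _)
  rw [hμ.inner_eq_neg_inner_invNegLap hL (by simp [hd, hw]), inner_add_right,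
    real_inner_smul_right]
  have := mul_le_mul_of_nonneg_right (hC d hd) (norm_nonneg w)
  linarith

section Solution

variable {ε T : ℝ} {Φ : ℝ → L2 L}

lemma IsPFCSolution.coef_zero_eq (hsol : IsPFCSolution L ε T Φ) (hL : ∀ i, 0 < L i)
    (hΦ : DifferentiableOn ℝ Φ (Set.Icc 0 T)) {r t : ℝ} (hr : r ∈ Set.Icc 0 T)
    (ht : t ∈ Set.Icc 0 T) : coef (Φ t) 0 = coef (Φ r) 0 := by
  have hderiv : ∀ s ∈ Set.Icc 0 T, HasDerivWithinAt (fun s => coef (Φ s) 0) 0 (Set.Icc 0 T) s :=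
    fun s hs => by
      obtain ⟨μ, -, hμ⟩ := hsol s hs
      refine HasDerivWithinAt.congr_deriv (f' := coef (derivWithin Φ (Set.Icc 0 T) s) 0) ?_
        (hμ.coef_zero hL)
      exact ((innerSL ℝ (waveLp L 0)).hasFDerivAt (x := Φ s)).comp_hasDerivWithinAt s
        (hΦ s hs).hasDerivWithinAt
  have := (convex_Icc 0 T).norm_image_sub_le_of_norm_hasDerivWithin_le hderiv
    (fun _ _ => norm_zero.le) hr ht
  rwa [zero_mul, norm_le_zero_iff, sub_eq_zero] at this

lemma IsPFCSolution.energy_antitoneOn (hsol : IsPFCSolution L ε T Φ) (hL : ∀ i, 0 < L i)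
    (hε : 0 ≤ ε) (hT : 0 < T) (hΦ : ContDiffOn ℝ 2 Φ (Set.Icc 0 T)) :
    AntitoneOn (fun t => energy L ε (Φ t)) (Set.Icc 0 T) := by
  have hu := uniqueDiffOn_Icc hT
  have hdiff : DifferentiableOn ℝ Φ (Set.Icc 0 T) := hΦ.differentiableOn (by simp)
  obtain ⟨C, hC0, hC⟩ := exists_norm_invNegLap_le hL
  obtain ⟨M, hM⟩ := isCompact_Icc.exists_bound_of_continuousOn
    (hΦ.continuousOn_derivWithin hu (by simp))
  obtain ⟨K, hK⟩ := isCompact_Icc.exists_bound_of_continuousOn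
    (hΦ.continuousOn_iteratedDerivWithin (m := 2) (by simp) hu)
  refine antitoneOn_of_sub_le_mul_sq (convex_Icc 0 T) (C := C * M * K + ε / 2 * M ^ 2)
    fun r hr t ht hrt => ?_
  have hM0 : 0 ≤ M := (norm_nonneg _).trans (hM t ht)
  obtain ⟨μ, hμ, hd⟩ := hsol t ht
  set d := derivWithin Φ (Set.Icc 0 T) t
  set w := Φ t - Φ r - (t - r) • d with w_def
  have hw : ‖w‖ ≤ K * (t - r) ^ 2 :=
    norm_sub_sub_smul_derivWithin_le (convex_Icc 0 T) hu hΦ hK ht hr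
  have hw0 : coef w 0 = 0 := by
    simp [w_def, hd.coef_zero hL, hsol.coef_zero_eq hL hdiff hr ht]
  have hincr : ‖Φ t - Φ r‖ ≤ M * (t - r) := by
    have := (convex_Icc 0 T).norm_image_sub_le_of_norm_hasDerivWithin_le
      (fun s hs => (hdiff s hs).hasDerivWithinAt) hM hr ht
    rwa [Real.norm_of_nonneg (sub_nonneg.2 hrt)] at this
  have hinner : ⟪μ, Φ t - Φ r⟫_ℝ ≤ C * M * (K * (t - r) ^ 2) := by
    have hsplit : Φ t - Φ r = (t - r) • d + w := by rw [w_def]; abel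
    rw [hsplit]
    refine (hd.inner_smul_add_le hL hC (sub_nonneg.2 hrt) hw0).trans ?_
    have := hM t ht
    gcongr
  have hsq : ε / 2 * ‖Φ t - Φ r‖ ^ 2 ≤ ε / 2 * (M * (t - r)) ^ 2 := by gcongr
  have := energy_sub_le hL hμ (hsol r hr).choose_spec.1.1
  have : 0 ≤ ‖(Φ t + lap L (Φ t)) - (Φ r + lap L (Φ r))‖ ^ 2 := by positivity
  linarith

end Solution

/-! ### Consistency of the BDF formulas -/

section Consistency

variable {E : Type*} [NormedAddCommGroup E] [NormedSpace ℝ E] {k : ℕ}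

lemma sum_bdfKernel_smul_polynomial_sub (hk : k ∈ Set.Icc 3 5) (c : ℕ → E) (τ : ℝ) :
    ∑ i ∈ range k, bdfKernel k i • (∑ m ∈ range (k + 1), (-(i * τ)) ^ m • c m -
      ∑ m ∈ range (k + 1), (-((i + 1 : ℕ) * τ)) ^ m • c m) = τ • c 1 := by
  obtain ⟨hk3, hk5⟩ := hk
  interval_cases k <;>
    simp only [sum_range_succ, sum_range_zero, bdfKernel_three, bdfKernel_four, bdfKernel_five] <;>
    norm_num <;> module

lemma bdf_sub {V : Type*} [AddCommGroup V] [Module ℝ V] (k : ℕ) (τ : ℝ) (u v : ℕ → V) (n : ℕ) :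
    bdf k τ (fun j => u j - v j) n = bdf k τ u n - bdf k τ v n := by
  simp only [bdf, backDiff, ← smul_sub, ← sum_sub_distrib, sub_sub_sub_comm]

lemma norm_bdf_le (hk : k ∈ Set.Icc 3 5) {n : ℕ} (hkn : k ≤ n) {τ B : ℝ} (hτ : 0 < τ)
    {v : ℕ → E} (hv : ∀ j ≤ k, ‖v (n - j)‖ ≤ B) : ‖bdf k τ v n‖ ≤ 1 / τ * (30 * B) := by
  have hB : 0 ≤ B := (norm_nonneg _).trans (hv 0 k.zero_le)
  have hterm : ∀ i ∈ range k, ‖bdfKernel k i • backDiff v (n - i)‖ ≤ 3 * (B + B) := fun i hi => by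
    have hi : i < k := mem_range.1 hi
    rw [norm_smul, backDiff, Nat.sub_sub]
    have := abs_bdfKernel_le hk i
    have := (norm_sub_le _ _).trans (add_le_add (hv i hi.le) (hv (i + 1) hi))
    gcongr
    exact abs_bdfKernel_le hk i
  have hk5 : (k : ℝ) ≤ 5 := by exact_mod_cast hk.2
  rw [bdf_eq_sum_range hkn, norm_smul, Real.norm_of_nonneg (by positivity)]
  gcongr
  refine (norm_sum_le_of_le _ hterm).trans ?_
  rw [sum_const, card_range, nsmul_eq_mul]
  linarith [mul_le_mul_of_nonneg_right hk5 hB]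

lemma bdf_taylorWithinEval (hk : k ∈ Set.Icc 3 5) {n : ℕ} (hkn : k ≤ n) {τ : ℝ} (hτ : τ ≠ 0)
    (f : ℝ → E) (s : Set ℝ) :
    bdf k τ (fun j => taylorWithinEval f k s (n * τ) (j * τ)) n = derivWithin f s (n * τ) := by
  have hpoly : ∀ j ≤ k, taylorWithinEval f k s (n * τ) ((n - j : ℕ) * τ) =
      ∑ m ∈ range (k + 1), (-(j * τ)) ^ m •
        ((m.factorial : ℝ)⁻¹ • iteratedDerivWithin m f s (n * τ)) := fun j hj => by
    rw [taylor_within_apply]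
    refine sum_congr rfl fun m _ => ?_
    rw [smul_smul, mul_comm, Nat.cast_sub (hj.trans hkn)]
    ring_nf
  rw [bdf_eq_sum_range hkn]
  have hsum := sum_bdfKernel_smul_polynomial_sub hk
    (fun m => (m.factorial : ℝ)⁻¹ • iteratedDerivWithin m f s (n * τ)) τ
  rw [sum_congr rfl fun i hi => by
    rw [backDiff, Nat.sub_sub, hpoly i (mem_range.1 hi).le, hpoly (i + 1) (mem_range.1 hi)], hsum]
  simp [smul_smul, hτ, iteratedDerivWithin_one]

lemma norm_bdf_sub_derivWithin_le (hk : k ∈ Set.Icc 3 5) {n : ℕ} (hkn : k ≤ n) {T M τ : ℝ}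
    (hτ : 0 < τ) (hn : n * τ ≤ T) {f : ℝ → E} (hf : ContDiffOn ℝ (k + 1) f (Set.Icc 0 T))
    (hM : ∀ t ∈ Set.Icc 0 T, ‖iteratedDerivWithin (k + 1) f (Set.Icc 0 T) t‖ ≤ M) :
    ‖bdf k τ (fun j => f (j * τ)) n - derivWithin f (Set.Icc 0 T) (n * τ)‖ ≤
      30 * 5 ^ 6 * M * τ ^ k := by
  have hn0 : (0 : ℝ) < n := by exact_mod_cast (by grind : 0 < n)
  have hmem : (n : ℝ) * τ ∈ Set.Icc 0 T := ⟨by positivity, hn⟩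
  have hM0 : 0 ≤ M := (norm_nonneg _).trans (hM _ hmem)
  have hremainder : ∀ j ≤ k, ‖f ((n - j : ℕ) * τ) -
      taylorWithinEval f k (Set.Icc 0 T) (n * τ) ((n - j : ℕ) * τ)‖ ≤
        M * (5 * τ) ^ (k + 1) := fun j hj => by
    have hjn : ((n - j : ℕ) : ℝ) = n - j := Nat.cast_sub (hj.trans hkn)
    have hj5 : (j : ℝ) ≤ 5 := by exact_mod_cast hj.trans hk.2
    refine (norm_sub_taylorWithinEval_le (convex_Icc 0 T)
      (uniqueDiffOn_Icc ((by positivity : 0 < n * τ).trans_le hn)) hf hM hmem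
      ⟨by positivity, le_trans (by gcongr; omega) hn⟩).trans ?_
    rw [hjn, ← sub_mul, sub_sub_cancel_left, neg_mul, abs_neg, abs_of_nonneg (by positivity)]
    gcongr
  have hpow : (5 : ℝ) ^ (k + 1) ≤ 5 ^ 6 := pow_le_pow_right₀ (by norm_num) (by grind)
  rw [← bdf_taylorWithinEval hk hkn hτ.ne' f (Set.Icc 0 T), ← bdf_sub]
  calc _ ≤ 1 / τ * (30 * (M * (5 * τ) ^ (k + 1))) := norm_bdf_le hk hkn hτ hremainder
    _ = 30 * 5 ^ (k + 1) * M * τ ^ k := by rw [mul_pow, pow_succ τ]; field_simp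
    _ ≤ _ := by gcongr

end Consistency

/-! ### Stability of the linearized scheme -/

section Gronwall

lemma le_mul_exp_of_le_add_sum {B : ℕ → ℝ} {Q c : ℝ} {N : ℕ} (hB : ∀ n, 0 ≤ B n) (hc : 0 ≤ c)
    (hc2 : c ≤ 1 / 2) (h : ∀ n ≤ N, B n ≤ Q + c * ∑ p ∈ range (n + 1), B p) :
    B N ≤ Q * Real.exp (2 * c * (N + 1 : ℕ)) := by
  have hexp : 1 ≤ (1 - c) * Real.exp (2 * c) := by
    nlinarith [Real.add_one_le_exp (2 * c)]
  have hmajorant : ∀ n ≤ N + 1, Q + c * ∑ p ∈ range n, B p ≤ Q * Real.exp (2 * c * n) := by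
    intro n
    induction n with
    | zero => simp
    | succ n ih =>
      intro hn
      set U := Q + c * ∑ p ∈ range (n + 1), B p with U_def
      have hBU : B n ≤ U := h n (by omega)
      have hU : 0 ≤ U := (hB n).trans hBU
      have hstep : (1 - c) * U ≤ Q + c * ∑ p ∈ range n, B p := by
        rw [sum_range_succ] at U_def
        linarith [mul_le_mul_of_nonneg_left hBU hc]
      calc U ≤ ((1 - c) * Real.exp (2 * c)) * U := le_mul_of_one_le_left hU hexp
        _ = (1 - c) * U * Real.exp (2 * c) := by ring
        _ ≤ Q * Real.exp (2 * c * n) * Real.exp (2 * c) :=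
          mul_le_mul_of_nonneg_right (hstep.trans (ih (by omega))) (Real.exp_pos _).le
        _ = _ := by rw [mul_assoc, ← Real.exp_add]; push_cast; ring_nf
  exact (h N le_rfl).trans (hmajorant (N + 1) le_rfl)

lemma le_mul_exp_of_sq_le_add_sum {E w : ℕ → ℝ} {S c : ℝ} {N : ℕ} (hE : ∀ n, 0 ≤ E n)
    (hw : ∀ n, 0 ≤ w n) (hS : 0 ≤ S) (hc : 0 ≤ c) (hc2 : c ≤ 1 / 2)
    (h : ∀ n ≤ N, E n ^ 2 ≤ S ^ 2 + c * ∑ p ∈ range (n + 1), E p ^ 2 +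
      ∑ p ∈ range (n + 1), E p * w p) :
    E N ≤ (S + ∑ p ∈ range (N + 1), w p) * Real.exp (2 * c * (N + 1 : ℕ)) := by
  have hBnonneg : ∀ n, 0 ≤ partialSups E n := fun n => (hE n).trans (le_partialSups E n)
  -- The square is removed by dividing by the largest of `E 0, …, E n`.
  refine (le_partialSups E N).trans (le_mul_exp_of_le_add_sum hBnonneg hc hc2 fun n hn => ?_)
  obtain ⟨m, hmn, hm⟩ := exists_partialSups_eq E n
  have hsum : c * ∑ p ∈ range (m + 1), partialSups E p ≤
      c * ∑ p ∈ range (n + 1), partialSups E p := by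
    gcongr
    exact fun p _ _ => hBnonneg p
  have hwsum : ∑ p ∈ range (m + 1), w p ≤ ∑ p ∈ range (N + 1), w p :=
    sum_le_sum_of_subset_of_nonneg (range_subset_range.2 (by omega)) fun p _ _ => hw p
  have hsum0 : 0 ≤ c * ∑ p ∈ range (m + 1), partialSups E p :=
    mul_nonneg hc (sum_nonneg fun p _ => hBnonneg p)
  rw [hm]
  rcases le_or_gt (E m) S with hmS | hSm
  · linarith [sum_nonneg fun p (_ : p ∈ range (N + 1)) => hw p]
  have hle : ∀ p ∈ range (m + 1), E p ≤ E m := fun p hp =>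
    (le_partialSups_of_le E (by grind)).trans_eq hm
  have hsq : ∑ p ∈ range (m + 1), E p ^ 2 ≤ E m * ∑ p ∈ range (m + 1), partialSups E p := by
    rw [mul_sum]
    refine sum_le_sum fun p hp => ?_
    rw [pow_two]
    exact mul_le_mul (hle p hp) (le_partialSups E p) (hE p) (hE m)
  have hprod : ∑ p ∈ range (m + 1), E p * w p ≤ E m * ∑ p ∈ range (m + 1), w p := by
    rw [mul_sum]
    exact sum_le_sum fun p hp => mul_le_mul_of_nonneg_right (hle p hp) (hw p)
  have hdiv : E m ≤ S + c * ∑ p ∈ range (m + 1), partialSups E p + ∑ p ∈ range (m + 1), w p := by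
    refine le_of_mul_le_mul_left ?_ (hS.trans_lt hSm)
    have := mul_le_mul_of_nonneg_left hsq hc
    have := mul_le_mul_of_nonneg_right hSm.le hS
    linarith [h m (hmn.trans hn)]
  linarith

end Gronwall

section Mode

variable {k : ℕ}

/-- What remains of the increment `∇_τ e^{k+p}` once the DOC kernels have inverted the BDF formula
and the elliptic part of the equation is set aside: the consistency errors `ξ` and the starting
values `e^0, …, e^{k-1}`. -/
def perturbation {V : Type*} [AddCommGroup V] [Module ℝ V] (k : ℕ) (τ : ℝ) (e ξ : ℕ → V)
    (p : ℕ) : V :=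
  τ • ∑ i ∈ range (p + 1), docKernel k (p - i) • ξ i -
    ∑ l ∈ Icc 1 (k - 1), startWeight k l (k + p) • backDiff e l

lemma sum_Icc_add {M : Type*} [AddCommMonoid M] (k p : ℕ) (f : ℕ → M) :
    ∑ j ∈ Icc k (k + p), f j = ∑ i ∈ range (p + 1), f (k + i) := by
  rw [← Ico_succ_right_eq_Icc, Order.succ_eq_add_one, sum_Ico_eq_sum_range]
  congr 2
  omega

lemma conv_add (f g h : ℕ → ℝ) (p : ℕ) :
    conv f (fun i => g i + h i) p = conv f g p + conv f h p := by
  simp only [conv, mul_add, sum_add_distrib]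

lemma conv_const_mul (f g : ℕ → ℝ) (c : ℝ) (p : ℕ) :
    conv f (fun i => c * g i) p = c * conv f g p := by
  simp only [conv, mul_sum, mul_left_comm]

lemma conv_bdfKernel_eq (hk : 0 < k) {τ : ℝ} (hτ : τ ≠ 0) (a : ℕ → ℝ) (i : ℕ) :
    conv (bdfKernel k) (fun i => backDiff a (k + i)) i = τ * bdf k τ a (k + i) -
      ∑ l ∈ Icc 1 (k - 1), bdfKernel k (k + i - l) * backDiff a l := by
  have hunion : Icc 1 (k + i) = Icc 1 (k - 1) ∪ Icc k (k + i) := by grind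
  have hdisj : Disjoint (Icc 1 (k - 1)) (Icc k (k + i)) := by
    rw [disjoint_left]
    grind
  rw [bdf, smul_eq_mul, ← mul_assoc, mul_one_div_cancel hτ, one_mul, hunion, sum_union hdisj]
  simp only [smul_eq_mul, add_sub_cancel_left, sum_Icc_add, conv, Nat.add_sub_add_left]

lemma backDiff_eq_conv_add_perturbation (hk : 0 < k) {τ : ℝ} (hτ : τ ≠ 0) {a F z : ℕ → ℝ} {p : ℕ}
    (h : ∀ i ≤ p, bdf k τ a (k + i) = F i + z i) :
    backDiff a (k + p) = τ * conv (docKernel k) F p + perturbation k τ a z p := by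
  have hinv := congr_fun (conv_conv_of_mk_mul_mk_eq_one (f := bdfKernel k) (g := docKernel k)
    (by rw [mul_comm, mk_docKernel_mul_mk_bdfKernel hk]) fun i => backDiff a (k + i)) p
  have hstart : ∑ i ∈ range (p + 1), docKernel k (p - i) *
      ∑ l ∈ Icc 1 (k - 1), bdfKernel k (k + i - l) * backDiff a l =
      ∑ l ∈ Icc 1 (k - 1), startWeight k l (k + p) * backDiff a l := by
    simp only [mul_sum]
    rw [sum_comm]
    simp only [startWeight, sum_Icc_add, sum_mul, Nat.add_sub_add_left, mul_assoc]
  rw [← hinv, conv, sum_congr rfl fun i hi => by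
    rw [conv_bdfKernel_eq hk hτ, h i (by grind), mul_sub], sum_sub_distrib, hstart, perturbation]
  simp only [conv, smul_eq_mul, mul_add, sum_add_distrib, mul_sum, mul_left_comm, add_sub_assoc]

lemma sq_sub_sq_le_sum_mul_backDiff (a : ℕ → ℝ) (k M : ℕ) :
    a (k + M) ^ 2 - a (k - 1) ^ 2 ≤ 2 * ∑ p ∈ range (M + 1), a (k + p) * backDiff a (k + p) := by
  have hstep : ∀ n, a n ^ 2 - a (n - 1) ^ 2 ≤ 2 * (a n * backDiff a n) := fun n => by
    rw [backDiff]
    linarith [sq_nonneg (a n - a (n - 1))]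
  induction M with
  | zero => simpa using hstep k
  | succ M ih =>
    rw [sum_range_succ, mul_add]
    have := hstep (k + (M + 1))
    rw [show k + (M + 1) - 1 = k + M by omega] at this
    linarith

lemma sq_le_mul_one_sub_sq_add {f : ℝ} (hf : 0 ≤ f) : f ^ 2 ≤ f * (1 - f) ^ 2 + 4 := by
  linarith [mul_nonneg hf (sq_nonneg (f - 2)), sq_nonneg (f - 2)]

lemma neg_symbol_mul_sum_conv_le {θ : ℕ → ℝ} {s K f : ℝ} (hs : 0 < s) (hθ : IsCoerciveKernel s θ)
    (hK : IsL2BoundedKernel K θ) (hf : 0 ≤ f) (x g : ℕ → ℝ) (M : ℕ) :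
    ∑ p ∈ range M, x p * conv θ (fun i => -f * ((1 - f) ^ 2 * x i + g i)) p ≤
      4 * s * ∑ p ∈ range M, x p ^ 2 + K / (4 * s) * ∑ p ∈ range M, g p ^ 2 := by
  have hyoung : ∀ p, x p * conv θ (fun i => -f * ((1 - f) ^ 2 * x i + g i)) p ≤
      -(f * (1 - f) ^ 2) * (x p * conv θ x p) + s * f ^ 2 * x p ^ 2 +
        1 / (4 * s) * conv θ g p ^ 2 := fun p => by
    have hsq : 0 ≤ 1 / (4 * s) * (2 * s * f * x p + conv θ g p) ^ 2 := by positivity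
    have hexpand : 1 / (4 * s) * (2 * s * f * x p + conv θ g p) ^ 2 =
        s * f ^ 2 * x p ^ 2 + f * x p * conv θ g p + 1 / (4 * s) * conv θ g p ^ 2 := by
      field_simp
      ring
    rw [conv_const_mul, conv_add, conv_const_mul]
    linarith
  refine (sum_le_sum fun p _ => hyoung p).trans ?_
  simp only [sum_add_distrib, ← mul_sum]
  have hcoercive := mul_le_mul_of_nonneg_left (hθ x M) (by positivity : 0 ≤ f * (1 - f) ^ 2)
  have hbounded := mul_le_mul_of_nonneg_left (hK g M) (by positivity : 0 ≤ 1 / (4 * s))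
  have hX : 0 ≤ s * ∑ p ∈ range M, x p ^ 2 := by positivity
  have hsymbol := mul_le_mul_of_nonneg_right (sq_le_mul_one_sub_sq_add hf) hX
  have hfactor : 1 / (4 * s) * (K * ∑ p ∈ range M, g p ^ 2) =
      K / (4 * s) * ∑ p ∈ range M, g p ^ 2 := by ring
  linarith

lemma sq_le_of_bdf_eq (hk : k ∈ Set.Icc 3 5) {f τ : ℝ} (hf : 0 ≤ f) (hτ : 0 < τ)
    {a g z : ℕ → ℝ} {M : ℕ}
    (h : ∀ p ≤ M, bdf k τ a (k + p) = -f * ((1 - f) ^ 2 * a (k + p) + g p) + z p) :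
    a (k + M) ^ 2 ≤ a (k - 1) ^ 2 +
      τ * ∑ p ∈ range (M + 1), (sigmaL k / 25 * a (k + p) ^ 2 + 400 / sigmaL k ^ 3 * g p ^ 2) +
      2 * ∑ p ∈ range (M + 1), a (k + p) * perturbation k τ a z p := by
  have hσ := sigmaL_pos hk
  have htelescope := sq_sub_sq_le_sum_mul_backDiff a k M
  rw [sum_congr rfl fun p hp => by
    rw [backDiff_eq_conv_add_perturbation (by grind) hτ.ne' fun i hi => h i (by grind), mul_add,
      mul_left_comm], sum_add_distrib, ← mul_sum] at htelescope
  have hsymbol := mul_le_mul_of_nonneg_left (neg_symbol_mul_sum_conv_le (by positivity)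
    (isCoerciveKernel_docKernel hk) (isL2BoundedKernel_docKernel hk) hf
    (fun p => a (k + p)) g (M + 1)) hτ.le
  have hconst : 1 / (sigmaL k / 2) ^ 2 / (4 * (sigmaL k / 2 / 100)) = 400 / sigmaL k ^ 3 / 2 := by
    field_simp
    norm_num
  rw [hconst] at hsymbol
  rw [sum_add_distrib, ← mul_sum, ← mul_sum]
  linarith

end Mode

section Perturbation

lemma sum_norm_backDiff_le {V : Type*} [NormedAddCommGroup V] (e : ℕ → V) (k : ℕ) :
    ∑ l ∈ Icc 1 (k - 1), ‖backDiff e l‖ ≤ 2 * ∑ l ∈ range k, ‖e l‖ := by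
  have hcur : ∑ l ∈ Icc 1 (k - 1), ‖e l‖ ≤ ∑ l ∈ range k, ‖e l‖ :=
    sum_le_sum_of_subset_of_nonneg (fun l hl => by grind) fun l _ _ => norm_nonneg _
  have hprev : ∑ l ∈ Icc 1 (k - 1), ‖e (l - 1)‖ ≤ ∑ l ∈ range k, ‖e l‖ := by
    rw [← sum_image (s := Icc 1 (k - 1)) (g := fun l => l - 1) (f := fun l => ‖e l‖)
      fun i hi j hj h => by simp only [coe_Icc, Set.mem_Icc] at hi hj h; omega]
    exact sum_le_sum_of_subset_of_nonneg (fun l hl => by grind) fun l _ _ => norm_nonneg _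
  calc ∑ l ∈ Icc 1 (k - 1), ‖backDiff e l‖
      ≤ ∑ l ∈ Icc 1 (k - 1), (‖e l‖ + ‖e (l - 1)‖) := sum_le_sum fun l _ => norm_sub_le _ _
    _ ≤ _ := by rw [sum_add_distrib]; linarith

variable {V : Type*} [NormedAddCommGroup V] [NormedSpace ℝ V] {k : ℕ}

lemma rho_mul_geom_sum_le (hk : k ∈ Set.Icc 3 5) (n : ℕ) :
    rho k / 4 * ∑ i ∈ range n, ((k : ℝ) / 7) ^ i ≤ m3 k / 2 := by
  have hρ := rho_pos hk
  have hk7 : (k : ℝ) < 7 := by exact_mod_cast (by grind : k < 7)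
  have hgeom : ∑ i ∈ range n, ((k : ℝ) / 7) ^ i ≤ 1 / (1 - (k : ℝ) / 7) := by
    simpa using geom_sum_Ico_le_of_lt_one (m := 0) (n := n) (x := (k : ℝ) / 7) (by positivity)
      (by linarith)
  have : (7 : ℝ) - k ≠ 0 := by linarith
  calc rho k / 4 * ∑ i ∈ range n, ((k : ℝ) / 7) ^ i
      ≤ rho k / 4 * (1 / (1 - (k : ℝ) / 7)) := by gcongr
    _ = m3 k / 2 := by rw [m3]; field_simp; norm_num

lemma norm_perturbation_le (hk : k ∈ Set.Icc 3 5) {τ Ξ : ℝ} (hτ : 0 ≤ τ) (e : ℕ → V) {ξ : ℕ → V}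
    {p : ℕ} (hξ : ∀ i ≤ p, ‖ξ i‖ ≤ Ξ) :
    ‖perturbation k τ e ξ p‖ ≤ τ * (m3 k / 2 * Ξ) +
      startConst k * (∑ l ∈ range k, ‖e l‖) * (rho k / 4 * ((k : ℝ) / 7) ^ p) := by
  have hρ := rho_pos hk
  have hC := one_lt_startConst hk
  have hΞ : 0 ≤ Ξ := (norm_nonneg _).trans (hξ 0 p.zero_le)
  have hconsistency : ‖∑ i ∈ range (p + 1), docKernel k (p - i) • ξ i‖ ≤ m3 k / 2 * Ξ :=
    calc _ ≤ ∑ i ∈ range (p + 1), rho k / 4 * ((k : ℝ) / 7) ^ (p - i) * Ξ :=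
          norm_sum_le_of_le _ fun i hi => by
            rw [norm_smul]
            exact mul_le_mul (abs_docKernel_le hk _) (hξ i (by grind)) (norm_nonneg _)
              (by positivity)
      _ = rho k / 4 * (∑ i ∈ range (p + 1), ((k : ℝ) / 7) ^ i) * Ξ := by
          rw [← sum_mul, ← mul_sum, ← sum_range_reflect fun i => ((k : ℝ) / 7) ^ i]
          simp only [add_tsub_cancel_right]
      _ ≤ _ := mul_le_mul_of_nonneg_right (rho_mul_geom_sum_le hk _) hΞ
  have hstart : ‖∑ l ∈ Icc 1 (k - 1), startWeight k l (k + p) • backDiff e l‖ ≤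
      startConst k * (∑ l ∈ range k, ‖e l‖) * (rho k / 4 * ((k : ℝ) / 7) ^ p) :=
    calc _ ≤ ∑ l ∈ Icc 1 (k - 1),
            startConst k * rho k / 8 * ((k : ℝ) / 7) ^ p * ‖backDiff e l‖ :=
          norm_sum_le_of_le _ fun l hl => by
            have hweight := abs_startWeight_le hk (mem_Icc.1 hl).2 (k.le_add_right p)
            rw [Nat.add_sub_cancel_left] at hweight
            rw [norm_smul]
            exact mul_le_mul_of_nonneg_right hweight (norm_nonneg _)
      _ ≤ startConst k * rho k / 8 * ((k : ℝ) / 7) ^ p * (2 * ∑ l ∈ range k, ‖e l‖) := by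
          rw [← mul_sum]
          gcongr
          exact sum_norm_backDiff_le e k
      _ = _ := by ring
  refine (norm_sub_le _ _).trans (add_le_add ?_ hstart)
  rw [norm_smul, Real.norm_of_nonneg hτ]
  exact mul_le_mul_of_nonneg_left hconsistency hτ

lemma sum_norm_perturbation_le (hk : k ∈ Set.Icc 3 5) {τ Ξ : ℝ} (hτ : 0 ≤ τ) (e : ℕ → V)
    {ξ : ℕ → V} {M : ℕ} (hξ : ∀ i ≤ M, ‖ξ i‖ ≤ Ξ) :
    ∑ p ∈ range (M + 1), ‖perturbation k τ e ξ p‖ ≤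
      m3 k / 2 * (startConst k * ∑ l ∈ range k, ‖e l‖ + Ξ * ((M + 1 : ℕ) * τ)) := by
  have := one_lt_startConst hk
  have hstart : 0 ≤ startConst k * ∑ l ∈ range k, ‖e l‖ := by positivity
  have hgeom := mul_le_mul_of_nonneg_left (rho_mul_geom_sum_le hk (M + 1)) hstart
  refine (sum_le_sum fun p hp => norm_perturbation_le hk hτ e
    fun i hi => hξ i (by grind)).trans ?_
  rw [sum_add_distrib, sum_const, card_range, nsmul_eq_mul, ← mul_sum, ← mul_sum]
  linarith

end Perturbation

section Stability

variable {L : Fin 2 → ℝ} {k M : ℕ} {τ : ℝ} {e g ξ : ℕ → L2 L}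

lemma coef_perturbation (k : ℕ) (τ : ℝ) (e ξ : ℕ → L2 L) (p : ℕ) (κ : Fin 2 → ℤ) :
    coef (perturbation k τ e ξ p) κ =
      perturbation k τ (fun j => coef (e j) κ) (fun i => coef (ξ i) κ) p := by
  simp only [perturbation, coef_sub, coef_smul, coef_sum, coef_backDiff, smul_eq_mul]

lemma norm_sq_le_of_coef_bdf_eq (hL : ∀ i, 0 < L i) (hk : k ∈ Set.Icc 3 5) (hτ : 0 < τ)
    (h : ∀ p ≤ M, ∀ κ, coef (bdf k τ e (k + p)) κ =
      -freq L κ * ((1 - freq L κ) ^ 2 * coef (e (k + p)) κ + coef (g p) κ) + coef (ξ p) κ) :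
    ‖e (k + M)‖ ^ 2 ≤ ‖e (k - 1)‖ ^ 2 +
      τ * ∑ p ∈ range (M + 1),
        (sigmaL k / 25 * ‖e (k + p)‖ ^ 2 + 400 / sigmaL k ^ 3 * ‖g p‖ ^ 2) +
      2 * ∑ p ∈ range (M + 1), ⟪e (k + p), perturbation k τ e ξ p⟫_ℝ := by
  refine hasSum_le (fun κ => ?_) (hasSum_coef_sq hL (e (k + M)))
    (((hasSum_coef_sq hL (e (k - 1))).add ((hasSum_sum fun p _ =>
      ((hasSum_coef_sq hL (e (k + p))).mul_left (sigmaL k / 25)).add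
        ((hasSum_coef_sq hL (g p)).mul_left (400 / sigmaL k ^ 3))).mul_left τ)).add
      ((hasSum_sum fun p _ =>
        hasSum_coef_mul_coef hL (e (k + p)) (perturbation k τ e ξ p)).mul_left 2))
  simp only [coef_perturbation]
  refine sq_le_of_bdf_eq hk (freq_nonneg L κ) hτ (a := fun j => coef (e j) κ) fun p hp => ?_
  rw [← h p hp κ]
  simp only [bdf, coef_smul, coef_sum, coef_backDiff, smul_eq_mul]

lemma norm_sq_le_add_sum_norm_perturbation (hL : ∀ i, 0 < L i) (hk : k ∈ Set.Icc 3 5) (hτ : 0 < τ)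
    {a c : ℝ} (hc : sigmaL k / 25 + 400 / sigmaL k ^ 3 * a ^ 2 ≤ c)
    (h : ∀ p ≤ M, ∀ κ, coef (bdf k τ e (k + p)) κ =
      -freq L κ * ((1 - freq L κ) ^ 2 * coef (e (k + p)) κ + coef (g p) κ) + coef (ξ p) κ)
    (hg : ∀ p ≤ M, ‖g p‖ ≤ a * ‖e (k + p)‖) :
    ‖e (k + M)‖ ^ 2 ≤ ‖e (k - 1)‖ ^ 2 + c * τ * ∑ p ∈ range (M + 1), ‖e (k + p)‖ ^ 2 +
      ∑ p ∈ range (M + 1), ‖e (k + p)‖ * (2 * ‖perturbation k τ e ξ p‖) := by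
  have hσ := sigmaL_pos hk
  refine (norm_sq_le_of_coef_bdf_eq hL hk hτ h).trans ?_
  rw [mul_sum, mul_sum, mul_sum]
  refine add_le_add (add_le_add le_rfl (sum_le_sum fun p hp => ?_)) (sum_le_sum fun p _ => ?_)
  · have hgp : ‖g p‖ ^ 2 ≤ a ^ 2 * ‖e (k + p)‖ ^ 2 := by
      rw [← mul_pow]
      exact pow_le_pow_left₀ (norm_nonneg _) (hg p (by grind)) 2
    calc _ ≤ τ * (sigmaL k / 25 * ‖e (k + p)‖ ^ 2 +
            400 / sigmaL k ^ 3 * (a ^ 2 * ‖e (k + p)‖ ^ 2)) := by gcongr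
      _ = τ * ((sigmaL k / 25 + 400 / sigmaL k ^ 3 * a ^ 2) * ‖e (k + p)‖ ^ 2) := by ring
      _ ≤ τ * (c * ‖e (k + p)‖ ^ 2) := by gcongr
      _ = c * τ * ‖e (k + p)‖ ^ 2 := by ring
  · linarith [real_inner_le_norm (e (k + p)) (perturbation k τ e ξ p)]

lemma one_le_m3 (hk : k ∈ Set.Icc 3 5) : 1 ≤ m3 k := by
  obtain ⟨hk3, hk5⟩ := hk
  interval_cases k <;> norm_num [m3, rho]

theorem norm_le_of_coef_bdf_eq (hL : ∀ i, 0 < L i) (hk : k ∈ Set.Icc 3 5) (hτ : 0 < τ)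
    {a c Ξ : ℝ} (hc : sigmaL k / 25 + 400 / sigmaL k ^ 3 * a ^ 2 ≤ c) (hcτ : c * τ ≤ 1 / 2)
    (h : ∀ p ≤ M, ∀ κ, coef (bdf k τ e (k + p)) κ =
      -freq L κ * ((1 - freq L κ) ^ 2 * coef (e (k + p)) κ + coef (g p) κ) + coef (ξ p) κ)
    (hg : ∀ p ≤ M, ‖g p‖ ≤ a * ‖e (k + p)‖) (hξ : ∀ p ≤ M, ‖ξ p‖ ≤ Ξ) :
    ‖e (k + M)‖ ≤ 2 * m3 k * Real.exp (2 * c * ((M + 1 : ℕ) * τ)) *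
      (startConst k * ∑ l ∈ range k, ‖e l‖ + Ξ * ((M + 1 : ℕ) * τ)) := by
  have hσ := sigmaL_pos hk
  have hc0 : 0 ≤ c := le_trans (by positivity) hc
  have hΞ : 0 ≤ Ξ := (norm_nonneg _).trans (hξ 0 M.zero_le)
  set S := ∑ l ∈ range k, ‖e l‖
  set R := startConst k * S + Ξ * ((M + 1 : ℕ) * τ)
  have hS : ‖e (k - 1)‖ ≤ S :=
    single_le_sum (f := fun l => ‖e l‖) (fun l _ => norm_nonneg _) (by grind)
  have hSR : S ≤ R := le_add_of_le_of_nonneg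
    (le_mul_of_one_le_left (by positivity) (one_lt_startConst hk).le) (by positivity)
  have hRm3 : R ≤ m3 k * R :=
    le_mul_of_one_le_left (((norm_nonneg _).trans hS).trans hSR) (one_le_m3 hk)
  have hperturbation := sum_norm_perturbation_le hk hτ.le e hξ
  calc ‖e (k + M)‖
      ≤ (‖e (k - 1)‖ + ∑ p ∈ range (M + 1), 2 * ‖perturbation k τ e ξ p‖) *
          Real.exp (2 * (c * τ) * (M + 1 : ℕ)) :=
        le_mul_exp_of_sq_le_add_sum (E := fun p => ‖e (k + p)‖) (fun _ => norm_nonneg _)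
          (fun _ => by positivity) (norm_nonneg _) (by positivity) hcτ fun n hn =>
          norm_sq_le_add_sum_norm_perturbation hL hk hτ hc (fun p hp => h p (hp.trans hn))
            fun p hp => hg p (hp.trans hn)
    _ ≤ 2 * m3 k * R * Real.exp (2 * (c * τ) * (M + 1 : ℕ)) := by
        rw [← mul_sum]
        gcongr
        linarith
    _ = _ := by rw [mul_right_comm]; congr 3; ring

end Stability

/-! ### Uniform bounds and convergence -/

section UniformBounds

variable {L : Fin 2 → ℝ} {ε : ℝ}

lemma eLpNorm_top_le {u : L2 L} {C : ℝ} (h : ∀ᵐ x ∂(cellMeasure L), |u x| ≤ C) :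
    eLpNorm u ⊤ (cellMeasure L) ≤ ENNReal.ofReal C := by
  rw [eLpNorm_exponent_top]
  exact eLpNormEssSup_le_of_ae_bound h

theorem exists_ae_abs_le_c1 (hL : ∀ i, 0 < L i) : ∃ cΩ : ℝ, 0 < cΩ ∧
    (∀ u : L2 L, InH2 L u → ∀ᵐ x ∂(cellMeasure L), |u x| ≤ cΩ * (‖u‖ + ‖lap L u‖)) ∧
    ∀ ε : ℝ, 0 ≤ ε → ∀ (u : L2 L) (c : ℝ), InH2 L u → energy L ε u ≤ c →
      ∀ᵐ x ∂(cellMeasure L), |u x| ≤ c1 L ε cΩ c := by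
  obtain ⟨C, hC, hsobolev⟩ := exists_sobolev_embedding hL
  refine ⟨2 * C, by positivity, fun u hu => ?_, fun ε hε u c hu hc => ?_⟩
  · filter_upwards [hsobolev u hu] with x hx
    have : 0 ≤ C * (‖u‖ + ‖lap L u‖) := by positivity
    linarith
  · have henergy := mul_le_mul_of_nonneg_left (norm_add_norm_lap_le_of_energy_le hL hε hu hc) hC.le
    filter_upwards [hsobolev u hu] with x hx
    rw [c1]
    linarith

lemma IsPFCSolution.ae_abs_le {T : ℝ} {Φ : ℝ → L2 L} (hsol : IsPFCSolution L ε T Φ)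
    (hL : ∀ i, 0 < L i) (hε : 0 ≤ ε) (hΦ : ContDiffOn ℝ 2 Φ (Set.Icc 0 T)) {B : ℝ}
    (hB : ∀ u, InH2 L u → energy L ε u ≤ energy L ε (Φ 0) → ∀ᵐ x ∂(cellMeasure L), |u x| ≤ B)
    (hT : 0 < T) : ∀ t ∈ Set.Icc 0 T, ∀ᵐ x ∂(cellMeasure L), |Φ t x| ≤ B := fun t ht => by
  obtain ⟨μ, hμ, -⟩ := hsol t ht
  exact hB _ hμ.1 (hsol.energy_antitoneOn hL hε hT hΦ ⟨le_rfl, hT.le⟩ ht ht.1)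

end UniformBounds

section Nonlinearity

variable {L : Fin 2 → ℝ} {ε a b : ℝ}

lemma abs_cubic_sub_le {x y : ℝ} (hε : 0 ≤ ε) (hx : |x| ≤ b) (hy : |y| ≤ a) :
    |(x ^ 3 - ε * x) - (y ^ 3 - ε * y)| ≤ c3 ε a b * |x - y| := by
  have hfactor : (x ^ 3 - ε * x) - (y ^ 3 - ε * y) = (x ^ 2 + x * y + y ^ 2 - ε) * (x - y) := by
    ring
  have hx2 : x ^ 2 ≤ b ^ 2 := sq_le_sq' (abs_le.1 hx).1 (abs_le.1 hx).2
  have hy2 : y ^ 2 ≤ a ^ 2 := sq_le_sq' (abs_le.1 hy).1 (abs_le.1 hy).2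
  have hxy : |x * y| ≤ a * b := by
    rw [abs_mul, mul_comm a]
    exact mul_le_mul hx hy (abs_nonneg _) ((abs_nonneg _).trans hx)
  rw [hfactor, abs_mul]
  refine mul_le_mul_of_nonneg_right ?_ (abs_nonneg _)
  rw [c3, abs_le]
  constructor <;> linarith [abs_le.1 hxy, sq_nonneg x, sq_nonneg y, sq_nonneg a, sq_nonneg b]

lemma norm_nonlinearity_sub_le (hε : 0 ≤ ε) {u w μ ν : L2 L} (hμ : IsChemicalPotential L ε u μ)
    (hν : IsChemicalPotential L ε w ν) (hu : ∀ᵐ x ∂(cellMeasure L), |u x| ≤ b)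
    (hw : ∀ᵐ x ∂(cellMeasure L), |w x| ≤ a) :
    ‖(μ - oneAddLapSq L u) - (ν - oneAddLapSq L w)‖ ≤ c3 ε a b * ‖u - w‖ := by
  refine Lp.norm_le_mul_norm_of_ae_le_mul ?_
  filter_upwards [hμ.2.2, hν.2.2, hu, hw, Lp.coeFn_sub u w, Lp.coeFn_sub μ (oneAddLapSq L u),
    Lp.coeFn_sub ν (oneAddLapSq L w),
    Lp.coeFn_sub (μ - oneAddLapSq L u) (ν - oneAddLapSq L w)] with x hμx hνx hux hwx h₁ h₂ h₃ h₄
  simp only [h₁, h₂, h₃, h₄, Pi.sub_apply, Real.norm_eq_abs, hμx, hνx]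
  refine le_of_eq_of_le (congrArg _ ?_) (abs_cubic_sub_le hε hux hwx)
  simp only [oneAddLapSq]
  ring

end Nonlinearity

section Convergence

variable {L : Fin 2 → ℝ} {k N n : ℕ} {ε T τ : ℝ} {Φ : ℝ → L2 L} {φ : ℕ → L2 L}

theorem IsBDFSolution.norm_sub_le (hφ : IsBDFSolution k L ε τ N φ) (hsol : IsPFCSolution L ε T Φ)
    (hL : ∀ i, 0 < L i) (hk : k ∈ Set.Icc 3 5) (hε : 0 ≤ ε) (hτ : 0 < τ) (hNT : N * τ = T)
    (hΦ : ContDiffOn ℝ (k + 1) Φ (Set.Icc 0 T)) {M a b c : ℝ}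
    (hM : ∀ t ∈ Set.Icc 0 T, ‖iteratedDerivWithin (k + 1) Φ (Set.Icc 0 T) t‖ ≤ M)
    (hb : ∀ t ∈ Set.Icc 0 T, ∀ᵐ x ∂(cellMeasure L), |Φ t x| ≤ b)
    (ha : ∀ j, k ≤ j → j ≤ N → ∀ᵐ x ∂(cellMeasure L), |φ j x| ≤ a)
    (hc : sigmaL k / 25 + 400 / sigmaL k ^ 3 * c3 ε a b ^ 2 ≤ c) (hcτ : c * τ ≤ 1 / 2)
    (hkn : k ≤ n) (hn : n ≤ N) :
    ‖Φ (n * τ) - φ n‖ ≤ 2 * m3 k * Real.exp (2 * c * ((n - k + 1 : ℕ) * τ)) *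
      (startConst k * ∑ l ∈ range k, ‖Φ (l * τ) - φ l‖ +
        30 * 5 ^ 6 * M * τ ^ k * ((n - k + 1 : ℕ) * τ)) := by
  obtain ⟨p, rfl⟩ := Nat.exists_eq_add_of_le hkn
  have htime : ∀ j ≤ N, (j : ℝ) * τ ∈ Set.Icc 0 T := fun j hj =>
    ⟨by positivity, hNT ▸ by gcongr⟩
  choose! μ hμ hμΔ using hsol
  choose! ν hν hνΔ using hφ
  rw [Nat.add_sub_cancel_left]
  refine norm_le_of_coef_bdf_eq hL hk hτ (e := fun j => Φ (j * τ) - φ j)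
    (g := fun i => (μ ((k + i : ℕ) * τ) - oneAddLapSq L (Φ ((k + i : ℕ) * τ))) -
      (ν (k + i) - oneAddLapSq L (φ (k + i))))
    (ξ := fun i => bdf k τ (fun j => Φ (j * τ)) (k + i) -
      derivWithin Φ (Set.Icc 0 T) ((k + i : ℕ) * τ))
    hc hcτ (fun i hi κ => ?_) (fun i hi => ?_) fun i hi => ?_
  · have hμi := hμ _ (htime (k + i) (by omega))
    have hνi := hν (k + i) (by omega) (by omega)
    rw [bdf_sub]
    simp only [coef_sub, coef_oneAddLapSq hL hμi.1 hμi.2.1, coef_oneAddLapSq hL hνi.1 hνi.2.1,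
      (hasLaplacian_iff_coef hL).1 (hμΔ _ (htime (k + i) (by omega))),
      (hasLaplacian_iff_coef hL).1 (hνΔ (k + i) (by omega) (by omega))]
    ring
  · exact norm_nonlinearity_sub_le hε (hμ _ (htime (k + i) (by omega)))
      (hν (k + i) (by omega) (by omega)) (hb _ (htime (k + i) (by omega)))
      (ha (k + i) (by omega) (by omega))
  · exact norm_bdf_sub_derivWithin_le hk (by omega) hτ (htime (k + i) (by omega)).2 hΦ hM

lemma le_c4 (hk : k ∈ Set.Icc 3 5) (a : ℝ) :
    sigmaL k / 25 + 400 / sigmaL k ^ 3 * a ^ 2 ≤ c4 k 100 a := by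
  obtain ⟨hk3, hk5⟩ := hk
  interval_cases k <;> norm_num [c4, m1, m3, sigmaL, rho] <;> linarith [sq_nonneg a]

theorem IsPFCSolution.exists_norm_sub_le (hsol : IsPFCSolution L ε T Φ) (hL : ∀ i, 0 < L i)
    (hk : k ∈ Set.Icc 3 5) (hε0 : 0 < ε) (hε1 : ε ≤ 1) (hT : 0 < T)
    (hΦ : ContDiffOn ℝ (k + 1) Φ (Set.Icc 0 T)) {cΩ c₂ : ℝ}
    (hcΩ : ∀ (u : L2 L) (c : ℝ), InH2 L u → energy L ε u ≤ c →
      ∀ᵐ x ∂(cellMeasure L), |u x| ≤ c1 L ε cΩ c)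
    (hc₂ : ∀ t ∈ Set.Icc 0 T, ∀ᵐ x ∂(cellMeasure L), |Φ t x| ≤ c₂) :
    ∃ C : ℝ, 0 < C ∧ ∀ (c₀ : ℝ) (N : ℕ) (τ : ℝ) (φ : ℕ → L2 L), 0 < N → τ = T / N →
      AssumptionA2 k L ε τ φ c₀ → IsBDFSolution k L ε τ N φ →
      τ ≤ 1 / (2 * c4 k 100 (c3 ε (c1 L ε cΩ c₀) c₂)) → ∀ n : ℕ, k ≤ n → n ≤ N →
      ‖Φ (n * τ) - φ n‖ ≤ 7 * rho k / (7 - (k : ℝ)) *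
        Real.exp (2 * c4 k 100 (c3 ε (c1 L ε cΩ c₀) c₂) * ((n - k + 1 : ℕ) * τ)) *
        (startConst k * ∑ l ∈ range k, ‖Φ (l * τ) - φ l‖ + C * ((n - k + 1 : ℕ) * τ) * τ ^ k) := by
  obtain ⟨M, hM⟩ := isCompact_Icc.exists_bound_of_continuousOn
    (hΦ.continuousOn_iteratedDerivWithin le_rfl (uniqueDiffOn_Icc hT))
  have hM0 : 0 ≤ M := (norm_nonneg _).trans (hM 0 ⟨le_rfl, hT.le⟩)
  refine ⟨30 * 5 ^ 6 * M + 1, by positivity, fun c₀ N τ φ hN hτN hA2 hφ hτc n hkn hn => ?_⟩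
  have hτ : 0 < τ := hτN ▸ by positivity
  have hNT : N * τ = T := by rw [hτN]; field_simp
  set c := c4 k 100 (c3 ε (c1 L ε cΩ c₀) c₂)
  have hσ := sigmaL_pos hk
  have hc : 0 < c := lt_of_lt_of_le (by positivity) (le_c4 hk _)
  have hcτ : c * τ ≤ 1 / 2 := by
    rw [le_div_iff₀ (by positivity)] at hτc
    linarith
  have hρ := rho_pos hk
  have hk7 : (0 : ℝ) < 7 - k := sub_pos.2 (by exact_mod_cast (by grind : k < 7))
  calc ‖Φ (n * τ) - φ n‖
      ≤ 2 * m3 k * Real.exp (2 * c * ((n - k + 1 : ℕ) * τ)) *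
          (startConst k * ∑ l ∈ range k, ‖Φ (l * τ) - φ l‖ +
            30 * 5 ^ 6 * M * τ ^ k * ((n - k + 1 : ℕ) * τ)) :=
        hφ.norm_sub_le hsol hL hk hε0.le hτ hNT hΦ hM hc₂ (fun j hkj hj =>
          have henergy := hφ.energy_le hL hk hε0 hε1 hτ hA2 hkj hj
          hcΩ _ _ henergy.1 henergy.2) (le_c4 hk _) hcτ hkn hn
    _ ≤ _ := by
        rw [m3, ← mul_div_assoc, mul_div_mul_left _ _ two_ne_zero, mul_right_comm _ (τ ^ k)]
        gcongr
        exact le_add_of_nonneg_right (zero_le_one (α := ℝ))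

end Convergence

end PFC

end

theorem mainTheorem3 :
    -- constants depending on `k` only
    ∃ m2 cI : ℕ → ℝ,
      (∀ k : ℕ, 3 ≤ k → k ≤ 5 →
        0 < m2 k ∧
        (∀ (m : ℕ) (lam : ℝ),
          Module.End.HasEigenvalue
            (Matrix.toLin' ((PFC.bdfMatrix k m).transpose * PFC.bdfMatrix k m)) lam →
          lam ≤ m2 k) ∧
        1 < cI k ∧
        (∀ (v : ℕ → ℝ) (n : ℕ), k ≤ n →
          |PFC.startingEffect k v n| ≤
            cI k * PFC.rho k / 8 * ((k : ℝ) / 7) ^ (n - k) *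
              ∑ l ∈ Finset.Icc 1 (k - 1), |PFC.backDiff v l|)) ∧
      ∀ L : Fin 2 → ℝ, (∀ i, 0 < L i) →
        -- the embedding constant depends on the domain only
        ∃ cΩ : ℝ, 0 < cΩ ∧
          (∀ v : PFC.L2 L, PFC.InH2 L v →
            eLpNorm v ⊤ (PFC.cellMeasure L) ≤ ENNReal.ofReal (cΩ * (‖v‖ + ‖PFC.lap L v‖))) ∧
          ∀ ε : ℝ, 0 < ε → ε < 1 →
            -- the bound of the exact solution depends on the problem and the initial data only
            ∀ Φ₀ : PFC.L2 L, ∃ c₂ : ℝ, 0 < c₂ ∧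
              ∀ k : ℕ, 3 ≤ k → k ≤ 5 →
                ∀ T : ℝ, 0 < T → ∀ Φ : ℝ → PFC.L2 L,
                  Φ 0 = Φ₀ →
                  ContDiffOn ℝ ((k + 1 : ℕ) : WithTop ℕ∞) Φ (Set.Icc 0 T) →
                  PFC.IsPFCSolution L ε T Φ →
                  (∀ t ∈ Set.Icc 0 T,
                    eLpNorm (Φ t) ⊤ (PFC.cellMeasure L) ≤ ENNReal.ofReal c₂) ∧
                  ∃ Cφ : ℝ, 0 < Cφ ∧
                    ∀ (c₀ : ℝ) (N : ℕ) (τ : ℝ) (φ : ℕ → PFC.L2 L),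
                      0 < N → τ = T / N →
                      PFC.AssumptionA2 k L ε τ φ c₀ →
                      PFC.IsBDFSolution k L ε τ N φ →
                      τ ≤ 1 / (2 * PFC.c4 k (m2 k) (PFC.c3 ε (PFC.c1 L ε cΩ c₀) c₂)) →
                      ∀ n : ℕ, k ≤ n → n ≤ N →
                        ‖Φ (n * τ) - φ n‖ ≤
                          7 * PFC.rho k / (7 - (k : ℝ)) *
                            Real.exp (2 * PFC.c4 k (m2 k) (PFC.c3 ε (PFC.c1 L ε cΩ c₀) c₂) *
                              (((n - k + 1 : ℕ) : ℝ) * τ)) *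
                            (cI k * ∑ l ∈ Finset.range k, ‖Φ (l * τ) - φ l‖ +
                              Cφ * (((n - k + 1 : ℕ) : ℝ) * τ) * τ ^ k) := by
  refine ⟨fun _ => 100, PFC.startConst, fun k hk3 hk5 => ⟨by norm_num,
    fun _ _ => PFC.eigenvalue_bdfMatrix_le ⟨hk3, hk5⟩, PFC.one_lt_startConst ⟨hk3, hk5⟩,
    fun v n hn => PFC.abs_startingEffect_le ⟨hk3, hk5⟩ hn v⟩, fun L hL => ?_⟩
  obtain ⟨cΩ, hcΩ, hsobolev, henergy⟩ := PFC.exists_ae_abs_le_c1 hL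
  refine ⟨cΩ, hcΩ, fun v hv => PFC.eLpNorm_top_le (hsobolev v hv), fun ε hε0 hε1 Φ₀ => ?_⟩
  have hc1 : 0 ≤ PFC.c1 L ε cΩ (PFC.energy L ε Φ₀) := mul_nonneg hcΩ.le (Real.sqrt_nonneg _)
  refine ⟨PFC.c1 L ε cΩ (PFC.energy L ε Φ₀) + 1, by positivity,
    fun k hk3 hk5 T hT Φ hΦ₀ hΦ hsol => ?_⟩
  have hbound : ∀ t ∈ Set.Icc 0 T, ∀ᵐ x ∂(PFC.cellMeasure L),
      |Φ t x| ≤ PFC.c1 L ε cΩ (PFC.energy L ε Φ₀) + 1 :=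
    hsol.ae_abs_le hL hε0.le (hΦ.of_le (by exact_mod_cast (by omega : 2 ≤ k + 1)))
      (fun u hu hEu => (henergy ε hε0.le u _ hu (hΦ₀ ▸ hEu)).mono
        fun x hx => hx.trans (le_add_of_nonneg_right zero_le_one)) hT
  exact ⟨fun t ht => PFC.eLpNorm_top_le (hbound t ht),
    hsol.exists_norm_sub_le hL ⟨hk3, hk5⟩ hε0 hε1.le hT (by exact_mod_cast hΦ)
      (henergy ε hε0.le) hbound⟩
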